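/- Let $n>2$, let $\Omega\subset\mathbb{R}^n$ be a bounded type-A domain (open, connected, and with a constant $A>0$ such that $|\Omega\cap B_r(x)|\ge A r^n$ for all $x\in\Omega$, $0<r<\operatorname{diam}\Omega$), let $B\subset\Omega$ be an open $n$-disc, and let $\Sigma\subset B$ be a compact set of (Hausdorff) codimension $\mu=n-\dim_H\Sigma$. Let $E$ be a finite-dimensional real inner product space ($E=\mathbb{R}$ in the scalar case). Let $\omega$ be a smooth $E$-valued 1-form on $\Omega\setminus\Sigma$ and $\nu$ a smooth $\operatorname{End}(E)$-valued 1-form on $\Omega\setminus\Sigma$ (an ordinary 1-form if $E=\mathbb{R}$), and put $Q=|\omega|^2=\sum_i|\omega_i|^2$. Suppose that on $\Omega\setminus\Sigma$ $$\delta(\rho(Q)\omega)=\xi(\omega),\qquad d\omega=\nu\wedge\omega ,$$ where $\delta$ is the formal adjoint of $d$, and that for some constants $\kappa,q>0$ and $k\ge 0$: (i) the function $\rho$ is continuous on $[0,\infty)$, $C^1$ on $(0,\infty)$, and satisfies $$\kappa^{-1}(Q+k)^q\le\rho(Q)+2Q\rho'(Q)\le\kappa(Q+k)^q\quad\text{for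 all } Q>0;$$ (ii) $\xi$ is a differentiable $E$-valued function of the value of $\omega$ (a scalar function if $E=\mathbb{R}$), with $|\xi'(w)|\le\kappa(|w|^2+k)^q$ for every $E$-valued covector $w$. Assume further: (iii) if $n>4$, then $\mu>2n/(n-2)$ and $\omega\in L^{n(q+1)}(B)$; (iv) if $n=3$ or $n=4$, then $\mu>2$ and $\omega\in L^{4(q+1)\beta\gamma_1}(B)\cap L^{4(q+1)\gamma_2}(B)$ for some $\tfrac12<\gamma_1<\gamma_2$ and some $0<\varepsilon<\mu-2$, where $\beta=(\mu-\varepsilon)/(\mu-2-\varepsilon)$; (v) $|\nabla\nu|+|\nu|^2\in L^s(B)$ for some $s>n/2$. Then $\omega$ is bounded on compact subdomains of $\Omega$: for every compact $K\subset\Omega$ there is a constant $C$ with $|\omega(x)|\le C$ for all $x\in K\setminus\Sigma$. -/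

import Mathlib

open MeasureTheory Set

noncomputable section

/-- Type-A domain: the balls centred in `Ω`, up to the diameter of `Ω`, meet `Ω` in a fixed
fraction of the volume `r ^ n`. -/
def IsTypeA {n : ℕ} (Ω : Set (EuclideanSpace ℝ (Fin n))) : Prop :=
  ∃ A : ℝ, 0 < A ∧ ∀ x ∈ Ω, ∀ r : ℝ, 0 < r → r < Metric.diam Ω →
    ENNReal.ofReal (A * r ^ n) ≤ volume (Ω ∩ Metric.ball x r)

/-- The (Hausdorff) codimension of a subset of `ℝⁿ`. -/
def codimension {n : ℕ} (S : Set (EuclideanSpace ℝ (Fin n))) : ℝ :=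
  (n : ℝ) - (dimH S).toReal

section Forms

variable {n : ℕ} {E : Type*} [NormedAddCommGroup E] [InnerProductSpace ℝ E]

/-- `Q = |w|²` for an `E`-valued covector `w` on `ℝⁿ`: the sum of the squared norms of its
components in the standard basis (for `E = ℝ` this is `w ∧ *w`). -/
def Qsq (w : EuclideanSpace ℝ (Fin n) →L[ℝ] E) : ℝ :=
  ∑ i : Fin n, ‖w (EuclideanSpace.single i 1)‖ ^ 2

/-- The codifferential `δ` of an `E`-valued 1-form, i.e. the formal adjoint of `d` on
`E`-valued functions: `δ α = - ∑ᵢ ∂ᵢ αᵢ`. -/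
def codiff (α : EuclideanSpace ℝ (Fin n) → EuclideanSpace ℝ (Fin n) →L[ℝ] E)
    (x : EuclideanSpace ℝ (Fin n)) : E :=
  -∑ i : Fin n, fderiv ℝ α x (EuclideanSpace.single i 1) (EuclideanSpace.single i 1)

/-- The exterior derivative of an `E`-valued 1-form, as a 2-form: Mathlib's `extDeriv`, after
a covector is regarded as an alternating map in one variable. -/
def dOne (ω : EuclideanSpace ℝ (Fin n) → EuclideanSpace ℝ (Fin n) →L[ℝ] E)
    (x : EuclideanSpace ℝ (Fin n)) : EuclideanSpace ℝ (Fin n) [⋀^Fin 2]→L[ℝ] E :=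
  extDeriv (fun y => ContinuousAlternatingMap.ofSubsingleton ℝ
    (EuclideanSpace ℝ (Fin n)) E (0 : Fin 1) (ω y)) x

/-- `(ν ∧ w)(u, v) = ν(u) w(v) - ν(v) w(u)` for an endomorphism-valued covector `ν` and an
`E`-valued covector `w`. -/
def wedgeOne (ν : EuclideanSpace ℝ (Fin n) →L[ℝ] E →L[ℝ] E)
    (w : EuclideanSpace ℝ (Fin n) →L[ℝ] E) (u v : EuclideanSpace ℝ (Fin n)) : E :=
  ν u (w v) - ν v (w u)

/-- `|∇ν| = (∑ᵢ |∂ᵢ ν|²)^(1/2)` for an endomorphism-valued 1-form `ν`. -/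
def gradNorm
    (ν : EuclideanSpace ℝ (Fin n) → EuclideanSpace ℝ (Fin n) →L[ℝ] E →L[ℝ] E)
    (x : EuclideanSpace ℝ (Fin n)) : ℝ :=
  √(∑ i : Fin n, ‖fderiv ℝ ν x (EuclideanSpace.single i 1)‖ ^ 2)

end Forms

end

/-! ### Calculus preliminaries: cutoffs, fast geometric decay, Cauchy–Schwarz. -/

section Analysis

open scoped Topology ENNReal NNReal

/-! Away from `S` the form is continuous, so only a neighbourhood of `S` matters, and there `Q =
|ω|²` is bounded by De Giorgi iteration on its superlevel sets.

The starting point is a Caccioppoli inequality (`energy_estimate`). With `α = ρ(Q)ω` and the test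
form `φ = ζ² g(Q) ω`, two integrations by parts give `∫ ∑ᵢⱼ ⟨∂ⱼαᵢ, ∂ᵢφⱼ⟩ = ∫ ⟨div α, div φ⟩`, and
`div α = -ξ(ω)`. This is an integrated Bochner identity that differentiates `α` only once, so that
`ρ` of class `C¹` and the growth of `ξ` suffice. The equation `dω = ν ∧ ω` makes `∂ᵢωⱼ - ∂ⱼωᵢ` of
size `|ν||ω|`, hence `⟨∂ⱼαᵢ, ∂ᵢφⱼ⟩` is a coercive quadratic form up to lower order terms. Coercivity
rests on `ρ` and `ρ + 2Qρ'`, the eigenvalues of the derivative of `w ↦ ρ(|w|²)w`; both are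
comparable with `Q^q` for `Q ≥ 1` (`density_bounds`), and `g` vanishes below `1`. Young's inequality
then bounds the weighted integral of `|∇Q|²/Q` by one of `Q(1 + |ν|²)` and `Q|∇ζ|²`.

The Sobolev inequality for a truncation of `ζ Q^((q+1)/2)` turns this into a reverse Hölder
inequality between the levels `t + 2τ` and `t` (`level_set_estimate`), for `ζ` supported off `S`.

To reach `S`, take `ζ = ψχ` with `χ` vanishing near `S`. Codimension larger than `p` gives `S` zero
`p`-capacity (`exists_cutoff`), so `‖∇χ‖_p` can tend to zero, and the error `∫ |∇χ|² Q^(q+1)`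
vanishes by Hölder if `Q^(q+1) ∈ L^(p/(p-2))`. The integrability hypotheses on `ω` supply such a `p`
(`exists_removability_exponent`). The other cutoff `ψ` costs nothing: its gradient lives on a
compact annulus away from `S`, where `Q` is bounded, and only levels above that bound are used
(`level_set_estimate_across`).

Since `|ν|² ∈ L^s` with `s > n/2`, Hölder makes the inequality superlinear in the level-set
integrals. They are small at a high enough starting level, so they vanish at twice that level
(`ae_bounded_of_level_set_estimate`). -/

/-- The solution is regular only on an open set; its products with cutoffs become global functions
of the same class. -/
theorem contDiff_of_contDiffOn_tsupport {V G : Type*} [NormedAddCommGroup V] [NormedSpace ℝ V]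
    [NormedAddCommGroup G] [NormedSpace ℝ G] {m : WithTop ℕ∞} {u : V → G} {U : Set V}
    (hU : IsOpen U) (hu : ContDiffOn ℝ m u U) (hs : tsupport u ⊆ U) : ContDiff ℝ m u := by
  rw [contDiff_iff_contDiffAt]
  intro x
  by_cases hx : x ∈ U
  · exact hu.contDiffAt (hU.mem_nhds hx)
  · have : u =ᶠ[𝓝 x] 0 := notMem_tsupport_iff_eventuallyEq.1 fun h => hx (hs h)
    exact (contDiffAt_const (c := (0 : G))).congr_of_eventuallyEq this

theorem integral_fderiv_eq_zero {V : Type*} [NormedAddCommGroup V] [NormedSpace ℝ V]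
    [FiniteDimensional ℝ V] [MeasurableSpace V] [BorelSpace V] (μ : Measure V)
    [μ.IsAddHaarMeasure] {u : V → ℝ} (hu : ContDiff ℝ 1 u) (hc : HasCompactSupport u) (v : V) :
    ∫ x, fderiv ℝ u x v ∂μ = 0 := by
  have hcont : Continuous fun x => fderiv ℝ u x v :=
    (hu.continuous_fderiv one_ne_zero).clm_apply continuous_const
  have hi : Integrable (fun x => fderiv ℝ u x v) μ :=
    hcont.integrable_of_hasCompactSupport (hc.fderiv_apply ℝ v)
  have h := integral_mul_fderiv_eq_neg_fderiv_mul_of_integrable (μ := μ) (v := v)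
    (f := u) (g := fun _ => (1 : ℝ)) (by simpa using hi) (by simp)
    (by simpa using hu.continuous.integrable_of_hasCompactSupport hc)
    (fun x _ => hu.differentiable one_ne_zero x) (fun x _ => by fun_prop)
  simpa using h

/-- A sequence with `Z (j + 1) ≤ A * B ^ j * Z j ^ θ` for some `θ > 1` tends to zero as soon as
its first term is small enough. -/
theorem exists_pos_tendsto_zero_of_le_rpow {A B θ : ℝ} (hA : 0 < A) (hB : 1 < B) (hθ : 1 < θ) :
    ∃ δ : ℝ, 0 < δ ∧ ∀ Z : ℕ → ℝ, (∀ j, 0 ≤ Z j) → Z 0 ≤ δ →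
      (∀ j, Z (j + 1) ≤ A * B ^ j * Z j ^ θ) → Filter.Tendsto Z Filter.atTop (𝓝 0) := by
  have hθ' : 0 < θ - 1 := by linarith
  have hB0 : 0 < B := by linarith
  -- The bound `Z j ≤ δ * r ^ j` reproduces itself under the recursion exactly when `B * r ^ (θ - 1)
  -- = 1` and `A * δ ^ (θ - 1) = r`; this fixes `r` and then `δ`.
  set r : ℝ := B ^ (-(1 / (θ - 1))) with hr
  have hr0 : 0 < r := Real.rpow_pos_of_pos hB0 _
  have hr1 : r < 1 := Real.rpow_lt_one_of_one_lt_of_neg hB (by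
    have : 0 < 1 / (θ - 1) := by positivity
    linarith)
  have hBr : B * r ^ (θ - 1) = 1 := by
    rw [hr, ← Real.rpow_mul hB0.le, show -(1 / (θ - 1)) * (θ - 1) = -1 by field_simp,
      Real.rpow_neg_one, mul_inv_cancel₀ hB0.ne']
  set δ : ℝ := (r / A) ^ (1 / (θ - 1)) with hδ
  have hδ0 : 0 < δ := Real.rpow_pos_of_pos (by positivity) _
  have hAδ : A * δ ^ (θ - 1) = r := by
    rw [hδ, ← Real.rpow_mul (by positivity), show 1 / (θ - 1) * (θ - 1) = 1 by field_simp,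
      Real.rpow_one]
    field_simp
  refine ⟨δ, hδ0, fun Z hZ h0 hstep => ?_⟩
  have key : ∀ j, Z j ≤ δ * r ^ j := by
    intro j
    induction j with
    | zero => simpa using h0
    | succ j ih =>
      calc Z (j + 1) ≤ A * B ^ j * Z j ^ θ := hstep j
        _ ≤ A * B ^ j * (δ * r ^ j) ^ θ := by
            have := Real.rpow_le_rpow (hZ j) ih (by linarith : (0 : ℝ) ≤ θ)
            gcongr
        _ = A * B ^ j * ((δ * r ^ j) ^ (θ - 1) * (δ * r ^ j)) := by
            have hp : 0 < δ * r ^ j := by positivity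
            rw [← Real.rpow_add_one hp.ne']
            simp
        _ = (A * δ ^ (θ - 1)) * (B * r ^ (θ - 1)) ^ j * (δ * r ^ j) := by
            rw [Real.mul_rpow hδ0.le (by positivity), ← Real.rpow_natCast r j,
              ← Real.rpow_mul hr0.le, mul_comm (j : ℝ), Real.rpow_mul hr0.le, Real.rpow_natCast,
              mul_pow]
            ring
        _ = δ * r ^ (j + 1) := by rw [hAδ, hBr]; ring
  refine squeeze_zero hZ key ?_
  simpa using (tendsto_pow_atTop_nhds_zero_of_lt_one hr0.le hr1).const_mul δ

/-- A smooth nondecreasing step from `0` on `(-∞, a]` to `1` on `[a + τ, ∞)`. -/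
theorem exists_smooth_step :
    ∃ M : ℝ, 0 < M ∧ ∀ a τ : ℝ, 0 < τ → ∃ g : ℝ → ℝ, ContDiff ℝ 2 g ∧ (∀ t, 0 ≤ g t) ∧
      (∀ t, g t ≤ 1) ∧ (∀ t, t ≤ a → g t = 0) ∧ (∀ t, a + τ ≤ t → g t = 1) ∧
      (∀ t, 0 ≤ deriv g t) ∧ (∀ t, deriv g t ≤ M / τ) ∧ (∀ t, t ≤ a → deriv g t = 0) ∧
      (∀ t, a + τ ≤ t → deriv g t = 0) := by
  have hS : ContDiff ℝ 2 Real.smoothTransition := Real.smoothTransition.contDiff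
  have hSc : Continuous (deriv Real.smoothTransition) := hS.continuous_deriv (by norm_num)
  obtain ⟨M, hM⟩ := isCompact_Icc.exists_bound_of_continuousOn (s := Icc (0 : ℝ) 1)
    hSc.continuousOn
  refine ⟨max M 1, by positivity, fun a τ hτ => ?_⟩
  set g : ℝ → ℝ := fun t => Real.smoothTransition ((t - a) / τ) with hg
  have hgc : ContDiff ℝ 2 g := hS.comp (by fun_prop)
  have hd : ∀ t, deriv g t = deriv Real.smoothTransition ((t - a) / τ) / τ := by
    intro t
    have h1 : HasDerivAt (fun t : ℝ => (t - a) / τ) (1 / τ) t :=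
      ((hasDerivAt_id t).sub_const a).div_const τ
    have h2 := ((hS.differentiable (by norm_num) ((t - a) / τ)).hasDerivAt).comp t h1
    have := h2.deriv
    simp only [Function.comp_def] at this
    rw [hg, this]; ring
  have h0 : ∀ t, t ≤ a → g t = 0 := fun t ht =>
    Real.smoothTransition.zero_of_nonpos (div_nonpos_of_nonpos_of_nonneg (by linarith) hτ.le)
  have h1 : ∀ t, a + τ ≤ t → g t = 1 := fun t ht =>
    Real.smoothTransition.one_of_one_le ((one_le_div hτ).2 (by linarith))
  have hnn : ∀ t, 0 ≤ g t := fun t => Real.smoothTransition.nonneg _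
  have hle : ∀ t, g t ≤ 1 := fun t => Real.smoothTransition.le_one _
  -- The endpoints are included: `g` attains its global minimum at every `t ≤ a` and its global
  -- maximum at every `t ≥ a + τ`.
  have hd0 : ∀ t, t ≤ a → deriv g t = 0 := fun t ht =>
    IsLocalMin.deriv_eq_zero (Filter.Eventually.of_forall fun s => by rw [h0 t ht]; exact hnn s)
  have hd1 : ∀ t, a + τ ≤ t → deriv g t = 0 := fun t ht =>
    IsLocalMax.deriv_eq_zero (Filter.Eventually.of_forall fun s => by rw [h1 t ht]; exact hle s)
  refine ⟨g, hgc, hnn, hle, h0, h1, ?_, ?_, hd0, hd1⟩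
  · intro t
    rw [hd]
    exact div_nonneg (Real.smoothTransition.monotone.deriv_nonneg) hτ.le
  · intro t
    rcases le_total t a with h | h
    · rw [hd0 t h]; positivity
    rcases le_total (a + τ) t with h' | h'
    · rw [hd1 t h']; positivity
    rw [hd]
    have := hM ((t - a) / τ) ⟨div_nonneg (by linarith) hτ.le, (div_le_one hτ).2 (by linarith)⟩
    have h3 := (Real.le_norm_self _).trans (this.trans (le_max_left M 1))
    gcongr

theorem abs_sum_inner_le {ι E : Type*} [Fintype ι] [NormedAddCommGroup E] [InnerProductSpace ℝ E]
    (a b : ι → E) :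
    |∑ i, inner ℝ (a i) (b i)| ≤ √(∑ i, ‖a i‖ ^ 2) * √(∑ i, ‖b i‖ ^ 2) := by
  calc |∑ i, inner ℝ (a i) (b i)| ≤ ∑ i, |inner ℝ (a i) (b i)| := Finset.abs_sum_le_sum_abs _ _
    _ ≤ ∑ i, ‖a i‖ * ‖b i‖ := Finset.sum_le_sum fun i _ => abs_real_inner_le_norm _ _
    _ ≤ _ := Real.sum_mul_le_sqrt_mul_sqrt _ _ _

theorem norm_sum_smul_le {ι E : Type*} [Fintype ι] [NormedAddCommGroup E] [NormedSpace ℝ E]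
    (c : ι → ℝ) (b : ι → E) :
    ‖∑ i, c i • b i‖ ≤ √(∑ i, c i ^ 2) * √(∑ i, ‖b i‖ ^ 2) := by
  calc ‖∑ i, c i • b i‖ ≤ ∑ i, |c i| * ‖b i‖ :=
        (norm_sum_le _ _).trans_eq (Finset.sum_congr rfl fun i _ => by
          rw [norm_smul, Real.norm_eq_abs])
    _ ≤ √(∑ i, |c i| ^ 2) * √(∑ i, ‖b i‖ ^ 2) := Real.sum_mul_le_sqrt_mul_sqrt _ _ _
    _ = _ := by simp only [sq_abs]

end Analysis

/-! ### Ellipticity bounds for the density. -/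

section Density

open scoped Topology ENNReal NNReal

/-- The density and its radial derivative are comparable with `Q ^ q` for `Q ≥ 1`. -/
theorem density_bounds {ρ : ℝ → ℝ} {κ q k : ℝ} (hκ : 0 < κ) (hq : 0 < q) (hk : 0 ≤ k)
    (hρc : ContinuousOn ρ (Ici 0)) (hρd : ContDiffOn ℝ 1 ρ (Ioi 0))
    (hρ : ∀ Q : ℝ, 0 < Q →
      κ⁻¹ * (Q + k) ^ q ≤ ρ Q + 2 * Q * deriv ρ Q ∧
      ρ Q + 2 * Q * deriv ρ Q ≤ κ * (Q + k) ^ q) :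
    ∃ l u : ℝ, 0 < l ∧ 0 < u ∧ ∀ Q, 1 ≤ Q → l * Q ^ q ≤ ρ Q ∧ ρ Q ≤ u * Q ^ q ∧
      l * Q ^ q ≤ ρ Q + 2 * Q * deriv ρ Q ∧ ρ Q + 2 * Q * deriv ρ Q ≤ u * Q ^ q := by
  have h4 : (1 / 4 : ℝ) ^ q ≤ 1 := Real.rpow_le_one (by norm_num) (by norm_num) hq.le
  have h4' : 0 < (1 / 4 : ℝ) ^ q := Real.rpow_pos_of_pos (by norm_num) _
  have hk1 : ∀ Q : ℝ, 1 ≤ Q → (Q + k) ^ q ≤ (1 + k) ^ q * Q ^ q := by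
    intro Q hQ
    rw [← Real.mul_rpow (by linarith) (by linarith)]
    refine Real.rpow_le_rpow (by linarith) ?_ hq.le
    nlinarith
  have hk2 : ∀ Q : ℝ, 1 ≤ Q → Q ^ q ≤ (Q + k) ^ q := fun Q hQ =>
    Real.rpow_le_rpow (by linarith) (by linarith) hq.le
  -- The quantity `ρ + 2Qρ'` at `Q = t²` is the derivative of `t ρ(t²)`, so bounds on `ρ` itself
  -- come from the mean value theorem. Continuity of `ρ` at `0` allows intervals starting at `0`.
  have hder : ∀ t : ℝ, 0 < t → HasDerivAt (fun t => t * ρ (t ^ 2))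
      (ρ (t ^ 2) + 2 * t ^ 2 * deriv ρ (t ^ 2)) t := by
    intro t ht
    have h1 : HasDerivAt ρ (deriv ρ (t ^ 2)) (t ^ 2) :=
      ((hρd.contDiffAt (Ioi_mem_nhds (by positivity))).differentiableAt one_ne_zero).hasDerivAt
    have h2 : HasDerivAt (fun t : ℝ => t ^ 2) (2 * t) t := by simpa using hasDerivAt_pow 2 t
    have h3 := (hasDerivAt_id t).mul (HasDerivAt.comp (h := fun t : ℝ => t ^ 2) t h1 h2)
    refine h3.congr_deriv ?_
    simp [Function.comp]
    ring
  have hcont : ContinuousOn (fun t => t * ρ (t ^ 2)) (Ici 0) :=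
    continuousOn_id.mul (hρc.comp (by fun_prop) fun t _ => sq_nonneg t)
  have upper : ∀ T : ℝ, 1 ≤ T → ρ (T ^ 2) ≤ κ * (T ^ 2 + k) ^ q := by
    intro T hT
    have hT0 : 0 < T := by linarith
    obtain ⟨t, ht, h⟩ := exists_hasDerivAt_eq_slope (fun t => t * ρ (t ^ 2)) _ hT0
      (hcont.mono Icc_subset_Ici_self) (fun t ht => hder t ht.1)
    have h1 := (hρ (t ^ 2) (by have := ht.1; positivity)).2
    have h2 : (t ^ 2 + k) ^ q ≤ (T ^ 2 + k) ^ q := by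
      refine Real.rpow_le_rpow (by positivity) ?_ hq.le
      nlinarith [ht.1, ht.2]
    rw [h, zero_mul, sub_zero, sub_zero, mul_div_cancel_left₀ _ hT0.ne'] at h1
    exact h1.trans (by gcongr)
  have lower : ∀ T : ℝ, 1 ≤ T → κ⁻¹ * (1 / 4) ^ q / 2 * (T ^ 2) ^ q ≤ ρ (T ^ 2) := by
    intro T hT
    have hT0 : 0 < T := by linarith
    -- The interval is halved: on `[0, T/2]` only the sign of the derivative is used, and on `[T/2,
    -- T]` the intermediate point satisfies `s² ≥ T²/4`, which produces the factor `(1/4)^q / 2`.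
    obtain ⟨t, ht, h⟩ := exists_hasDerivAt_eq_slope (fun t => t * ρ (t ^ 2)) _ (half_pos hT0)
      (hcont.mono Icc_subset_Ici_self) (fun t ht => hder t ht.1)
    obtain ⟨s, hs, h'⟩ := exists_hasDerivAt_eq_slope (fun t => t * ρ (t ^ 2)) _ (half_lt_self hT0)
      (hcont.mono fun x hx => (half_pos hT0).le.trans hx.1)
      (fun t ht => hder t ((half_pos hT0).trans ht.1))
    have h1 := (hρ (t ^ 2) (by have := ht.1; positivity)).1
    have h2 := (hρ (s ^ 2) (by have := (half_pos hT0).trans hs.1; positivity)).1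
    rw [h] at h1
    rw [h'] at h2
    have h3 : 0 ≤ κ⁻¹ * (t ^ 2 + k) ^ q := by positivity
    have h5 : (1 / 4) ^ q * (T ^ 2) ^ q ≤ (s ^ 2 + k) ^ q := by
      rw [← Real.mul_rpow (by norm_num) (by positivity)]
      refine Real.rpow_le_rpow (by positivity) ?_ hq.le
      nlinarith [hs.1, hs.2]
    have h6 := h3.trans h1
    rw [le_div_iff₀ (by linarith)] at h6
    rw [le_div_iff₀ (by linarith)] at h2
    have h7 : κ⁻¹ * ((1 / 4) ^ q * (T ^ 2) ^ q) ≤ κ⁻¹ * (s ^ 2 + k) ^ q := by gcongr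
    have h8 : κ⁻¹ * ((1 / 4) ^ q * (T ^ 2) ^ q) * (T - T / 2) ≤
        κ⁻¹ * (s ^ 2 + k) ^ q * (T - T / 2) :=
      mul_le_mul_of_nonneg_right h7 (by linarith)
    have h9 : T * (κ⁻¹ * (1 / 4) ^ q / 2 * (T ^ 2) ^ q) ≤ T * ρ (T ^ 2) := by linarith
    exact le_of_mul_le_mul_left h9 hT0
  refine ⟨κ⁻¹ * (1 / 4) ^ q / 2, κ * (1 + k) ^ q, by positivity, by positivity, fun Q hQ => ?_⟩
  have hQ0 : 0 < Q := by linarith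
  have hsq : √Q ^ 2 = Q := Real.sq_sqrt hQ0.le
  have hs1 : 1 ≤ √Q := Real.one_le_sqrt.2 hQ
  have hup : κ * (Q + k) ^ q ≤ κ * (1 + k) ^ q * Q ^ q := by
    rw [mul_assoc]; exact mul_le_mul_of_nonneg_left (hk1 Q hQ) hκ.le
  refine ⟨?_, ?_, ?_, (hρ Q hQ0).2.trans hup⟩
  · have := lower _ hs1
    rwa [hsq] at this
  · have := upper _ hs1
    rw [hsq] at this
    exact this.trans hup
  · refine le_trans ?_ (hρ Q hQ0).1
    have h1 := hk2 Q hQ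
    have h2 : 0 ≤ Q ^ q := by positivity
    have h3 : (1 / 4 : ℝ) ^ q / 2 * Q ^ q ≤ (Q + k) ^ q := by nlinarith
    calc _ = κ⁻¹ * ((1 / 4 : ℝ) ^ q / 2 * Q ^ q) := by ring
      _ ≤ _ := by gcongr

end Density

/-! ### Norms of covectors and growth of the right-hand side. -/

section Covectors

open scoped Topology ENNReal NNReal

variable {n : ℕ} {E : Type*} [NormedAddCommGroup E] [InnerProductSpace ℝ E]

theorem euclidean_sum_single (v : EuclideanSpace ℝ (Fin n)) :
    v = ∑ i, v i • EuclideanSpace.single i (1 : ℝ) := by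
  ext j
  simp [Finset.sum_apply, Pi.single_apply]

theorem Qsq_nonneg (w : EuclideanSpace ℝ (Fin n) →L[ℝ] E) : 0 ≤ Qsq w :=
  Finset.sum_nonneg fun _ _ => by positivity

/-- The operator norm is at most the Hilbert–Schmidt norm. -/
theorem norm_le_sqrt_sum {G : Type*} [NormedAddCommGroup G] [NormedSpace ℝ G]
    (w : EuclideanSpace ℝ (Fin n) →L[ℝ] G) :
    ‖w‖ ≤ √(∑ i : Fin n, ‖w (EuclideanSpace.single i 1)‖ ^ 2) := by
  refine w.opNorm_le_bound (Real.sqrt_nonneg _) fun v => ?_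
  have h : w v = ∑ i, v i • w (EuclideanSpace.single i 1) := by
    conv_lhs => rw [euclidean_sum_single v]
    simp
  rw [h, EuclideanSpace.norm_eq]
  calc ‖∑ i, v i • w (EuclideanSpace.single i 1)‖
      ≤ ∑ i, ‖w (EuclideanSpace.single i 1)‖ * ‖v i‖ :=
        (norm_sum_le _ _).trans_eq (Finset.sum_congr rfl fun i _ => by
          rw [norm_smul, mul_comm])
    _ ≤ _ := Real.sum_mul_le_sqrt_mul_sqrt _ _ _

theorem norm_le_sqrt_Qsq (w : EuclideanSpace ℝ (Fin n) →L[ℝ] E) : ‖w‖ ≤ √(Qsq w) :=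
  norm_le_sqrt_sum w

theorem norm_apply_single_le {G : Type*} [NormedAddCommGroup G] [NormedSpace ℝ G]
    (w : EuclideanSpace ℝ (Fin n) →L[ℝ] G) (i : Fin n) :
    ‖w (EuclideanSpace.single i 1)‖ ≤ ‖w‖ := by
  simpa using w.le_opNorm (EuclideanSpace.single i (1 : ℝ))

theorem Qsq_le_norm_sq (w : EuclideanSpace ℝ (Fin n) →L[ℝ] E) : Qsq w ≤ n * ‖w‖ ^ 2 := by
  calc Qsq w ≤ ∑ _i : Fin n, ‖w‖ ^ 2 := Finset.sum_le_sum fun i _ => by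
        gcongr; exact norm_apply_single_le w i
    _ = _ := by simp

theorem contDiff_Qsq {m : WithTop ℕ∞} :
    ContDiff ℝ m (Qsq : (EuclideanSpace ℝ (Fin n) →L[ℝ] E) → ℝ) := by
  unfold Qsq
  exact ContDiff.sum fun i _ => (contDiff_id.clm_apply contDiff_const).norm_sq ℝ

theorem hasFDerivAt_Qsq_comp {ω : EuclideanSpace ℝ (Fin n) → EuclideanSpace ℝ (Fin n) →L[ℝ] E}
    {x : EuclideanSpace ℝ (Fin n)} (h : DifferentiableAt ℝ ω x) (v : EuclideanSpace ℝ (Fin n)) :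
    fderiv ℝ (fun y => Qsq (ω y)) x v = 2 * ∑ i, inner ℝ (fderiv ℝ ω x v (EuclideanSpace.single i 1))
      (ω x (EuclideanSpace.single i 1)) := by
  have h1 : ∀ i : Fin n, HasFDerivAt (fun y => ω y (EuclideanSpace.single i 1))
      ((fderiv ℝ ω x).flip (EuclideanSpace.single i 1)) x := fun i => by
    simpa using h.hasFDerivAt.clm_apply (hasFDerivAt_const (EuclideanSpace.single i (1 : ℝ)) x)
  have h2 : HasFDerivAt (fun y => Qsq (ω y)) _ x :=
    HasFDerivAt.fun_sum (u := Finset.univ) fun i _ => (h1 i).norm_sq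
  rw [h2.fderiv]
  simp [Finset.mul_sum, real_inner_comm]

/-- Growth of a map whose derivative is controlled by `(|w|² + k) ^ q`. -/
theorem norm_le_of_fderiv_le {ξ : (EuclideanSpace ℝ (Fin n) →L[ℝ] E) → E} {κ q k : ℝ}
    (hκ : 0 < κ) (hq : 0 < q) (hk : 0 ≤ k) (hξd : Differentiable ℝ ξ)
    (hξ : ∀ w, ‖fderiv ℝ ξ w‖ ≤ κ * (Qsq w + k) ^ q) :
    ∃ X : ℝ, 0 < X ∧ ∀ w, 1 ≤ Qsq w → ‖ξ w‖ ≤ X * (Qsq w ^ q * √(Qsq w)) := by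
  -- The derivative is integrated along the segment from `0` to `w`, on which `Qsq` is at most `Qsq
  -- w`; the value `ξ 0` is absorbed because `Qsq w ≥ 1`.
  refine ⟨‖ξ 0‖ + κ * (1 + k) ^ q + 1, by positivity, fun w hw => ?_⟩
  have hQ : Qsq w = ∑ i : Fin n, ‖w (EuclideanSpace.single i 1)‖ ^ 2 := rfl
  have hmv := (convex_segment (0 : EuclideanSpace ℝ (Fin n) →L[ℝ] E) w).norm_image_sub_le_of_norm_fderiv_le (𝕜 := ℝ) (f := ξ)
    (C := κ * (Qsq w + k) ^ q) (fun x _ => hξd x) (fun x hx => by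
      refine (hξ x).trans ?_
      have : Qsq x ≤ Qsq w := by
        obtain ⟨t, ht, rfl⟩ := (segment_eq_image ℝ (0 : EuclideanSpace ℝ (Fin n) →L[ℝ] E) w ▸ hx :)
        refine Finset.sum_le_sum fun i _ => ?_
        have : ‖((1 - t) • (0 : EuclideanSpace ℝ (Fin n) →L[ℝ] E) + t • w)
            (EuclideanSpace.single i 1)‖ ≤ ‖w (EuclideanSpace.single i 1)‖ := by
          simp [norm_smul, abs_of_nonneg ht.1]
          exact mul_le_of_le_one_left (norm_nonneg _) ht.2
        simp only at this ⊢
        gcongr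
      have h0 := Qsq_nonneg x
      gcongr) (left_mem_segment ℝ _ _) (right_mem_segment ℝ _ _)
  have h1 : ‖ξ w‖ ≤ ‖ξ 0‖ + κ * (Qsq w + k) ^ q * √(Qsq w) := by
    have h2 : ‖ξ w‖ ≤ ‖ξ w - ξ 0‖ + ‖ξ 0‖ := by simpa using norm_add_le (ξ w - ξ 0) (ξ 0)
    have h3 : κ * (Qsq w + k) ^ q * ‖w - 0‖ ≤ κ * (Qsq w + k) ^ q * √(Qsq w) := by
      rw [sub_zero]
      have := norm_le_sqrt_Qsq w
      have : 0 ≤ (Qsq w + k) ^ q := Real.rpow_nonneg (by linarith) _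
      gcongr
    linarith
  have hk1 : (Qsq w + k) ^ q ≤ (1 + k) ^ q * Qsq w ^ q := by
    rw [← Real.mul_rpow (by linarith) (by linarith)]
    refine Real.rpow_le_rpow (by linarith) ?_ hq.le
    nlinarith
  have hs : 1 ≤ √(Qsq w) := Real.one_le_sqrt.2 hw
  have hqq : 1 ≤ Qsq w ^ q := Real.one_le_rpow hw hq.le
  have h5 : 1 ≤ Qsq w ^ q * √(Qsq w) := by nlinarith
  have h7 : κ * (Qsq w + k) ^ q * √(Qsq w) ≤ κ * (1 + k) ^ q * (Qsq w ^ q * √(Qsq w)) := by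
    calc _ ≤ κ * ((1 + k) ^ q * Qsq w ^ q) * √(Qsq w) := by gcongr
      _ = _ := by ring
  have h8 : 0 ≤ κ * (1 + k) ^ q := by positivity
  nlinarith [mul_nonneg (norm_nonneg (ξ 0)) (sub_nonneg.2 h5)]

end Covectors

/-! ### Pointwise algebra of the Bochner identity. -/

section Bochner

open scoped Topology ENNReal NNReal

theorem sqrt_sum_sum_le {n : ℕ} {E : Type*} [NormedAddCommGroup E] {R : Fin n → Fin n → E} {b : ℝ} (hb : 0 ≤ b) (hR : ∀ i j, ‖R i j‖ ≤ b) :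
    √(∑ i, ∑ j, ‖R i j‖ ^ 2) ≤ n * b := by
  refine Real.sqrt_le_iff.2 ⟨by positivity, ?_⟩
  calc ∑ i, ∑ j, ‖R i j‖ ^ 2 ≤ ∑ _i : Fin n, ∑ _j : Fin n, b ^ 2 :=
        Finset.sum_le_sum fun i _ => Finset.sum_le_sum fun j _ => by gcongr; exact hR i j
    _ = (n * b) ^ 2 := by simp; ring

variable {n : ℕ} {E : Type*} [NormedAddCommGroup E] [InnerProductSpace ℝ E]

theorem abs_sum_sum_inner_le (A B : Fin n → Fin n → E) :
    |∑ i, ∑ j, inner ℝ (A i j) (B i j)| ≤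
      √(∑ i, ∑ j, ‖A i j‖ ^ 2) * √(∑ i, ∑ j, ‖B i j‖ ^ 2) := by
  have := abs_sum_inner_le (fun p : Fin n × Fin n => A p.1 p.2) (fun p => B p.1 p.2)
  simpa only [Fintype.sum_prod_type] using this

theorem norm_trace_le (D : Fin n → Fin n → E) :
    ‖∑ j, D j j‖ ≤ √n * √(∑ i, ∑ j, ‖D i j‖ ^ 2) := by
  have h := norm_sum_smul_le (fun _ : Fin n => (1 : ℝ)) (fun j => D j j)
  simp only [one_smul, one_pow, Finset.sum_const, Finset.card_univ, Fintype.card_fin,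
    nsmul_eq_mul, mul_one] at h
  refine h.trans ?_
  gcongr with i
  exact Finset.single_le_sum (f := fun j => ‖D i j‖ ^ 2) (fun _ _ => by positivity)
    (Finset.mem_univ i)

variable {w : Fin n → E} {D : Fin n → Fin n → E} {dQ : Fin n → ℝ} {y N : ℝ}

/-- The transposed contraction of `∇ω` with `ω` is `∇Q / 2` up to the curvature term. -/
theorem sqrt_sum_contraction_le (hy : 0 ≤ y) (hN : 0 ≤ N) (hw : ∑ i, ‖w i‖ ^ 2 = y ^ 2)
    (hR : ∀ i j, ‖D i j - D j i‖ ≤ 2 * N * y) :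
    √(∑ i, (∑ j, inner ℝ (D j i - D i j) (w j)) ^ 2) ≤ 2 * n * N * y ^ 2 := by
  refine Real.sqrt_le_iff.2 ⟨by positivity, ?_⟩
  calc ∑ i, (∑ j, inner ℝ (D j i - D i j) (w j)) ^ 2
      ≤ ∑ _i : Fin n, n * (2 * N * y ^ 2) ^ 2 := Finset.sum_le_sum fun i _ => by
        have h := abs_sum_inner_le (fun j => D j i - D i j) w
        rw [hw, Real.sqrt_sq hy] at h
        have h2 : √(∑ j, ‖D j i - D i j‖ ^ 2) ≤ √n * (2 * N * y) := by
          refine Real.sqrt_le_iff.2 ⟨by positivity, ?_⟩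
          rw [mul_pow, Real.sq_sqrt (by positivity)]
          calc _ ≤ ∑ _j : Fin n, (2 * N * y) ^ 2 := Finset.sum_le_sum fun j _ => by
                gcongr; exact hR j i
            _ = _ := by simp
        have h3 : |∑ j, inner ℝ (D j i - D i j) (w j)| ≤ √n * (2 * N * y ^ 2) :=
          h.trans ((mul_le_mul_of_nonneg_right h2 hy).trans_eq (by ring))
        calc (∑ j, inner ℝ (D j i - D i j) (w j)) ^ 2
            = |∑ j, inner ℝ (D j i - D i j) (w j)| ^ 2 := (sq_abs _).symm
          _ ≤ (√n * (2 * N * y ^ 2)) ^ 2 := by gcongr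
          _ = _ := by rw [mul_pow, Real.sq_sqrt (by positivity)]
    _ = _ := by simp; ring

/-- A Kato-type inequality, `|∇Q| ≤ 2|ω||∇ω|`, from Cauchy–Schwarz in each direction. It both gives
coercivity when `ρ' < 0` and lets `|∇ω|²` be traded for `|∇Q|²/Q`. -/
theorem sqrt_sum_dQ_le (hy : 0 ≤ y) (hw : ∑ i, ‖w i‖ ^ 2 = y ^ 2)
    (hdQ : ∀ i, dQ i = 2 * ∑ j, inner ℝ (D i j) (w j)) :
    ∑ i, dQ i ^ 2 ≤ 4 * y ^ 2 * ∑ i, ∑ j, ‖D i j‖ ^ 2 := by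
  rw [Finset.mul_sum]
  refine Finset.sum_le_sum fun i _ => ?_
  have h := abs_sum_inner_le (fun j => D i j) w
  rw [hw, Real.sqrt_sq hy] at h
  calc dQ i ^ 2 = 4 * |∑ j, inner ℝ (D i j) (w j)| ^ 2 := by rw [hdQ, sq_abs]; ring
    _ ≤ 4 * (√(∑ j, ‖D i j‖ ^ 2) * y) ^ 2 := by gcongr
    _ = _ := by rw [mul_pow, Real.sq_sqrt (Finset.sum_nonneg fun _ _ => by positivity)]; ring

variable {r r' a l u X : ℝ} {v : E}

/-- The contribution of `g ζ² ∇ω`. -/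
theorem bochner_gradient_term (hy : 0 ≤ y) (hN : 0 ≤ N) (hw : ∑ i, ‖w i‖ ^ 2 = y ^ 2)
    (hR : ∀ i j, ‖D i j - D j i‖ ≤ 2 * N * y)
    (hdQ : ∀ i, dQ i = 2 * ∑ j, inner ℝ (D i j) (w j))
    (ha : 0 ≤ a) (hl : 0 ≤ l) (hr : l * a ≤ r) (hr2 : r ≤ u * a) (hr' : l * a ≤ r + 2 * y ^ 2 * r')
    (hr'2 : r + 2 * y ^ 2 * r' ≤ u * a) (hX : 0 ≤ X) (hv : ‖v‖ ≤ X * (a * y)) :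
    a * (l * (∑ i, ∑ j, ‖D i j‖ ^ 2) -
      (4 * n * u * N + X * √n) * y * √(∑ i, ∑ j, ‖D i j‖ ^ 2)) ≤
    (∑ i, ∑ j, inner ℝ (r • D j i + (r' * dQ j) • w i) (D i j)) + inner ℝ v (∑ j, D j j) := by
  set d := √(∑ i, ∑ j, ‖D i j‖ ^ 2) with hd
  have hdd : ∑ i, ∑ j, ‖D i j‖ ^ 2 = d ^ 2 :=
    (Real.sq_sqrt (Finset.sum_nonneg fun _ _ => Finset.sum_nonneg fun _ _ => by positivity)).symm
  set G := √(∑ i, dQ i ^ 2) with hG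
  have hGG : ∑ i, dQ i ^ 2 = G ^ 2 := (Real.sq_sqrt (Finset.sum_nonneg fun _ _ => by positivity)).symm
  have hGd := sqrt_sum_dQ_le hy hw hdQ
  rw [hdd, hGG] at hGd
  have hd0 : 0 ≤ d := Real.sqrt_nonneg _
  have hG0 : 0 ≤ G := Real.sqrt_nonneg _
  have hGd' : G ≤ 2 * y * d := by
    refine abs_le_of_sq_le_sq' ?_ (by positivity) |>.2
    linarith [mul_pow (2 * y) d 2, mul_pow 2 y 2]
  set t : Fin n → ℝ := fun i => ∑ j, inner ℝ (D j i - D i j) (w j) with ht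
  have ht2 : √(∑ i, t i ^ 2) ≤ 2 * n * N * y ^ 2 := sqrt_sum_contraction_le hy hN hw hR
  set T := ∑ i, ∑ j, inner ℝ (D i j - D j i) (D i j) with hT
  have hT2 : |T| ≤ 2 * n * N * y * d := by
    refine (abs_sum_sum_inner_le _ _).trans ?_
    have := sqrt_sum_sum_le (by positivity) hR
    calc _ ≤ n * (2 * N * y) * d := by gcongr
      _ = _ := by ring
  set S := ∑ i, dQ i * t i with hS
  have hS2 : |S| ≤ G * (2 * n * N * y ^ 2) := by
    refine (abs_sum_inner_le (E := ℝ) dQ t |>.trans' (le_of_eq ?_)).trans ?_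
    · simp [hS, mul_comm]
    · simp only [Real.norm_eq_abs, sq_abs]
      gcongr
  have hv2 : |inner ℝ v (∑ j, D j j)| ≤ X * (a * y) * (√n * d) :=
    (abs_real_inner_le_norm _ _).trans (by
      have := norm_trace_le D
      gcongr)
  -- Up to the antisymmetric errors `T` and `S`, transposing `D` leaves `r|∇ω|² + r'|∇Q|²/2`.
  have hexp : (∑ i, ∑ j, inner ℝ (r • D j i + (r' * dQ j) • w i) (D i j)) =
      r * (d ^ 2 - T) + r' * (G ^ 2 / 2 + S) := by
    have e1 : ∑ i, ∑ j, inner ℝ (D j i) (D i j) = d ^ 2 - T := by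
      rw [← hdd, hT]
      simp only [← Finset.sum_sub_distrib]
      refine Finset.sum_congr rfl fun i _ => Finset.sum_congr rfl fun j _ => ?_
      rw [inner_sub_left, real_inner_self_eq_norm_sq]; ring
    have e2 : ∑ i, ∑ j, dQ j * inner ℝ (w i) (D i j) = G ^ 2 / 2 + S := by
      rw [Finset.sum_comm, ← hGG, hS, Finset.sum_div, ← Finset.sum_add_distrib]
      refine Finset.sum_congr rfl fun j _ => ?_
      have : ∑ i, inner ℝ (w i) (D i j) = dQ j / 2 + t j := by
        rw [hdQ, ht]
        simp only [inner_sub_left, Finset.sum_sub_distrib, real_inner_comm]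
        ring
      rw [← Finset.mul_sum, this]; ring
    rw [← e1, ← e2]
    simp only [inner_add_left, real_inner_smul_left, Finset.sum_add_distrib, Finset.mul_sum, mul_assoc]
  rw [hexp, hdd]
  have hr'' : |y ^ 2 * r'| ≤ u * a / 2 := by
    have : 0 ≤ l * a := by positivity
    rw [abs_le]; constructor <;> linarith
  -- For `r' ≥ 0` the bound on `r` suffices. For `r' ≤ 0` the inequality `G² ≤ 4y²d²` leaves `(r +
  -- 2y²r')d²`, which is the other ellipticity bound.
  have hmain : l * a * d ^ 2 ≤ r * d ^ 2 + r' * (G ^ 2 / 2) := by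
    rcases le_total 0 r' with h | h
    · have : 0 ≤ r' * (G ^ 2 / 2) := by positivity
      nlinarith [sq_nonneg d]
    · have : r' * (4 * y ^ 2 * d ^ 2) ≤ r' * G ^ 2 := mul_le_mul_of_nonpos_left hGd h
      nlinarith [sq_nonneg d]
  have h1 : |r * T| ≤ u * a * (2 * n * N * y * d) := by
    rw [abs_mul]
    have : |r| ≤ u * a := by rw [abs_of_nonneg (by nlinarith)]; exact hr2
    gcongr
    exact (abs_nonneg r).trans this
  have h2 : |r' * S| ≤ u * a * (2 * n * N * y * d) := by
    have h3 : |S| ≤ 2 * y * d * (2 * n * N * y ^ 2) := hS2.trans (by gcongr)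
    calc |r' * S| = |r'| * |S| := abs_mul _ _
      _ ≤ |r'| * (2 * y * d * (2 * n * N * y ^ 2)) := by gcongr
      _ = |y ^ 2 * r'| * (4 * n * N * y * d) := by rw [abs_mul, abs_of_nonneg (sq_nonneg y)]; ring
      _ ≤ u * a / 2 * (4 * n * N * y * d) := by gcongr
      _ = _ := by ring
  linarith [(abs_le.1 h1).2, (abs_le.1 h2).1, (abs_le.1 hv2).1]

/-- The contribution of the gradient of the scalar factor, in terms of its components `c`. -/
theorem bochner_scalar_term (c : Fin n → ℝ)
    (hdQ : ∀ i, dQ i = 2 * ∑ j, inner ℝ (D i j) (w j)) :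
    (∑ i, ∑ j, inner ℝ (r • D j i + (r' * dQ j) • w i) (c i • w j)) + inner ℝ v (∑ j, c j • w j) =
    r * ((∑ i, c i * dQ i) / 2) + r * (∑ i, c i * ∑ j, inner ℝ (D j i - D i j) (w j)) +
      r' * inner ℝ (∑ i, c i • w i) (∑ i, dQ i • w i) + inner ℝ v (∑ j, c j • w j) := by
  congr 1
  have e1 : ∀ i, ∑ j, inner ℝ (D j i) (w j) = dQ i / 2 + ∑ j, inner ℝ (D j i - D i j) (w j) := by
    intro i
    rw [hdQ]
    simp only [inner_sub_left, Finset.sum_sub_distrib]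
    ring
  have e2 : ∑ i, ∑ j, c i * inner ℝ (D j i) (w j) =
      (∑ i, c i * dQ i) / 2 + ∑ i, c i * ∑ j, inner ℝ (D j i - D i j) (w j) := by
    rw [Finset.sum_div, ← Finset.sum_add_distrib]
    refine Finset.sum_congr rfl fun i _ => ?_
    rw [← Finset.mul_sum, e1]; ring
  have e3 : inner ℝ (∑ i, c i • w i) (∑ i, dQ i • w i) =
      ∑ i, ∑ j, c i * (dQ j * inner ℝ (w i) (w j)) := by
    rw [sum_inner]
    refine Finset.sum_congr rfl fun i _ => ?_
    rw [inner_sum]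
    refine Finset.sum_congr rfl fun j _ => ?_
    rw [real_inner_smul_left, real_inner_smul_right]
  rw [← mul_add, ← e2, e3]
  simp only [inner_add_left, real_inner_smul_left, real_inner_smul_right, Finset.sum_add_distrib,
    Finset.mul_sum]
  congr 1 <;> refine Finset.sum_congr rfl fun i _ => Finset.sum_congr rfl fun j _ => ?_ <;> ring

/-- The choice `c = dQ` makes the principal part `r|∇Q|²/2 + r'|∑ dQᵢ wᵢ|²`, and `|∑ dQᵢ wᵢ|² ≤
y²|∇Q|²`. The sign of `r'` again decides which ellipticity bound applies. This is the contribution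
of the derivative of `g(Q)`. -/
theorem bochner_scalar_term_lower (hy : 0 ≤ y) (hN : 0 ≤ N) (hw : ∑ i, ‖w i‖ ^ 2 = y ^ 2)
    (hR : ∀ i j, ‖D i j - D j i‖ ≤ 2 * N * y)
    (hdQ : ∀ i, dQ i = 2 * ∑ j, inner ℝ (D i j) (w j))
    (ha : 0 ≤ a) (hl : 0 ≤ l) (hr : l * a ≤ r) (hr2 : r ≤ u * a) (hr' : l * a ≤ r + 2 * y ^ 2 * r')
    (hX : 0 ≤ X) (hv : ‖v‖ ≤ X * (a * y)) :
    a * (l / 2 * (∑ i, dQ i ^ 2) - (2 * n * u * N + X) * y ^ 2 * √(∑ i, dQ i ^ 2)) ≤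
    (∑ i, ∑ j, inner ℝ (r • D j i + (r' * dQ j) • w i) (dQ i • w j)) +
      inner ℝ v (∑ j, dQ j • w j) := by
  rw [bochner_scalar_term dQ hdQ]
  set G := √(∑ i, dQ i ^ 2) with hG
  have hGG : ∑ i, dQ i ^ 2 = G ^ 2 := (Real.sq_sqrt (Finset.sum_nonneg fun _ _ => by positivity)).symm
  have hG0 : 0 ≤ G := Real.sqrt_nonneg _
  set t : Fin n → ℝ := fun i => ∑ j, inner ℝ (D j i - D i j) (w j) with ht
  have ht2 : √(∑ i, t i ^ 2) ≤ 2 * n * N * y ^ 2 := sqrt_sum_contraction_le hy hN hw hR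
  have hS2 : |∑ i, dQ i * t i| ≤ G * (2 * n * N * y ^ 2) := by
    refine (abs_sum_inner_le (E := ℝ) dQ t |>.trans' (le_of_eq ?_)).trans ?_
    · simp [mul_comm]
    · simp only [Real.norm_eq_abs, sq_abs]
      gcongr
  have hm : ‖∑ i, dQ i • w i‖ ≤ G * y := by
    have := norm_sum_smul_le dQ w
    rwa [hw, Real.sqrt_sq hy] at this
  have hv2 : |inner ℝ v (∑ j, dQ j • w j)| ≤ X * (a * y) * (G * y) :=
    (abs_real_inner_le_norm _ _).trans (by gcongr)
  have h1 : |r * ∑ i, dQ i * t i| ≤ u * a * (G * (2 * n * N * y ^ 2)) := by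
    rw [abs_mul]
    have : |r| ≤ u * a := by rw [abs_of_nonneg (by nlinarith)]; exact hr2
    gcongr
    exact (abs_nonneg r).trans this
  have e : ∑ i, dQ i * dQ i = G ^ 2 := by rw [← hGG]; simp only [sq]
  rw [e, real_inner_self_eq_norm_sq, hGG]
  have hmain : l * a / 2 * G ^ 2 ≤ r * (G ^ 2 / 2) + r' * ‖∑ i, dQ i • w i‖ ^ 2 := by
    have hm2 : ‖∑ i, dQ i • w i‖ ^ 2 ≤ G ^ 2 * y ^ 2 := by rw [← mul_pow]; gcongr
    rcases le_total 0 r' with h | h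
    · have : 0 ≤ r' * ‖∑ i, dQ i • w i‖ ^ 2 := by positivity
      nlinarith [sq_nonneg G]
    · have : r' * (G ^ 2 * y ^ 2) ≤ r' * ‖∑ i, dQ i • w i‖ ^ 2 := mul_le_mul_of_nonpos_left hm2 h
      nlinarith [sq_nonneg G]
  linarith [(abs_le.1 h1).1, (abs_le.1 hv2).1]

/-- Applied to the components `c` of `∇ζ`. This term has no sign, but it is linear in `|∇Q|` and can
be absorbed. -/
theorem bochner_scalar_term_abs (c : Fin n → ℝ) (hy : 0 ≤ y) (hN : 0 ≤ N)
    (hw : ∑ i, ‖w i‖ ^ 2 = y ^ 2) (hR : ∀ i j, ‖D i j - D j i‖ ≤ 2 * N * y)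
    (hdQ : ∀ i, dQ i = 2 * ∑ j, inner ℝ (D i j) (w j))
    (ha : 0 ≤ a) (hl : 0 ≤ l) (hr : l * a ≤ r) (hr2 : r ≤ u * a) (hr' : l * a ≤ r + 2 * y ^ 2 * r')
    (hr'2 : r + 2 * y ^ 2 * r' ≤ u * a) (hX : 0 ≤ X) (hv : ‖v‖ ≤ X * (a * y)) :
    |(∑ i, ∑ j, inner ℝ (r • D j i + (r' * dQ j) • w i) (c i • w j)) +
      inner ℝ v (∑ j, c j • w j)| ≤
    a * √(∑ i, c i ^ 2) * (u * √(∑ i, dQ i ^ 2) + (2 * n * u * N + X) * y ^ 2) := by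
  rw [bochner_scalar_term c hdQ]
  set G := √(∑ i, dQ i ^ 2) with hG
  set z := √(∑ i, c i ^ 2) with hz
  have hG0 : 0 ≤ G := Real.sqrt_nonneg _
  have hz0 : 0 ≤ z := Real.sqrt_nonneg _
  set t : Fin n → ℝ := fun i => ∑ j, inner ℝ (D j i - D i j) (w j) with ht
  have ht2 : √(∑ i, t i ^ 2) ≤ 2 * n * N * y ^ 2 := sqrt_sum_contraction_le hy hN hw hR
  have cs : ∀ b : Fin n → ℝ, |∑ i, c i * b i| ≤ z * √(∑ i, b i ^ 2) := fun b => by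
    refine (abs_sum_inner_le (E := ℝ) c b |>.trans' (le_of_eq ?_)).trans (le_of_eq ?_)
    · simp [mul_comm]
    · simp only [Real.norm_eq_abs, sq_abs, hz]
  have hm : ∀ b : Fin n → ℝ, ‖∑ i, b i • w i‖ ≤ √(∑ i, b i ^ 2) * y := fun b => by
    have := norm_sum_smul_le b w
    rwa [hw, Real.sqrt_sq hy] at this
  have hr0 : |r| ≤ u * a := by rw [abs_of_nonneg (by nlinarith)]; exact hr2
  have hua : 0 ≤ u * a := (abs_nonneg r).trans hr0
  have h1 : |r * ((∑ i, c i * dQ i) / 2)| ≤ u * a * (z * G / 2) := by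
    rw [abs_mul, abs_div, abs_of_pos (zero_lt_two' ℝ)]
    have := cs dQ
    gcongr
  have h2 : |r * ∑ i, c i * t i| ≤ u * a * (z * (2 * n * N * y ^ 2)) := by
    rw [abs_mul]
    have := (cs t).trans (mul_le_mul_of_nonneg_left ht2 hz0)
    gcongr
  have h3 : |r' * inner ℝ (∑ i, c i • w i) (∑ i, dQ i • w i)| ≤ u * a / 2 * (z * G) := by
    have hr'' : |y ^ 2 * r'| ≤ u * a / 2 := by
      have : 0 ≤ l * a := by positivity
      rw [abs_le]; constructor <;> linarith
    calc _ = |r'| * |inner ℝ (∑ i, c i • w i) (∑ i, dQ i • w i)| := abs_mul _ _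
      _ ≤ |r'| * ((z * y) * (G * y)) := by
          gcongr
          exact (abs_real_inner_le_norm _ _).trans
            (mul_le_mul (hm c) (hm dQ) (norm_nonneg _) (by positivity))
      _ = |y ^ 2 * r'| * (z * G) := by rw [abs_mul, abs_of_nonneg (sq_nonneg y)]; ring
      _ ≤ _ := by gcongr
  have h4 : |inner ℝ v (∑ j, c j • w j)| ≤ X * (a * y) * (z * y) :=
    (abs_real_inner_le_norm _ _).trans (by have := hm c; gcongr)
  refine (abs_add_le _ _).trans ((add_le_add ((abs_add_le _ _).trans (add_le_add
    ((abs_add_le _ _).trans (add_le_add h1 h2)) h3)) h4).trans (le_of_eq ?_))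
  ring

/-- Here `d` stands for `|∇ω|`, `e` for `|∇Q|/|ω|`, `z` for `|∇ζ|`, and `p₁`, `p₂`, `p₃` for the
terms carrying `g`, `g'` and `∇ζ`. Completing squares leaves `l/2 · d² ≥ l/8 · e²` in the first
term; the third consumes half of that, whence `l/16`. -/
theorem young_combination {l u b b₀ f y e d ζ z g gp p₁ p₂ p₃ : ℝ} (hl : 0 < l)
    (hb₀ : 0 ≤ b₀) (hf : 0 ≤ f) (hb : b ^ 2 ≤ b₀ * f) (hg : 0 ≤ g) (hgp : 0 ≤ gp)
    (hed : e ^ 2 ≤ 4 * d ^ 2) (h₁ : l * d ^ 2 - b * y * d ≤ p₁)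
    (h₂ : l / 2 * (e * y) ^ 2 - b * y ^ 2 * (e * y) ≤ p₂)
    (h₃ : |p₃| ≤ z * (u * (e * y) + b * y ^ 2)) :
    l / 16 * (ζ ^ 2 * (g + gp * y ^ 2) * e ^ 2) ≤
      ζ ^ 2 * g * p₁ + ζ ^ 2 * gp * p₂ + 2 * ζ * g * p₃ +
        (b₀ * (1 / l + 1) + 16 * u ^ 2 / l + 1) *
          (ζ ^ 2 * (g + gp * y ^ 2) * y ^ 2 * f + g * y ^ 2 * z ^ 2) := by
  have hb' : b ^ 2 * y ^ 2 ≤ b₀ * f * y ^ 2 := by gcongr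
  have q₁ : l / 8 * e ^ 2 - b₀ * f * y ^ 2 / (2 * l) ≤ p₁ := by
    have : b * y * d ≤ l / 2 * d ^ 2 + (b * y) ^ 2 / (2 * l) := by
      have : 0 ≤ (l * d - b * y) ^ 2 / (2 * l) := by positivity
      have e1 : (l * d - b * y) ^ 2 / (2 * l) =
        l / 2 * d ^ 2 + (b * y) ^ 2 / (2 * l) - b * y * d := by field_simp; ring
      linarith
    have h4 : (b * y) ^ 2 / (2 * l) ≤ b₀ * f * y ^ 2 / (2 * l) := by rw [mul_pow]; gcongr
    nlinarith
  have q₂ : l / 4 * (e ^ 2 * y ^ 2) - b₀ * f * y ^ 2 / l * y ^ 2 ≤ p₂ := by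
    have : b * y ^ 2 * (e * y) ≤ l / 4 * (e * y) ^ 2 + (b * y ^ 2) ^ 2 / l := by
      have : 0 ≤ (l * (e * y) - 2 * (b * y ^ 2)) ^ 2 / (4 * l) := by positivity
      have e1 : (l * (e * y) - 2 * (b * y ^ 2)) ^ 2 / (4 * l) =
        l / 4 * (e * y) ^ 2 + (b * y ^ 2) ^ 2 / l - b * y ^ 2 * (e * y) := by field_simp; ring
      linarith
    have h4 : (b * y ^ 2) ^ 2 / l ≤ b₀ * f * y ^ 2 / l * y ^ 2 := by
      calc (b * y ^ 2) ^ 2 / l = b ^ 2 * y ^ 2 / l * y ^ 2 := by ring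
        _ ≤ _ := by gcongr
    nlinarith
  have q₃ : -(l / 16 * ζ ^ 2 * e ^ 2 + 16 * u ^ 2 / l * (z ^ 2 * y ^ 2) + ζ ^ 2 * (b₀ * f * y ^ 2) +
      z ^ 2 * y ^ 2) ≤ 2 * ζ * p₃ := by
    have a1 : |2 * ζ * p₃| ≤ 2 * |ζ| * (z * (u * (e * y) + b * y ^ 2)) := by
      rw [abs_mul, abs_mul, abs_of_pos (zero_lt_two' ℝ)]; gcongr
    have a2 : 2 * |ζ| * (z * (u * (e * y))) ≤
        l / 16 * ζ ^ 2 * e ^ 2 + 16 * u ^ 2 / l * (z ^ 2 * y ^ 2) := by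
      have : 0 ≤ (l * |ζ| * e - 16 * u * z * y) ^ 2 / (16 * l) := by positivity
      have e1 : (l * |ζ| * e - 16 * u * z * y) ^ 2 / (16 * l) =
        l / 16 * |ζ| ^ 2 * e ^ 2 + 16 * u ^ 2 / l * (z ^ 2 * y ^ 2) -
          2 * |ζ| * (z * (u * (e * y))) := by field_simp; ring
      rw [sq_abs] at e1
      linarith
    have a3 : 2 * |ζ| * (z * (b * y ^ 2)) ≤ ζ ^ 2 * (b₀ * f * y ^ 2) + z ^ 2 * y ^ 2 := by
      have h5 : ζ ^ 2 * (b ^ 2 * y ^ 2) ≤ ζ ^ 2 * (b₀ * f * y ^ 2) := by gcongr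
      have h6 : 0 ≤ (|ζ| * (b * y) - z * y) ^ 2 := sq_nonneg _
      have h7 : (|ζ| * (b * y) - z * y) ^ 2 =
        |ζ| ^ 2 * (b ^ 2 * y ^ 2) + z ^ 2 * y ^ 2 - 2 * |ζ| * (z * (b * y ^ 2)) := by ring
      rw [sq_abs] at h7
      linarith
    linarith [(abs_le.1 a1).1]
  have t₁ := mul_le_mul_of_nonneg_left q₁ (by positivity : 0 ≤ ζ ^ 2 * g)
  have t₂ := mul_le_mul_of_nonneg_left q₂ (by positivity : 0 ≤ ζ ^ 2 * gp)
  have t₃ := mul_le_mul_of_nonneg_left q₃ hg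
  have s1 : 0 ≤ ζ ^ 2 * g * (b₀ * f * y ^ 2) / (2 * l) := by positivity
  have s2 : 0 ≤ (16 * u ^ 2 / l + 1) * (ζ ^ 2 * (g + gp * y ^ 2) * y ^ 2 * f) := by positivity
  have s3 : 0 ≤ b₀ * (1 / l + 1) * (g * y ^ 2 * z ^ 2) := by positivity
  have s4 : 0 ≤ b₀ * (ζ ^ 2 * gp * y ^ 2 * y ^ 2 * f) := by positivity
  have s5 : 0 ≤ l * (ζ ^ 2 * gp * y ^ 2 * e ^ 2) := by positivity
  have e1 : ζ ^ 2 * g * (b₀ * f * y ^ 2) / (2 * l) = b₀ * (1 / l) * (ζ ^ 2 * g * y ^ 2 * f) / 2 := by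
    field_simp
  have e2 : ζ ^ 2 * g * (l / 8 * e ^ 2 - b₀ * f * y ^ 2 / (2 * l)) =
    l / 8 * (ζ ^ 2 * g * e ^ 2) - b₀ * (1 / l) * (ζ ^ 2 * g * y ^ 2 * f) / 2 := by field_simp
  have e3 : ζ ^ 2 * gp * (l / 4 * (e ^ 2 * y ^ 2) - b₀ * f * y ^ 2 / l * y ^ 2) =
    l / 4 * (ζ ^ 2 * gp * y ^ 2 * e ^ 2) - b₀ * (1 / l) * (ζ ^ 2 * gp * y ^ 2 * y ^ 2 * f) := by
    field_simp
  rw [e2] at t₁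
  rw [e3] at t₂
  rw [e1] at s1
  linarith

set_option maxHeartbeats 800000 in
/-- Lower bound for the tested Bochner identity at a point where `Q = y² > 0`. -/
theorem bochner_lower (n : ℕ) {l u X : ℝ} (hl : 0 < l) (hu : 0 < u) (hX : 0 < X) :
    ∃ C₁ C₂ : ℝ, 0 < C₁ ∧ 0 < C₂ ∧ ∀ (w : Fin n → E) (D : Fin n → Fin n → E) (dQ z : Fin n → ℝ) (ξ : E)
      (y N r r' a ζ g gp : ℝ), 0 < y → 0 ≤ N → ∑ i, ‖w i‖ ^ 2 = y ^ 2 →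
      (∀ i j, ‖D i j - D j i‖ ≤ 2 * N * y) →
      (∀ i, dQ i = 2 * ∑ j, inner ℝ (D i j) (w j)) → 0 < a → l * a ≤ r → r ≤ u * a →
      l * a ≤ r + 2 * y ^ 2 * r' → r + 2 * y ^ 2 * r' ≤ u * a → ‖ξ‖ ≤ X * (a * y) →
      0 ≤ g → 0 ≤ gp →
      a * (ζ ^ 2 * (g + gp * y ^ 2) * ((∑ i, dQ i ^ 2) / y ^ 2)) ≤
        C₁ * ((∑ i, ∑ j, inner ℝ (r • D j i + (r' * dQ j) • w i)
            ((ζ ^ 2 * g) • D i j + (ζ ^ 2 * gp * dQ i + 2 * ζ * g * z i) • w j)) +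
          inner ℝ ξ (∑ j, ((ζ ^ 2 * g) • D j j + (ζ ^ 2 * gp * dQ j + 2 * ζ * g * z j) • w j))) +
        C₂ * (a * (ζ ^ 2 * (g + gp * y ^ 2) * y ^ 2 * (1 + N ^ 2) + g * y ^ 2 * ∑ i, z i ^ 2)) := by
  set b₁ : ℝ := 4 * n * u + X * (√n + 1) with hb₁
  have hb₁0 : 0 < b₁ := by positivity
  set C₁ : ℝ := 2 * b₁ ^ 2 * (1 / l + 1) + 16 * u ^ 2 / l + 1
  have hC₁0 : 0 < C₁ := by positivity
  refine ⟨16 / l, 16 / l * C₁, by positivity, by positivity, ?_⟩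
  intro w D dQ z ξ y N r r' a ζ g gp hy hN hw hR hdQ ha hr hr2 hr' hr'2 hξ hg hgp
  -- One coefficient dominating those of all the cross terms; its square is controlled by `1 + N²`,
  -- the weight in the conclusion.
  set b : ℝ := b₁ * (1 + N) with hb
  have hb2 : b ^ 2 ≤ 2 * b₁ ^ 2 * (1 + N ^ 2) := by
    rw [hb, mul_pow]; nlinarith [mul_nonneg (sq_nonneg b₁) (sq_nonneg (1 - N))]
  have hdd : 0 ≤ ∑ i, ∑ j, ‖D i j‖ ^ 2 :=
    Finset.sum_nonneg fun _ _ => Finset.sum_nonneg fun _ _ => by positivity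
  have hGG : 0 ≤ ∑ i, dQ i ^ 2 := Finset.sum_nonneg fun _ _ => by positivity
  have hzz : 0 ≤ ∑ i, z i ^ 2 := Finset.sum_nonneg fun _ _ => by positivity
  have k₁ := bochner_gradient_term hy.le hN hw hR hdQ ha.le hl.le hr hr2 hr' hr'2 hX.le hξ
  have k₂ := bochner_scalar_term_lower hy.le hN hw hR hdQ ha.le hl.le hr hr2 hr' hX.le hξ
  have k₃ := bochner_scalar_term_abs z hy.le hN hw hR hdQ ha.le hl.le hr hr2 hr' hr'2 hX.le hξ
  have k₄ := sqrt_sum_dQ_le hy.le hw hdQ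
  set P₁ := (∑ i, ∑ j, inner ℝ (r • D j i + (r' * dQ j) • w i) (D i j)) +
    inner ℝ ξ (∑ j, D j j) with hP₁
  set P₂ := (∑ i, ∑ j, inner ℝ (r • D j i + (r' * dQ j) • w i) (dQ i • w j)) +
    inner ℝ ξ (∑ j, dQ j • w j) with hP₂
  set P₃ := (∑ i, ∑ j, inner ℝ (r • D j i + (r' * dQ j) • w i) (z i • w j)) +
    inner ℝ ξ (∑ j, z j • w j) with hP₃
  have hP : (∑ i, ∑ j, inner ℝ (r • D j i + (r' * dQ j) • w i)
        ((ζ ^ 2 * g) • D i j + (ζ ^ 2 * gp * dQ i + 2 * ζ * g * z i) • w j)) +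
      inner ℝ ξ (∑ j, ((ζ ^ 2 * g) • D j j + (ζ ^ 2 * gp * dQ j + 2 * ζ * g * z j) • w j)) =
      ζ ^ 2 * g * P₁ + ζ ^ 2 * gp * P₂ + 2 * ζ * g * P₃ := by
    have e1 : ∀ i j, inner ℝ (r • D j i + (r' * dQ j) • w i)
        ((ζ ^ 2 * g) • D i j + (ζ ^ 2 * gp * dQ i + 2 * ζ * g * z i) • w j) =
        ζ ^ 2 * g * inner ℝ (r • D j i + (r' * dQ j) • w i) (D i j) +
        (ζ ^ 2 * gp * inner ℝ (r • D j i + (r' * dQ j) • w i) (dQ i • w j) +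
        2 * ζ * g * inner ℝ (r • D j i + (r' * dQ j) • w i) (z i • w j)) := by
      intro i j
      rw [inner_add_right]
      simp only [real_inner_smul_right]
      ring
    have e2 : inner ℝ ξ (∑ j, ((ζ ^ 2 * g) • D j j +
        (ζ ^ 2 * gp * dQ j + 2 * ζ * g * z j) • w j)) =
        ζ ^ 2 * g * inner ℝ ξ (∑ j, D j j) + (ζ ^ 2 * gp * inner ℝ ξ (∑ j, dQ j • w j) +
        2 * ζ * g * inner ℝ ξ (∑ j, z j • w j)) := by
      simp only [inner_sum, Finset.mul_sum, ← Finset.sum_add_distrib]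
      refine Finset.sum_congr rfl fun j _ => ?_
      rw [inner_add_right]
      simp only [real_inner_smul_right]
      ring
    rw [e2]
    simp only [e1, Finset.sum_add_distrib, ← Finset.mul_sum]
    rw [hP₁, hP₂, hP₃]
    ring
  rw [hP]
  set d := √(∑ i, ∑ j, ‖D i j‖ ^ 2) with hd
  set G := √(∑ i, dQ i ^ 2) with hG
  set Z := √(∑ i, z i ^ 2) with hZ
  have hd2 : ∑ i, ∑ j, ‖D i j‖ ^ 2 = d ^ 2 := (Real.sq_sqrt hdd).symm
  have hG2 : ∑ i, dQ i ^ 2 = G ^ 2 := (Real.sq_sqrt hGG).symm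
  have hZ2 : ∑ i, z i ^ 2 = Z ^ 2 := (Real.sq_sqrt hzz).symm
  have hd0 : 0 ≤ d := Real.sqrt_nonneg _
  have hG0 : 0 ≤ G := Real.sqrt_nonneg _
  have hZ0 : 0 ≤ Z := Real.sqrt_nonneg _
  rw [hd2] at k₁ k₄
  rw [hG2] at k₂ k₄
  rw [hG2, hZ2]
  have hGe : G = G / y * y := by field_simp
  have c₁ : 4 * n * u * N + X * √n ≤ b := by
    have h : 0 ≤ 4 * n * u + X + X * N + X * √n * N := by positivity
    have e : b = 4 * n * u * N + X * √n + (4 * n * u + X + X * N + X * √n * N) := by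
      rw [hb, hb₁]; ring
    linarith
  have c₂ : 2 * n * u * N + X ≤ b := by
    have h : 0 ≤ 4 * n * u + 2 * n * u * N + X * N + X * √n + X * √n * N := by positivity
    have e : b = 2 * n * u * N + X + (4 * n * u + 2 * n * u * N + X * N + X * √n + X * √n * N) := by
      rw [hb, hb₁]; ring
    linarith
  -- The three contributions are divided by `a`, and `e = |∇Q|/y`.
  have hy' := young_combination (l := l) (u := u) (b := b) (b₀ := 2 * b₁ ^ 2) (f := 1 + N ^ 2)
    (y := y) (e := G / y) (d := d) (ζ := ζ) (z := Z) (g := g) (gp := gp) (p₁ := P₁ / a)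
    (p₂ := P₂ / a) (p₃ := P₃ / a) hl (by positivity) (by positivity) hb2 hg hgp
    (by rw [div_pow, div_le_iff₀ (by positivity)]; linarith)
    (by
      rw [le_div_iff₀ ha, mul_comm]
      exact le_trans (by gcongr) k₁)
    (by
      rw [le_div_iff₀ ha, ← hGe, mul_comm]
      exact le_trans (by gcongr) k₂)
    (by
      rw [abs_div, abs_of_pos ha, div_le_iff₀ ha, ← hGe]
      refine k₃.trans ?_
      calc _ ≤ a * Z * (u * G + b * y ^ 2) := by gcongr
        _ = _ := by ring)
  have h1 := mul_le_mul_of_nonneg_left hy' (by positivity : 0 ≤ 16 / l * a)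
  set I := ζ ^ 2 * (g + gp * y ^ 2) * y ^ 2 * (1 + N ^ 2) + g * y ^ 2 * Z ^ 2 with hI
  have hI0 : 0 ≤ I := by positivity
  change _ ≤ 16 / l * a * (_ + C₁ * I) at h1
  have e3 : 16 / l * a * (l / 16 * (ζ ^ 2 * (g + gp * y ^ 2) * (G / y) ^ 2)) =
      a * (ζ ^ 2 * (g + gp * y ^ 2) * (G ^ 2 / y ^ 2)) := by field_simp
  have e4 : 16 / l * a * (ζ ^ 2 * g * (P₁ / a) + ζ ^ 2 * gp * (P₂ / a) + 2 * ζ * g * (P₃ / a) + C₁ * I) =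
      16 / l * (ζ ^ 2 * g * P₁ + ζ ^ 2 * gp * P₂ + 2 * ζ * g * P₃) + 16 / l * C₁ * (a * I) := by
    field_simp
  rw [e3, e4] at h1
  exact h1
end Bochner

/-! ### The Caccioppoli inequality. -/

section Energy

open scoped Topology ENNReal NNReal

/-- The positive and negative parts of `p` have equal finite integrals and cancel. Nothing is asked
of `f` and `h` beyond the pointwise inequality and `f ≥ 0`, so the right-hand side of the energy
estimate may be infinite. -/
theorem lintegral_ofReal_le_of_integral_eq_zero {α : Type*} [MeasurableSpace α] {μ : Measure α}
    {f p h : α → ℝ} (hp : Integrable p μ) (hp0 : ∫ x, p x ∂μ = 0) (hf : ∀ x, 0 ≤ f x)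
    (hle : ∀ x, f x ≤ p x + h x) :
    ∫⁻ x, ENNReal.ofReal (f x) ∂μ ≤ ∫⁻ x, ENNReal.ofReal (h x) ∂μ := by
  have hpm : AEMeasurable p μ := hp.1.aemeasurable
  have fin1 : ∫⁻ x, ENNReal.ofReal (p x) ∂μ ≠ ∞ := hp.lintegral_lt_top.ne
  have fin2 : ∫⁻ x, ENNReal.ofReal (-p x) ∂μ ≠ ∞ := hp.neg.lintegral_lt_top.ne
  have heq : ∫⁻ x, ENNReal.ofReal (p x) ∂μ = ∫⁻ x, ENNReal.ofReal (-p x) ∂μ := by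
    rw [integral_eq_lintegral_pos_part_sub_lintegral_neg_part hp, sub_eq_zero,
      ENNReal.toReal_eq_toReal_iff' fin1 fin2] at hp0
    exact hp0
  have key : ∫⁻ x, (ENNReal.ofReal (f x) + ENNReal.ofReal (-p x)) ∂μ ≤
      ∫⁻ x, (ENNReal.ofReal (h x) + ENNReal.ofReal (p x)) ∂μ := by
    refine lintegral_mono fun x => ?_
    have := hle x
    rcases le_total 0 (p x) with h0 | h0
    · rw [ENNReal.ofReal_of_nonpos (by linarith : -p x ≤ 0), add_zero]
      exact (ENNReal.ofReal_le_ofReal (by linarith)).trans ENNReal.ofReal_add_le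
    · rw [ENNReal.ofReal_of_nonpos h0, add_zero, ← ENNReal.ofReal_add (hf x) (by linarith)]
      exact ENNReal.ofReal_le_ofReal (by linarith)
  have hpn : AEMeasurable (fun x => ENNReal.ofReal (-p x)) μ := hpm.neg.ennreal_ofReal
  rw [lintegral_add_right' _ hpn, lintegral_add_right' _ hpm.ennreal_ofReal,
    heq] at key
  exact (ENNReal.add_le_add_iff_right fin2).1 key

variable {n : ℕ} {E : Type*} [NormedAddCommGroup E] [InnerProductSpace ℝ E]

local notation "V" => EuclideanSpace ℝ (Fin n)

theorem hasFDerivAt_clm_apply_const {G : Type*} [NormedAddCommGroup G] [NormedSpace ℝ G]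
    {α : V → V →L[ℝ] G} {x : V} (h : DifferentiableAt ℝ α x) (v : V) :
    HasFDerivAt (fun y => α y v) ((fderiv ℝ α x).flip v) x := by
  simpa using h.hasFDerivAt.clm_apply (hasFDerivAt_const v x)

/-- Integrating by parts twice exchanges the two derivatives. -/
theorem integral_inner_fderiv_swap {α φ : V → V →L[ℝ] E} {U : Set V} (hU : IsOpen U)
    (hα : ContDiffOn ℝ 1 α U) (hφ : ContDiff ℝ 2 φ) (hc : HasCompactSupport φ)
    (hs : tsupport φ ⊆ U) (a b c d : V) :
    Integrable (fun x => inner ℝ (fderiv ℝ α x b a) (fderiv ℝ φ x c d) -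
      inner ℝ (fderiv ℝ α x c a) (fderiv ℝ φ x b d)) ∧
    ∫ x, (inner ℝ (fderiv ℝ α x b a) (fderiv ℝ φ x c d) -
      inner ℝ (fderiv ℝ α x c a) (fderiv ℝ φ x b d)) = 0 := by
  have hφ1 : ContDiff ℝ 1 (fderiv ℝ φ) := hφ.fderiv_right (by norm_num)
  have hts : ∀ c : V, tsupport (fun x => inner ℝ (α x a) (fderiv ℝ φ x c d)) ⊆ tsupport φ := by
    intro c
    refine closure_minimal (fun x hx => ?_) (isClosed_tsupport φ)
    refine support_fderiv_subset ℝ (f := φ) fun h => hx ?_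
    simp [h]
  have hu : ∀ c : V, ContDiff ℝ 1 (fun x => inner ℝ (α x a) (fderiv ℝ φ x c d)) := fun c =>
    contDiff_of_contDiffOn_tsupport hU (((hα.clm_apply contDiffOn_const)).inner ℝ
      ((hφ1.clm_apply contDiff_const).clm_apply contDiff_const).contDiffOn) ((hts c).trans hs)
  have huc : ∀ c : V, HasCompactSupport (fun x => inner ℝ (α x a) (fderiv ℝ φ x c d)) :=
    fun c => hc.of_isClosed_subset (isClosed_tsupport _) (hts c)
  have hd : ∀ x ∈ U, ∀ b c : V, fderiv ℝ (fun x => inner ℝ (α x a) (fderiv ℝ φ x c d)) x b =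
      inner ℝ (fderiv ℝ α x b a) (fderiv ℝ φ x c d) +
        inner ℝ (α x a) (fderiv ℝ (fderiv ℝ φ) x b c d) := by
    intro x hx b c
    have h1 := hasFDerivAt_clm_apply_const
      ((hα.contDiffAt (hU.mem_nhds hx)).differentiableAt one_ne_zero) a
    have h2 := hasFDerivAt_clm_apply_const (hφ1.differentiable one_ne_zero x) c
    have h3 : HasFDerivAt (fun y => fderiv ℝ φ y c d) _ x :=
      h2.clm_apply (hasFDerivAt_const d x)
    rw [(h1.inner ℝ h3).fderiv]
    simp [add_comm]
  -- The integrand is a divergence: in the difference of the two derivatives the terms with second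
  -- derivatives of `φ` cancel by symmetry, and `α` is differentiated only once.
  have hP : ∀ x, inner ℝ (fderiv ℝ α x b a) (fderiv ℝ φ x c d) -
      inner ℝ (fderiv ℝ α x c a) (fderiv ℝ φ x b d) =
      fderiv ℝ (fun x => inner ℝ (α x a) (fderiv ℝ φ x c d)) x b -
      fderiv ℝ (fun x => inner ℝ (α x a) (fderiv ℝ φ x b d)) x c := by
    intro x
    by_cases hx : x ∈ tsupport φ
    · rw [hd x (hs hx), hd x (hs hx)]
      have hsym : IsSymmSndFDerivAt ℝ φ x :=
        hφ.contDiffAt.isSymmSndFDerivAt (by simp)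
      rw [hsym.eq b c]
      ring
    · have h0 : ∀ c : V, fderiv ℝ (fun x => inner ℝ (α x a) (fderiv ℝ φ x c d)) x = 0 := fun c =>
        Function.notMem_support.1 fun h =>
          hx (hts c (support_fderiv_subset ℝ h))
      have h1 : fderiv ℝ φ x = 0 :=
        Function.notMem_support.1 fun h => hx (support_fderiv_subset ℝ h)
      simp [h0, h1]
  have hint : ∀ b c : V, Integrable
      (fun x => fderiv ℝ (fun x => inner ℝ (α x a) (fderiv ℝ φ x c d)) x b) := fun b c =>
    (((hu c).continuous_fderiv one_ne_zero).clm_apply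
      continuous_const).integrable_of_hasCompactSupport ((huc c).fderiv_apply ℝ b)
  simp only [hP]
  refine ⟨(hint b c).sub (hint c b), ?_⟩
  rw [integral_sub (hint b c) (hint c b), integral_fderiv_eq_zero volume (hu c) (huc c),
    integral_fderiv_eq_zero volume (hu b) (huc b), sub_zero]

theorem dOne_apply {ω : V → V →L[ℝ] E} {x : V} (h : DifferentiableAt ℝ ω x) (u v : V) :
    dOne ω x ![u, v] = fderiv ℝ ω x u v - fderiv ℝ ω x v u := by
  have h1 : DifferentiableAt ℝ (fun y => ContinuousAlternatingMap.ofSubsingleton ℝ V E (0 : Fin 1)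
      (ω y)) x := by
    have := (ContinuousAlternatingMap.ofSubsingletonLIE (𝕜 := ℝ) (E := V) (F := E)
      (0 : Fin 1)).differentiable.differentiableAt.comp x h
    exact this
  rw [dOne, extDeriv_apply h1, Fin.sum_univ_two]
  have h2 : ∀ a b : V, fderiv ℝ (fun y => ω y a) x b = fderiv ℝ ω x b a := fun a b => by
    rw [(hasFDerivAt_clm_apply_const h a).fderiv]; rfl
  simp [Fin.removeNth, h2, sub_eq_add_neg]

/-- The equation `dω = ν ∧ ω` enters the estimates only through this bound on the antisymmetric part
of `∇ω`. -/
theorem norm_fderiv_antisymm_le {ω : V → V →L[ℝ] E} {ν : V → V →L[ℝ] E →L[ℝ] E} {x : V}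
    (h : DifferentiableAt ℝ ω x)
    (hd : ∀ u v : V, dOne ω x ![u, v] = wedgeOne (ν x) (ω x) u v) (i j : Fin n) :
    ‖fderiv ℝ ω x (EuclideanSpace.single i 1) (EuclideanSpace.single j 1) -
      fderiv ℝ ω x (EuclideanSpace.single j 1) (EuclideanSpace.single i 1)‖ ≤
      2 * ‖ν x‖ * √(Qsq (ω x)) := by
  rw [← dOne_apply h, hd, wedgeOne]
  have key : ∀ i j : Fin n, ‖ν x (EuclideanSpace.single i 1) (ω x (EuclideanSpace.single j 1))‖ ≤
      ‖ν x‖ * √(Qsq (ω x)) := fun i j =>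
    ((ν x (EuclideanSpace.single i 1)).le_opNorm _).trans <|
      mul_le_mul (norm_apply_single_le _ _)
        ((norm_apply_single_le _ _).trans (norm_le_sqrt_Qsq _)) (norm_nonneg _)
        (ContinuousLinearMap.opNorm_nonneg _)
  have := norm_sub_le (ν x (EuclideanSpace.single i 1) (ω x (EuclideanSpace.single j 1)))
    (ν x (EuclideanSpace.single j 1) (ω x (EuclideanSpace.single i 1)))
  linarith [key i j, key j i]

/-- The Caccioppoli-type inequality for solutions, tested with `ζ² g(Q) ω`. -/
theorem energy_estimate {q l u X : ℝ} (hl : 0 < l) (hu : 0 < u) (hX : 0 < X)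
    {ρ : ℝ → ℝ} (hρd : ContDiffOn ℝ 1 ρ (Ioi 0))
    (hρ : ∀ Q, 1 ≤ Q → l * Q ^ q ≤ ρ Q ∧ ρ Q ≤ u * Q ^ q ∧
      l * Q ^ q ≤ ρ Q + 2 * Q * deriv ρ Q ∧ ρ Q + 2 * Q * deriv ρ Q ≤ u * Q ^ q)
    {ξ : (V →L[ℝ] E) → E} (hξ : ∀ w, 1 ≤ Qsq w → ‖ξ w‖ ≤ X * (Qsq w ^ q * √(Qsq w)))
    {U : Set V} (hU : IsOpen U) {ω : V → V →L[ℝ] E} {ν : V → V →L[ℝ] E →L[ℝ] E}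
    (hω : ContDiffOn ℝ 2 ω U)
    (hδ : ∀ x ∈ U, codiff (fun y => ρ (Qsq (ω y)) • ω y) x = ξ (ω x))
    (hd : ∀ x ∈ U, ∀ u v : V, dOne ω x ![u, v] = wedgeOne (ν x) (ω x) u v) :
    ∃ C : ℝ, 0 < C ∧ ∀ (ζ : V → ℝ) (g : ℝ → ℝ), ContDiff ℝ 2 ζ → HasCompactSupport ζ →
      tsupport ζ ⊆ U → ContDiff ℝ 2 g → (∀ t, 0 ≤ g t) → (∀ t, 0 ≤ deriv g t) →
      (∀ t, t ≤ 1 → g t = 0) →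
      ∫⁻ x, ENNReal.ofReal (Qsq (ω x) ^ q * (ζ x ^ 2 *
        (g (Qsq (ω x)) + deriv g (Qsq (ω x)) * Qsq (ω x)) *
        ((∑ i, (fderiv ℝ (fun y => Qsq (ω y)) x (EuclideanSpace.single i 1)) ^ 2) / Qsq (ω x)) +
        g (Qsq (ω x)) * Qsq (ω x) * ∑ i, (fderiv ℝ ζ x (EuclideanSpace.single i 1)) ^ 2)) ≤
      ∫⁻ x, ENNReal.ofReal (C * (Qsq (ω x) ^ q * (ζ x ^ 2 *
        (g (Qsq (ω x)) + deriv g (Qsq (ω x)) * Qsq (ω x)) * Qsq (ω x) * (1 + ‖ν x‖ ^ 2) +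
        g (Qsq (ω x)) * Qsq (ω x) * ∑ i, (fderiv ℝ ζ x (EuclideanSpace.single i 1)) ^ 2))) := by
  obtain ⟨C₁, C₂, hC₁, hC₂, hB⟩ := bochner_lower (E := E) n hl hu hX
  -- The extra `1` pays for the term `g(Q) Q |∇ζ|²`, which is also added on the left so that the
  -- Sobolev step can use a single quantity.
  refine ⟨C₂ + 1, by positivity, fun ζ g hζ hζc hζU hg hg0 hg' hg1 => ?_⟩
  set e : Fin n → V := fun i => EuclideanSpace.single i 1 with he
  set φ : V → V →L[ℝ] E := fun x => (ζ x ^ 2 * g (Qsq (ω x))) • ω x with hφdef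
  set α : V → V →L[ℝ] E := fun y => ρ (Qsq (ω y)) • ω y with hαdef
  have hgd1 : ∀ t, t ≤ 1 → deriv g t = 0 := fun t ht =>
    IsLocalMin.deriv_eq_zero (Filter.Eventually.of_forall fun s => by rw [hg1 t ht]; exact hg0 s)
  have hQ : ContDiffOn ℝ 2 (fun y => Qsq (ω y)) U := contDiff_Qsq.comp_contDiffOn hω
  have hφζ : tsupport φ ⊆ tsupport ζ := by
    refine closure_mono fun x hx h => hx ?_
    simp [hφdef, h]
  have hφ : ContDiff ℝ 2 φ := contDiff_of_contDiffOn_tsupport hU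
    (((hζ.contDiffOn.pow 2).mul (hg.comp_contDiffOn hQ)).smul hω) (hφζ.trans hζU)
  have hφc : HasCompactSupport φ := hζc.of_isClosed_subset (isClosed_tsupport _) hφζ
  set U' : Set V := U ∩ (fun y => Qsq (ω y)) ⁻¹' Ioi 0 with hU'
  have hU'o : IsOpen U' := hQ.continuousOn.isOpen_inter_preimage hU isOpen_Ioi
  -- Near a point with `Q < 1` the factor `g(Q)` vanishes. Hence the test form lives where `Q > 0`,
  -- and `ρ(Q)ω` is `C¹` there.
  have hφU' : tsupport φ ⊆ U' := by
    intro x hx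
    have hxU := hζU (hφζ hx)
    refine ⟨hxU, ?_⟩
    by_contra hcon
    have hlt : Qsq (ω x) < 1 := by
      have : ¬ 0 < Qsq (ω x) := hcon
      linarith
    have : φ =ᶠ[𝓝 x] 0 := by
      filter_upwards [(hQ.continuousOn.continuousAt (hU.mem_nhds hxU)).eventually_lt
        continuousAt_const hlt] with y hy
      simp [hφdef, hg1 _ hy.le]
    exact notMem_tsupport_iff_eventuallyEq.2 this hx
  have hα : ContDiffOn ℝ 1 α U' := by
    have h1 : ContDiffOn ℝ 1 (fun y => Qsq (ω y)) U' :=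
      (hQ.mono inter_subset_left).of_le (by norm_num)
    exact (hρd.comp h1 fun x hx => hx.2).smul ((hω.mono inter_subset_left).of_le (by norm_num))
  have hsw := fun i j : Fin n => integral_inner_fderiv_swap hU'o hα hφ hφc hφU' (e i) (e j) (e i) (e j)
  set P : V → ℝ := fun x => ∑ i, ∑ j, (inner ℝ (fderiv ℝ α x (e j) (e i)) (fderiv ℝ φ x (e i) (e j)) -
      inner ℝ (fderiv ℝ α x (e i) (e i)) (fderiv ℝ φ x (e j) (e j))) with hP
  have hPi : Integrable P := integrable_finsetSum _ fun i _ => integrable_finsetSum _ fun j _ =>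
    (hsw i j).1
  have hP0 : ∫ x, P x = 0 := by
    rw [integral_finsetSum _ fun i _ => integrable_finsetSum _ fun j _ => (hsw i j).1]
    refine Finset.sum_eq_zero fun i _ => ?_
    rw [integral_finsetSum _ fun j _ => (hsw i j).1]
    exact Finset.sum_eq_zero fun j _ => (hsw i j).2
  refine lintegral_ofReal_le_of_integral_eq_zero (p := fun x => C₁ * P x) (hPi.const_mul C₁)
    (by rw [integral_const_mul, hP0, mul_zero]) (fun x => ?_) (fun x => ?_)
  · have := Qsq_nonneg (ω x)
    have := hg0 (Qsq (ω x))
    have := hg' (Qsq (ω x))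
    positivity
  · by_cases hx : x ∈ tsupport ζ
    swap
    · have h1 : fderiv ℝ φ x = 0 :=
        Function.notMem_support.1 fun h => hx (hφζ (support_fderiv_subset ℝ h))
      have h2 : ζ x = 0 := image_eq_zero_of_notMem_tsupport hx
      have h4 : P x = 0 := by simp [hP, h1]
      have h5 : fderiv ℝ ζ x = 0 :=
        Function.notMem_support.1 fun h => hx (support_fderiv_subset ℝ h)
      simp [h4, h2, h5]
    have hxU := hζU hx
    have hωd : DifferentiableAt ℝ ω x :=
      (hω.contDiffAt (hU.mem_nhds hxU)).differentiableAt (by norm_num)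
    have hQd : DifferentiableAt ℝ (fun y => Qsq (ω y)) x :=
      (hQ.contDiffAt (hU.mem_nhds hxU)).differentiableAt (by norm_num)
    have hφ' : ∀ v, fderiv ℝ φ x v = (ζ x ^ 2 * g (Qsq (ω x))) • fderiv ℝ ω x v +
        (ζ x ^ 2 * deriv g (Qsq (ω x)) * fderiv ℝ (fun y => Qsq (ω y)) x v +
          2 * ζ x * g (Qsq (ω x)) * fderiv ℝ ζ x v) • ω x := by
      intro v
      have h1 : HasFDerivAt (fun y => ζ y ^ 2) _ x :=
        ((hζ.differentiable (by norm_num)) x).hasFDerivAt.pow 2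
      have h2 : HasFDerivAt (fun y => g (Qsq (ω y))) _ x :=
        ((hg.differentiable (by norm_num)) _).hasDerivAt.comp_hasFDerivAt x hQd.hasFDerivAt
      have h3 : HasFDerivAt φ _ x := (h1.mul h2).smul hωd.hasFDerivAt
      rw [h3.fderiv]
      simp
      congr 2 <;> ring
    rcases le_or_gt (Qsq (ω x)) 1 with hQ1 | hQ1
    · have h1 : ∀ v, fderiv ℝ φ x v = 0 := fun v => by
        rw [hφ', hg1 _ hQ1, hgd1 _ hQ1]; simp
      have h4 : P x = 0 := by simp [hP, h1]
      rw [h4, hg1 _ hQ1, hgd1 _ hQ1]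
      simp
    have hα' : ∀ v, fderiv ℝ α x v = ρ (Qsq (ω x)) • fderiv ℝ ω x v +
        (deriv ρ (Qsq (ω x)) * fderiv ℝ (fun y => Qsq (ω y)) x v) • ω x := by
      intro v
      have h1 : HasDerivAt ρ (deriv ρ (Qsq (ω x))) (Qsq (ω x)) :=
        ((hρd.contDiffAt (Ioi_mem_nhds (by linarith))).differentiableAt one_ne_zero).hasDerivAt
      have h2 : HasFDerivAt (fun y => ρ (Qsq (ω y))) _ x :=
        h1.comp_hasFDerivAt x hQd.hasFDerivAt
      have h3 : HasFDerivAt α _ x := h2.smul hωd.hasFDerivAt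
      rw [h3.fderiv]
      simp
    have hdiv : ∑ i, fderiv ℝ α x (e i) (e i) = -ξ (ω x) := by
      rw [← hδ x hxU, codiff, neg_neg]
    have hy : √(Qsq (ω x)) ^ 2 = Qsq (ω x) := Real.sq_sqrt (by linarith)
    obtain ⟨b1, b2, b3, b4⟩ := hρ _ hQ1.le
    have key := hB (fun i => ω x (e i)) (fun i j => fderiv ℝ ω x (e i) (e j))
      (fun i => fderiv ℝ (fun y => Qsq (ω y)) x (e i)) (fun i => fderiv ℝ ζ x (e i)) (ξ (ω x))
      (√(Qsq (ω x))) ‖ν x‖ (ρ (Qsq (ω x))) (deriv ρ (Qsq (ω x))) (Qsq (ω x) ^ q) (ζ x)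
      (g (Qsq (ω x))) (deriv g (Qsq (ω x))) (Real.sqrt_pos.2 (by linarith))
      (ContinuousLinearMap.opNorm_nonneg _)
      (by rw [hy]; rfl) (norm_fderiv_antisymm_le hωd (hd x hxU))
      (fun i => hasFDerivAt_Qsq_comp hωd _) (Real.rpow_pos_of_pos (by linarith) _) b1 b2
      (by rw [hy]; exact b3) (by rw [hy]; exact b4) (hξ _ hQ1.le) (hg0 _) (hg' _)
    rw [hy] at key
    -- The product of the two divergences becomes a pairing with `ξ(ω)` by the first equation.
    have hPx : P x = (∑ i, ∑ j, inner ℝ (fderiv ℝ α x (e j) (e i)) (fderiv ℝ φ x (e i) (e j))) +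
        inner ℝ (ξ (ω x)) (∑ j, fderiv ℝ φ x (e j) (e j)) := by
      rw [← neg_neg (ξ (ω x)), ← hdiv, inner_neg_left, sum_inner]
      simp only [hP, Finset.sum_sub_distrib, inner_sum]
      ring
    rw [hPx]
    simp only [hα', hφ', he, add_apply, smul_apply]
      at key ⊢
    have h1 := hg0 (Qsq (ω x))
    have h2 := hg' (Qsq (ω x))
    have h3 : 0 ≤ Qsq (ω x) := by linarith
    have h4 : 0 ≤ Qsq (ω x) ^ q * (ζ x ^ 2 * (g (Qsq (ω x)) +
        deriv g (Qsq (ω x)) * Qsq (ω x)) * Qsq (ω x) * (1 + ‖ν x‖ ^ 2)) := by positivity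
    linarith

end Energy

/-! ### From the energy inequality to level sets via Sobolev. -/

section Sobolev

open scoped Topology ENNReal NNReal

variable {n : ℕ} {E : Type*} [NormedAddCommGroup E] [InnerProductSpace ℝ E]

local notation "V" => EuclideanSpace ℝ (Fin n)

/-- The Sobolev inequality with exponent `2`, in terms of integrals. -/
theorem sobolev_two (hn : 2 < n) : ∃ C : ℝ, 0 < C ∧ ∀ v : V → ℝ, ContDiff ℝ 1 v →
    HasCompactSupport v →
    (∫⁻ x, ‖v x‖ₑ ^ (2 * n / (n - 2) : ℝ)) ^ ((n - 2) / n : ℝ) ≤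
      ENNReal.ofReal C * ∫⁻ x, ‖fderiv ℝ v x‖ₑ ^ (2 : ℝ) := by
  have hn' : (2 : ℝ) < n := by exact_mod_cast hn
  have hn0 : (0 : ℝ) < n := by linarith
  have hn2 : (0 : ℝ) < n - 2 := by linarith
  set p' : ℝ≥0 := ⟨2 * n / (n - 2), by positivity⟩ with hp'
  have hp'c : (p' : ℝ) = 2 * n / (n - 2) := rfl
  have hp'0 : (0 : ℝ) < p' := by rw [hp'c]; positivity
  set S := SNormLESNormFDerivOfEqConst (E := V) ℝ volume 2 with hS
  refine ⟨(S : ℝ) ^ 2 + 1, by positivity, fun v hv hc => ?_⟩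
  have h := eLpNorm_le_eLpNorm_fderiv_of_eq (F := ℝ) (μ := (volume : Measure V)) hv hc
    (p := 2) (p' := p') (by norm_num) (by simp; omega)
    (by rw [hp'c, finrank_euclideanSpace_fin]; push_cast; field_simp)
  rw [eLpNorm_eq_lintegral_rpow_enorm_toReal (by simpa using hp'0.ne') (by simp),
    eLpNorm_eq_lintegral_rpow_enorm_toReal (by simp) (by simp)] at h
  simp only [ENNReal.coe_toReal, NNReal.coe_ofNat, hp'c] at h
  have h2 := ENNReal.rpow_le_rpow h (zero_le_two : (0 : ℝ) ≤ 2)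
  rw [← ENNReal.rpow_mul, ENNReal.mul_rpow_of_nonneg _ _ zero_le_two, ← ENNReal.rpow_mul,
    show (1 / (2 * n / (n - 2)) * 2 : ℝ) = (n - 2) / n by field_simp,
    show (1 / 2 * 2 : ℝ) = 1 by norm_num, ENNReal.rpow_one] at h2
  refine h2.trans ?_
  gcongr
  rw [ENNReal.ofReal_add (by positivity) zero_le_one, ENNReal.ofReal_pow S.coe_nonneg,
    ENNReal.ofReal_coe_nnreal, ← ENNReal.rpow_natCast]
  exact le_self_add

/-- A `C²` version of `T ↦ s(T) T ^ m` for a cutoff `s` vanishing up to `a ≥ 1`. -/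
theorem contDiff_cutoff_mul_rpow {s : ℝ → ℝ} {a m : ℝ} (hs : ContDiff ℝ 2 s) (ha : 0 < a)
    (h0 : ∀ T, T ≤ a → s T = 0) : ContDiff ℝ 2 fun T => s T * T ^ m := by
  rw [contDiff_iff_contDiffAt]
  intro T
  rcases lt_or_ge T a with h | h
  · have : (fun T => s T * T ^ m) =ᶠ[𝓝 T] fun _ => 0 := by
      filter_upwards [Iio_mem_nhds h] with y hy
      rw [h0 y hy.le, zero_mul]
    exact contDiffAt_const.congr_of_eventuallyEq this
  · exact hs.contDiffAt.mul (Real.contDiffAt_rpow_const_of_ne (by linarith))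

/-- The derivative is `T^((q-1)/2) (s'T + s(q+1)/2)`. Where `s' ≠ 0` one has `T ≤ t + 2τ ≤ 3t`, so
`s'T ≤ 3M t/τ`, and `t/τ ≥ 1` absorbs the other summand. -/
theorem deriv_cutoff_mul_rpow_sq_le {s : ℝ → ℝ} {t τ M q T : ℝ} (hq : 0 < q) (hM : 0 < M)
    (hs : ContDiff ℝ 2 s) (hs0 : 0 ≤ s T) (hs1 : s T ≤ 1) (hs' : 0 ≤ deriv s T)
    (hs'M : deriv s T ≤ M / τ) (hs'o : t + τ + τ ≤ T → deriv s T = 0) (ht : 1 ≤ t) (hτ : 0 < τ)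
    (hτt : τ ≤ t) (hT : 0 < T) :
    deriv (fun T => s T * T ^ ((q + 1) / 2)) T ^ 2 ≤
      T ^ q / T * ((3 * M + (q + 1) / 2) * (t / τ)) ^ 2 := by
  have hlam1 : 1 ≤ t / τ := (one_le_div hτ).2 hτt
  set b : ℝ := T ^ ((q - 1) / 2) with hb
  have hb0 : 0 < b := Real.rpow_pos_of_pos hT _
  have hbT : T ^ ((q + 1) / 2) = b * T := by
    rw [hb, ← Real.rpow_add_one hT.ne']; ring_nf
  have hb2 : T ^ q / T = b ^ 2 := by
    rw [hb, ← Real.rpow_natCast, ← Real.rpow_mul hT.le, ← Real.rpow_sub_one hT.ne']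
    norm_num
  have hFd : deriv (fun T => s T * T ^ ((q + 1) / 2)) T =
      b * (deriv s T * T + s T * ((q + 1) / 2)) := by
    have h1 := ((hs.differentiable (by norm_num)) T).hasDerivAt
    have h2 := Real.hasDerivAt_rpow_const (x := T) (p := (q + 1) / 2) (Or.inl hT.ne')
    have h3 : HasDerivAt (fun T => s T * T ^ ((q + 1) / 2)) _ T := h1.mul h2
    rw [h3.deriv, hbT, show (q + 1) / 2 - 1 = (q - 1) / 2 by ring, ← hb]
    ring
  have hsT : deriv s T * T ≤ 3 * M * (t / τ) := by
    rcases le_or_gt (t + τ + τ) T with h | h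
    · rw [hs'o h, zero_mul]; positivity
    · calc deriv s T * T ≤ M / τ * (3 * t) := by
            gcongr
            linarith
        _ = _ := by ring
  rw [hFd, mul_pow, hb2]
  gcongr
  have h1 : s T * ((q + 1) / 2) ≤ 1 * ((q + 1) / 2) := by gcongr
  have h2 : 1 * ((q + 1) / 2) ≤ (t / τ) * ((q + 1) / 2) := by gcongr
  linarith

theorem norm_fderiv_mul_comp_sq_le {ζ h : V → ℝ} {F : ℝ → ℝ} {x : V}
    (hζ : DifferentiableAt ℝ ζ x) (hh : DifferentiableAt ℝ h x) (hF : DifferentiableAt ℝ F (h x)) :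
    ‖fderiv ℝ (fun y => ζ y * F (h y)) x‖ ^ 2 ≤
      2 * (ζ x ^ 2 * deriv F (h x) ^ 2 * ∑ i, (fderiv ℝ h x (EuclideanSpace.single i 1)) ^ 2) +
      2 * (F (h x) ^ 2 * ∑ i, (fderiv ℝ ζ x (EuclideanSpace.single i 1)) ^ 2) := by
  have hfd : fderiv ℝ (fun y => ζ y * F (h y)) x = (ζ x * deriv F (h x)) • fderiv ℝ h x +
      F (h x) • fderiv ℝ ζ x := by
    have h2 : HasFDerivAt (fun y => F (h y)) _ x :=
      hF.hasDerivAt.comp_hasFDerivAt x hh.hasFDerivAt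
    have h3 : HasFDerivAt (fun y => ζ y * F (h y)) _ x := hζ.hasFDerivAt.mul h2
    rw [h3.fderiv, smul_smul]
  have key : ∀ L : V →L[ℝ] ℝ, ‖L‖ ^ 2 ≤ ∑ i, (L (EuclideanSpace.single i 1)) ^ 2 := fun L => by
    have h1 := norm_le_sqrt_sum L
    simp only [Real.norm_eq_abs, sq_abs] at h1
    exact (Real.le_sqrt (norm_nonneg L) (Finset.sum_nonneg fun _ _ => by positivity)).1 h1
  have k1 := key (fderiv ℝ h x)
  have k2 := key (fderiv ℝ ζ x)
  have h1 : ‖fderiv ℝ (fun y => ζ y * F (h y)) x‖ ≤ |ζ x * deriv F (h x)| * ‖fderiv ℝ h x‖ +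
      |F (h x)| * ‖fderiv ℝ ζ x‖ := by
    rw [hfd]
    refine (norm_add_le _ _).trans ?_
    rw [norm_smul, norm_smul, Real.norm_eq_abs, Real.norm_eq_abs]
  calc ‖fderiv ℝ (fun y => ζ y * F (h y)) x‖ ^ 2
      ≤ (|ζ x * deriv F (h x)| * ‖fderiv ℝ h x‖ + |F (h x)| * ‖fderiv ℝ ζ x‖) ^ 2 := by gcongr
    _ ≤ 2 * ((|ζ x * deriv F (h x)| * ‖fderiv ℝ h x‖) ^ 2 + (|F (h x)| * ‖fderiv ℝ ζ x‖) ^ 2) :=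
        add_sq_le
    _ = 2 * (ζ x ^ 2 * deriv F (h x) ^ 2 * ‖fderiv ℝ h x‖ ^ 2) +
        2 * (F (h x) ^ 2 * ‖fderiv ℝ ζ x‖ ^ 2) := by
          rw [mul_pow, mul_pow, sq_abs, sq_abs]; ring
    _ ≤ _ := by gcongr

/-- The squared gradient of the truncated power is dominated by the left-hand density of the energy
estimate, at the points where `g = 1`; the loss is `lam ^ 2` with `lam = t/τ`. -/
theorem gradient_density_le {c₀ lam ζ T Tq d f g gp G z : ℝ} (hT : 0 < T) (hTq : 0 ≤ Tq)
    (hd : d ^ 2 ≤ Tq / T * (c₀ * lam) ^ 2) (hf : f ^ 2 ≤ Tq * T) (hg : g = 1)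
    (hgp : 0 ≤ gp) (hG : 0 ≤ G) (hz : 0 ≤ z) (hlam : 1 ≤ lam) :
    2 * (ζ ^ 2 * d ^ 2 * G) + 2 * (f ^ 2 * z) ≤
      (2 * c₀ ^ 2 + 2) * lam ^ 2 * (Tq * (ζ ^ 2 * (g + gp * T) * (G / T) + g * T * z)) := by
  have hlam2 : 1 ≤ lam ^ 2 := one_le_pow₀ hlam
  have a1 : 2 * (ζ ^ 2 * d ^ 2 * G) ≤ 2 * (ζ ^ 2 * (Tq / T * (c₀ * lam) ^ 2) * G) := by gcongr
  have a2 : 2 * (f ^ 2 * z) ≤ 2 * ((Tq * T) * z) := by gcongr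
  have e1 : 2 * (ζ ^ 2 * (Tq / T * (c₀ * lam) ^ 2) * G) =
      2 * c₀ ^ 2 * lam ^ 2 * (Tq * (ζ ^ 2 * (1 + 0) * (G / T))) := by ring
  have a3 : 2 * c₀ ^ 2 * lam ^ 2 * (Tq * (ζ ^ 2 * (1 + 0) * (G / T))) ≤
      (2 * c₀ ^ 2 + 2) * lam ^ 2 * (Tq * (ζ ^ 2 * (g + gp * T) * (G / T))) := by
    rw [hg]
    have h1 : 0 ≤ gp * T := by positivity
    have h3 : 2 * c₀ ^ 2 ≤ 2 * c₀ ^ 2 + 2 := by linarith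
    gcongr
  have a4 : 2 * ((Tq * T) * z) ≤ (2 * c₀ ^ 2 + 2) * lam ^ 2 * (Tq * (g * T * z)) := by
    rw [hg, one_mul, mul_assoc Tq]
    have h2 : 2 ≤ (2 * c₀ ^ 2 + 2) * lam ^ 2 := by nlinarith [sq_nonneg c₀]
    gcongr
  linarith

/-- The derivative of the step is of order `1/τ` while `T` is of order `t`, so `g + g'T` costs one
more factor `lam`. The factor `m` compares the component sum for `∇ζ` with its squared operator
norm. -/
theorem source_density_le {lam M T g gp Tq z z' ζ f C m : ℝ} (hm : 1 ≤ m) (hlam : 1 ≤ lam)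
    (hM : 0 < M) (hT : 0 < T) (hTq : 0 ≤ Tq) (hg0 : 0 ≤ g) (hg : g ≤ 1) (hgp : gp * T ≤ 2 * M * lam)
    (hz' : 0 ≤ z') (hz : z ≤ m * z') (hf : 0 ≤ f) (hC : 0 < C) :
    C * (Tq * (ζ ^ 2 * (g + gp * T) * T * f + g * T * z)) ≤
      C * (1 + 2 * M) * m * lam * (Tq * T * (ζ ^ 2 * f + z')) := by
  have h2 : g + gp * T ≤ (1 + 2 * M) * m * lam := by
    have h3 : (1 : ℝ) ≤ m * lam := by nlinarith
    have h4 : 2 * M * lam ≤ 2 * M * (m * lam) := by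
      have : lam ≤ m * lam := by nlinarith
      gcongr
    linarith
  have h3 : g * m ≤ (1 + 2 * M) * m * lam := by
    have e1 : g * m ≤ 1 * m := by gcongr
    have e2 : m ≤ m * lam := by nlinarith
    have e3 : 0 ≤ 2 * M * (m * lam) := by positivity
    linarith
  calc C * (Tq * (ζ ^ 2 * (g + gp * T) * T * f + g * T * z))
      ≤ C * (Tq * (ζ ^ 2 * (g + gp * T) * T * f + g * T * (m * z'))) := by gcongr
    _ = C * (Tq * T * ((g + gp * T) * (ζ ^ 2 * f) + g * m * z')) := by ring
    _ ≤ C * (Tq * T * (((1 + 2 * M) * m * lam) * (ζ ^ 2 * f) + ((1 + 2 * M) * m * lam) * z')) := by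
        gcongr
    _ = _ := by ring

/-- Two consecutive steps are used. The test function involves `g`, rising between `t` and `t + τ`;
the Sobolev function involves `s`, rising between `t + τ` and `t + 2τ`. Thus `g = 1` wherever `s` is
active. The gradient contributes `(t/τ)²` and the source `t/τ`, hence the cube. -/
theorem level_set_estimate (hn : 2 < n) {q l u X : ℝ} (hq : 0 < q)
    (hl : 0 < l) (hu : 0 < u) (hX : 0 < X)
    {ρ : ℝ → ℝ} (hρd : ContDiffOn ℝ 1 ρ (Ioi 0))
    (hρ : ∀ Q, 1 ≤ Q → l * Q ^ q ≤ ρ Q ∧ ρ Q ≤ u * Q ^ q ∧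
      l * Q ^ q ≤ ρ Q + 2 * Q * deriv ρ Q ∧ ρ Q + 2 * Q * deriv ρ Q ≤ u * Q ^ q)
    {ξ : (V →L[ℝ] E) → E} (hξ : ∀ w, 1 ≤ Qsq w → ‖ξ w‖ ≤ X * (Qsq w ^ q * √(Qsq w)))
    {U : Set V} (hU : IsOpen U) {ω : V → V →L[ℝ] E} {ν : V → V →L[ℝ] E →L[ℝ] E}
    (hω : ContDiffOn ℝ 2 ω U)
    (hδ : ∀ x ∈ U, codiff (fun y => ρ (Qsq (ω y)) • ω y) x = ξ (ω x))
    (hd : ∀ x ∈ U, ∀ u v : V, dOne ω x ![u, v] = wedgeOne (ν x) (ω x) u v) :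
    ∃ C : ℝ, 0 < C ∧ ∀ (ζ : V → ℝ) (t τ : ℝ), ContDiff ℝ 2 ζ → HasCompactSupport ζ →
      tsupport ζ ⊆ U → 1 ≤ t → 0 < τ → τ ≤ t →
      (∫⁻ x, {x | t + 2 * τ ≤ Qsq (ω x)}.indicator (fun x => ENNReal.ofReal
        (|ζ x| * Qsq (ω x) ^ ((q + 1) / 2)) ^ (2 * n / (n - 2) : ℝ)) x) ^ ((n - 2) / n : ℝ) ≤
      ENNReal.ofReal (C * (t / τ) ^ 3) * ∫⁻ x, {x | t < Qsq (ω x)}.indicator (fun x =>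
        ENNReal.ofReal (Qsq (ω x) ^ (q + 1) *
          (ζ x ^ 2 * (1 + ‖ν x‖ ^ 2) + ‖fderiv ℝ ζ x‖ ^ 2))) x := by
  obtain ⟨C₁, hC₁, hE⟩ := energy_estimate (ν := ν) hl hu hX hρd hρ hξ hU hω hδ hd
  obtain ⟨C₂, hC₂, hSob⟩ := sobolev_two hn
  obtain ⟨M, hM, hstep⟩ := exists_smooth_step
  set c₀ : ℝ := 3 * M + (q + 1) / 2 with hc₀
  have hn1 : (1 : ℝ) ≤ n := by exact_mod_cast (by omega : 1 ≤ n)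
  refine ⟨C₂ * ((2 * c₀ ^ 2 + 2) * (C₁ * (1 + 2 * M) * n)), by positivity, ?_⟩
  intro ζ t τ hζ hζc hζU ht hτ hτt
  set lam : ℝ := t / τ with hlam
  have hlam1 : 1 ≤ lam := (one_le_div hτ).2 hτt
  obtain ⟨g, hg, hg0, hg1, hgz, hgo, hg', hg'M, hg'z, hg'o⟩ := hstep t τ hτ
  obtain ⟨s, hs, hs0, hs1, hsz, hso, hs', hs'M, hs'z, hs'o⟩ := hstep (t + τ) τ hτ
  set F : ℝ → ℝ := fun T => s T * T ^ ((q + 1) / 2) with hF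
  have hFc : ContDiff ℝ 2 F := contDiff_cutoff_mul_rpow hs (by linarith) hsz
  set v : V → ℝ := fun x => ζ x * F (Qsq (ω x)) with hv
  have hQ : ContDiffOn ℝ 2 (fun y => Qsq (ω y)) U := contDiff_Qsq.comp_contDiffOn hω
  have hvζ : tsupport v ⊆ tsupport ζ := by
    refine closure_mono fun x hx h => hx ?_
    simp [hv, h]
  have hvc : ContDiff ℝ 2 v := contDiff_of_contDiffOn_tsupport hU
    (hζ.contDiffOn.mul (hFc.comp_contDiffOn hQ)) (hvζ.trans hζU)
  have hvs : HasCompactSupport v := hζc.of_isClosed_subset (isClosed_tsupport _) hvζ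
  -- the gradient of `v`
  have hgrad : ∀ x, ‖fderiv ℝ v x‖ ^ 2 ≤ (2 * c₀ ^ 2 + 2) * lam ^ 2 * (Qsq (ω x) ^ q * (ζ x ^ 2 *
        (g (Qsq (ω x)) + deriv g (Qsq (ω x)) * Qsq (ω x)) *
        ((∑ i, (fderiv ℝ (fun y => Qsq (ω y)) x (EuclideanSpace.single i 1)) ^ 2) / Qsq (ω x)) +
        g (Qsq (ω x)) * Qsq (ω x) * ∑ i, (fderiv ℝ ζ x (EuclideanSpace.single i 1)) ^ 2)) := by
    intro x
    have hQ0 := Qsq_nonneg (ω x)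
    have n1 := hg0 (Qsq (ω x))
    have n2 := hg' (Qsq (ω x))
    have hnn : 0 ≤ (2 * c₀ ^ 2 + 2) * lam ^ 2 * (Qsq (ω x) ^ q * (ζ x ^ 2 *
        (g (Qsq (ω x)) + deriv g (Qsq (ω x)) * Qsq (ω x)) *
        ((∑ i, (fderiv ℝ (fun y => Qsq (ω y)) x (EuclideanSpace.single i 1)) ^ 2) / Qsq (ω x)) +
        g (Qsq (ω x)) * Qsq (ω x) * ∑ i, (fderiv ℝ ζ x (EuclideanSpace.single i 1)) ^ 2)) := by
      positivity
    by_cases hx : x ∈ tsupport ζ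
    swap
    · have h1 : fderiv ℝ v x = 0 :=
        Function.notMem_support.1 fun h => hx (hvζ (support_fderiv_subset ℝ h))
      simpa [h1] using hnn
    have hxU := hζU hx
    have hQd : DifferentiableAt ℝ (fun y => Qsq (ω y)) x :=
      (hQ.contDiffAt (hU.mem_nhds hxU)).differentiableAt (by norm_num)
    have hle := norm_fderiv_mul_comp_sq_le (hζ.differentiable (by norm_num) x) hQd
      (hFc.differentiable (by norm_num) (Qsq (ω x)))
    rcases le_or_gt (Qsq (ω x)) (t + τ) with hT | hT
    · have f0 : ∀ T, T ≤ t + τ → F T = 0 := fun T hT => by simp [hF, hsz T hT]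
      have h1 : F (Qsq (ω x)) = 0 := f0 _ hT
      have h2 : deriv F (Qsq (ω x)) = 0 := by
        refine IsLocalMin.deriv_eq_zero ?_
        filter_upwards [Ioi_mem_nhds (show -1 < Qsq (ω x) by linarith)] with T _
        rw [h1]
        rcases le_or_gt T (t + τ) with h | h
        · rw [f0 T h]
        · have : 0 ≤ T := by linarith
          exact mul_nonneg (hs0 T) (by positivity)
      rw [h1, h2] at hle
      exact hle.trans (by simpa using hnn)
    have hTp : 0 < Qsq (ω x) := by linarith
    refine hle.trans (gradient_density_le hTp (by positivity)
      (deriv_cutoff_mul_rpow_sq_le hq hM hs (hs0 _) (hs1 _) (hs' _) (hs'M _) (hs'o _) ht hτ hτt hTp)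
      ?_ (hgo _ hT.le) n2 (Finset.sum_nonneg fun _ _ => by positivity)
      (Finset.sum_nonneg fun _ _ => by positivity) hlam1)
    calc (F (Qsq (ω x))) ^ 2 = (s (Qsq (ω x))) ^ 2 * (Qsq (ω x) ^ ((q + 1) / 2)) ^ 2 := mul_pow _ _ _
      _ ≤ 1 * (Qsq (ω x) ^ ((q + 1) / 2)) ^ 2 := by
          gcongr
          exact pow_le_one₀ (hs0 _) (hs1 _)
      _ = Qsq (ω x) ^ q * Qsq (ω x) := by
          rw [one_mul, ← Real.rpow_natCast, ← Real.rpow_mul hTp.le, ← Real.rpow_add_one hTp.ne']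
          norm_num
  -- the right-hand side
  have hright : ∀ x, C₁ * (Qsq (ω x) ^ q * (ζ x ^ 2 *
        (g (Qsq (ω x)) + deriv g (Qsq (ω x)) * Qsq (ω x)) * Qsq (ω x) * (1 + ‖ν x‖ ^ 2) +
        g (Qsq (ω x)) * Qsq (ω x) * ∑ i, (fderiv ℝ ζ x (EuclideanSpace.single i 1)) ^ 2)) ≤
      C₁ * (1 + 2 * M) * n * lam * {x | t < Qsq (ω x)}.indicator (fun x => Qsq (ω x) ^ (q + 1) *
          (ζ x ^ 2 * (1 + ‖ν x‖ ^ 2) + ‖fderiv ℝ ζ x‖ ^ 2)) x := by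
    intro x
    by_cases hx : t < Qsq (ω x)
    swap
    · have hx' : Qsq (ω x) ≤ t := not_lt.1 hx
      rw [indicator_of_notMem (by simpa using hx'), hgz _ hx', hg'z _ hx']
      simp
    rw [indicator_of_mem (show x ∈ {x | t < Qsq (ω x)} from hx)]
    have hTp : 0 < Qsq (ω x) := by linarith
    have hz : ∑ i, (fderiv ℝ ζ x (EuclideanSpace.single i 1)) ^ 2 ≤ n * ‖fderiv ℝ ζ x‖ ^ 2 := by
      have := Qsq_le_norm_sq (fderiv ℝ ζ x)
      simpa [Qsq] using this
    have h1 : deriv g (Qsq (ω x)) * Qsq (ω x) ≤ 2 * M * lam := by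
      rcases le_or_gt (t + τ) (Qsq (ω x)) with h | h
      · rw [hg'o _ h, zero_mul]; positivity
      · calc deriv g (Qsq (ω x)) * Qsq (ω x) ≤ M / τ * (2 * t) := by
              have := hg'M (Qsq (ω x))
              gcongr
              linarith
          _ = _ := by rw [hlam]; ring
    rw [Real.rpow_add_one hTp.ne']
    exact source_density_le hn1 hlam1 hM hTp (by positivity) (hg0 _) (hg1 _) h1 (by positivity) hz
      (by positivity) hC₁
  have hen := hE ζ g hζ hζc hζU hg hg0 hg' (fun T hT => hgz T (hT.trans ht))
  calc (∫⁻ x, {x | t + 2 * τ ≤ Qsq (ω x)}.indicator (fun x => ENNReal.ofReal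
        (|ζ x| * Qsq (ω x) ^ ((q + 1) / 2)) ^ (2 * n / (n - 2) : ℝ)) x) ^ ((n - 2) / n : ℝ)
      ≤ (∫⁻ x, ‖v x‖ₑ ^ (2 * n / (n - 2) : ℝ)) ^ ((n - 2) / n : ℝ) := by
        have hn2 : (0 : ℝ) ≤ n - 2 := by
          have : (2 : ℝ) < n := by exact_mod_cast hn
          linarith
        refine ENNReal.rpow_le_rpow (lintegral_mono fun x => ?_) (by positivity)
        by_cases hx : x ∈ {x | t + 2 * τ ≤ Qsq (ω x)}
        swap
        · rw [indicator_of_notMem hx]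
          exact bot_le
        rw [indicator_of_mem hx]
        have hx' : t + 2 * τ ≤ Qsq (ω x) := hx
        have h1 : s (Qsq (ω x)) = 1 := hso _ (by linarith)
        have h2 : ‖v x‖ = |ζ x| * Qsq (ω x) ^ ((q + 1) / 2) := by
          simp only [hv, hF, h1, one_mul, norm_mul, Real.norm_eq_abs]
          rw [abs_of_nonneg (Real.rpow_nonneg (Qsq_nonneg _) _)]
        rw [← h2, ofReal_norm]
    _ ≤ ENNReal.ofReal C₂ * ∫⁻ x, ‖fderiv ℝ v x‖ₑ ^ (2 : ℝ) :=
        hSob v (hvc.of_le (by norm_num)) hvs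
    _ ≤ ENNReal.ofReal C₂ * (ENNReal.ofReal ((2 * c₀ ^ 2 + 2) * lam ^ 2) *
          (ENNReal.ofReal (C₁ * (1 + 2 * M) * n * lam) *
            ∫⁻ x, {x | t < Qsq (ω x)}.indicator (fun x =>
              ENNReal.ofReal (Qsq (ω x) ^ (q + 1) *
                (ζ x ^ 2 * (1 + ‖ν x‖ ^ 2) + ‖fderiv ℝ ζ x‖ ^ 2))) x)) := by
        gcongr
        calc ∫⁻ x, ‖fderiv ℝ v x‖ₑ ^ (2 : ℝ) ≤ _ := lintegral_mono fun x => by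
              rw [← ofReal_norm, ENNReal.ofReal_rpow_of_nonneg (norm_nonneg _) zero_le_two,
                Real.rpow_two]
              exact (ENNReal.ofReal_le_ofReal (hgrad x)).trans_eq
                (ENNReal.ofReal_mul (by positivity))
          _ = _ := lintegral_const_mul' _ _ ENNReal.ofReal_ne_top
          _ ≤ _ := mul_le_mul_right (hen.trans ?_) _
        rw [← lintegral_const_mul' _ _ ENNReal.ofReal_ne_top]
        refine lintegral_mono fun x => (ENNReal.ofReal_le_ofReal (hright x)).trans_eq ?_
        rw [ENNReal.ofReal_mul (by positivity)]
        congr 1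
        by_cases hx : x ∈ {x | t < Qsq (ω x)}
        · rw [indicator_of_mem hx, indicator_of_mem hx]
        · rw [indicator_of_notMem hx, indicator_of_notMem hx, ENNReal.ofReal_zero]
    _ = _ := by
        rw [← mul_assoc, ← mul_assoc, ← ENNReal.ofReal_mul (by positivity),
          ← ENNReal.ofReal_mul (by positivity)]
        congr 2
        ring

end Sobolev

/-! ### Capacity of the singular set. -/

section Capacity

open scoped Topology ENNReal NNReal

open scoped MeasureTheory

/-- A compact set of vanishing `d`-dimensional Hausdorff measure has finite coverings by small
balls centred on it with arbitrarily small sum of `r ^ d`. -/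
theorem exists_finite_ball_cover {W : Type*} [MetricSpace W] [MeasurableSpace W] [BorelSpace W]
    {S : Set W} (hS : IsCompact S) (hne : S.Nonempty) {d : ℝ} (hd : 0 < d) (h0 : μH[d] S = 0)
    {ε δ : ℝ} (hε : 0 < ε) (hδ : 0 < δ) :
    ∃ (I : Finset ℕ) (c : ℕ → W) (r : ℕ → ℝ), (∀ i, c i ∈ S) ∧ (∀ i, 0 < r i ∧ r i < δ) ∧
      S ⊆ ⋃ i ∈ I, Metric.ball (c i) (r i) ∧ ∑ i ∈ I, r i ^ d ≤ ε := by
  rw [Measure.hausdorffMeasure_apply] at h0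
  have h1 := le_of_eq h0
  rw [iSup₂_le_iff] at h1
  have h2 := h1 (ENNReal.ofReal (δ / 2)) (by simpa using hδ)
  have hε2 : (0 : ℝ≥0∞) < ENNReal.ofReal (ε / 2) := by simpa using hε
  have h3 := lt_of_le_of_lt h2 hε2
  simp only [iInf_lt_iff] at h3
  obtain ⟨t, hSt, hdiam, hsum⟩ := h3
  obtain ⟨e, he0, hesum⟩ := ENNReal.exists_pos_sum_of_countable' hε2.ne' ℕ
  obtain ⟨x₀, hx₀⟩ := hne
  -- The centre is taken in `t i ∩ S`; pieces missing `S` receive an arbitrary point of `S` and play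
  -- no role in the covering.
  have hc : ∀ i, ∃ c ∈ S, (t i ∩ S).Nonempty → c ∈ t i := by
    intro i
    by_cases h : (t i ∩ S).Nonempty
    · obtain ⟨c, hc, hcS⟩ := h
      exact ⟨c, hcS, fun _ => hc⟩
    · exact ⟨x₀, hx₀, fun h' => absurd h' h⟩
  choose c hcS hct using hc
  -- The radius must exceed the diameter strictly, since the balls are open and the diameter may be
  -- zero; the excess in `r ^ d` is charged to the summable `e i`.
  have hr : ∀ i, ∃ r : ℝ, (0 < r ∧ r < δ) ∧ Metric.ediam (t i) < ENNReal.ofReal r ∧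
      ENNReal.ofReal (r ^ d) ≤ Metric.ediam (t i) ^ d + e i := by
    intro i
    have hfin : Metric.ediam (t i) ≠ ∞ := ne_top_of_le_ne_top ENNReal.ofReal_ne_top (hdiam i)
    set D := (Metric.ediam (t i)).toReal with hD
    have hDe : Metric.ediam (t i) = ENNReal.ofReal D := (ENNReal.ofReal_toReal hfin).symm
    have hD0 : 0 ≤ D := ENNReal.toReal_nonneg
    have hDδ : D < δ := by
      have := hdiam i
      rw [hDe, ENNReal.ofReal_le_ofReal_iff (by positivity)] at this
      linarith
    have hcont : Filter.Tendsto (fun r : ℝ => ENNReal.ofReal (r ^ d)) (𝓝[>] D)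
        (𝓝 (ENNReal.ofReal (D ^ d))) :=
      (ENNReal.tendsto_ofReal ((Real.continuousAt_rpow_const D d (Or.inr hd.le)).tendsto)).mono_left
        nhdsWithin_le_nhds
    have hlt : ENNReal.ofReal (D ^ d) < Metric.ediam (t i) ^ d + e i := by
      rw [hDe, ENNReal.ofReal_rpow_of_nonneg hD0 hd.le]
      exact ENNReal.lt_add_right ENNReal.ofReal_ne_top (he0 i).ne'
    obtain ⟨r, hr1, hr2⟩ := ((hcont.eventually_lt_const hlt).and
      (Ioo_mem_nhdsGT hDδ)).exists
    refine ⟨r, ⟨hD0.trans_lt hr2.1, hr2.2⟩, ?_, hr1.le⟩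
    rw [hDe]
    exact (ENNReal.ofReal_lt_ofReal_iff (hD0.trans_lt hr2.1)).2 hr2.1
  choose r hr hrt hrd using hr
  have hcov : S ⊆ ⋃ i, Metric.ball (c i) (r i) := by
    intro x hx
    obtain ⟨i, hi⟩ := mem_iUnion.1 (hSt hx)
    refine mem_iUnion.2 ⟨i, ?_⟩
    have h := (Metric.edist_le_ediam_of_mem hi (hct i ⟨x, hi, hx⟩)).trans_lt (hrt i)
    rw [edist_dist, ENNReal.ofReal_lt_ofReal_iff (hr i).1] at h
    exact h
  obtain ⟨I, hI⟩ := hS.elim_finite_subcover _ (fun i => Metric.isOpen_ball) hcov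
  refine ⟨I, c, r, hcS, hr, hI, ?_⟩
  have hterm : ∀ i, Metric.ediam (t i) ^ d ≤ ⨆ _ : (t i).Nonempty, Metric.ediam (t i) ^ d := by
    intro i
    rcases (t i).eq_empty_or_nonempty with h | h
    · simp [h, ENNReal.zero_rpow_of_pos hd]
    · exact le_iSup (fun _ : (t i).Nonempty => Metric.ediam (t i) ^ d) h
  have : ENNReal.ofReal (∑ i ∈ I, r i ^ d) ≤ ENNReal.ofReal ε := by
    rw [ENNReal.ofReal_sum_of_nonneg fun i _ => Real.rpow_nonneg (hr i).1.le _]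
    calc ∑ i ∈ I, ENNReal.ofReal (r i ^ d)
        ≤ ∑ i ∈ I, ((⨆ _ : (t i).Nonempty, Metric.ediam (t i) ^ d) + e i) :=
          Finset.sum_le_sum fun i _ => (hrd i).trans (by gcongr; exact hterm i)
      _ ≤ ∑' i, ((⨆ _ : (t i).Nonempty, Metric.ediam (t i) ^ d) + e i) := ENNReal.sum_le_tsum I
      _ = (∑' i, ⨆ _ : (t i).Nonempty, Metric.ediam (t i) ^ d) + ∑' i, e i := ENNReal.tsum_add
      _ ≤ ENNReal.ofReal (ε / 2) + ENNReal.ofReal (ε / 2) := add_le_add hsum.le hesum.le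
      _ = ENNReal.ofReal ε := by
          rw [← ENNReal.ofReal_add (by positivity) (by positivity), add_halves]
  exact (ENNReal.ofReal_le_ofReal_iff hε.le).1 this

variable {n : ℕ}

local notation "V" => EuclideanSpace ℝ (Fin n)

/-- Rescaled bump functions, with the scaling of the `p`-energy. -/
theorem exists_bump_family {p : ℝ} (hp : 0 < p) : ∃ L : ℝ, 0 < L ∧ ∀ (c : V) (r : ℝ), 0 < r →
    ∃ b : V → ℝ, ContDiff ℝ 2 b ∧ (∀ x, 0 ≤ b x) ∧ (∀ x ∈ Metric.ball c r, b x = 1) ∧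
      (∀ x, 2 * r ≤ dist x c → b x = 0) ∧
      ∫⁻ x, ENNReal.ofReal (‖fderiv ℝ b x‖ ^ p) ≤ ENNReal.ofReal (L * r ^ (n - p)) := by
  let β : ContDiffBump (0 : V) := ⟨1, 2, one_pos, one_lt_two⟩
  have hβ : ContDiff ℝ 2 β := β.contDiff
  have hβc : HasCompactSupport β := β.hasCompactSupport
  obtain ⟨m, hm⟩ := (hβ.continuous_fderiv (by norm_num)).bounded_above_of_compact_support
    (hβc.fderiv ℝ)
  have hm0 : 0 ≤ m := (norm_nonneg _).trans (hm 0)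
  set v : ℝ := (volume (Metric.ball (0 : V) 1)).toReal with hv
  refine ⟨m ^ p * (2 ^ n * v) + 1, by positivity, fun c r hr => ?_⟩
  have hA : ∀ x, HasFDerivAt (fun x : V => r⁻¹ • (x - c)) (r⁻¹ • ContinuousLinearMap.id ℝ V) x :=
    fun x => ((hasFDerivAt_id x).sub_const c).const_smul r⁻¹
  have hz : ∀ x, 2 * r ≤ dist x c → β (r⁻¹ • (x - c)) = 0 := by
    intro x hx
    refine β.zero_of_le_dist ?_
    rw [dist_zero_right, norm_smul, norm_inv, Real.norm_of_nonneg hr.le, ← dist_eq_norm,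
      inv_mul_eq_div]
    exact (le_div_iff₀ hr).2 hx
  have hfd : ∀ x, fderiv ℝ (fun x => β (r⁻¹ • (x - c))) x =
      r⁻¹ • fderiv ℝ β (r⁻¹ • (x - c)) := by
    intro x
    have h1 : HasFDerivAt (fun x => β (r⁻¹ • (x - c))) _ x :=
      ((hβ.differentiable (by norm_num) _).hasFDerivAt).comp x (hA x)
    rw [h1.fderiv]
    ext
    simp
  refine ⟨fun x => β (r⁻¹ • (x - c)), hβ.comp (by fun_prop), fun x => β.nonneg, fun x hx => ?_,
    hz, ?_⟩
  · refine β.one_of_mem_closedBall ?_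
    rw [mem_closedBall_zero_iff, norm_smul, norm_inv, Real.norm_of_nonneg hr.le, ← dist_eq_norm,
      inv_mul_eq_div]
    exact (div_le_one hr).2 (Metric.mem_ball.1 hx).le
  · have hpt : ∀ x, ENNReal.ofReal (‖fderiv ℝ (fun x => β (r⁻¹ • (x - c))) x‖ ^ p) ≤
        (Metric.closedBall c (2 * r)).indicator (fun _ => ENNReal.ofReal ((r⁻¹ * m) ^ p)) x := by
      intro x
      by_cases hx : x ∈ Metric.closedBall c (2 * r)
      · rw [indicator_of_mem hx, hfd, norm_smul, norm_inv, Real.norm_of_nonneg hr.le]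
        gcongr
        exact hm _
      · have : (fun x => β (r⁻¹ • (x - c))) =ᶠ[𝓝 x] fun _ => 0 := by
          filter_upwards [Metric.isClosed_closedBall.isOpen_compl.mem_nhds hx] with y hy
          exact hz y (not_le.1 (fun h => hy (Metric.mem_closedBall.2 h))).le
        rw [indicator_of_notMem hx, this.fderiv_eq]
        simp [Real.zero_rpow hp.ne']
    refine (lintegral_mono hpt).trans ?_
    rw [lintegral_indicator_const Metric.isClosed_closedBall.measurableSet,
      Measure.addHaar_closedBall _ _ (by positivity), finrank_euclideanSpace_fin,
      ← ENNReal.ofReal_toReal (measure_ball_lt_top (μ := (volume : Measure V)) (x := 0) (r := 1)).ne,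
      ← hv, ← ENNReal.ofReal_mul (by positivity), ← ENNReal.ofReal_mul (by positivity)]
    refine ENNReal.ofReal_le_ofReal ?_
    have hrp : 0 < r ^ ((n : ℝ) - p) := Real.rpow_pos_of_pos hr _
    have e1 : (r⁻¹ * m) ^ p * ((2 * r) ^ n * v) = m ^ p * (2 ^ n * v) * r ^ ((n : ℝ) - p) := by
      rw [Real.mul_rpow (by positivity) hm0, Real.inv_rpow hr.le, Real.rpow_sub hr,
        Real.rpow_natCast, mul_pow]
      ring
    rw [e1]
    nlinarith

/-- Hölder with exponents `p/(p-1)` and `p`. The left-hand vector has the form of the gradient of `∑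
bᵢ^p`, so its `p`-energy is bounded by the sum of the energies regardless of how many supports
overlap. -/
theorem norm_sum_rpow_smul_le {ι G : Type*} [NormedAddCommGroup G] [NormedSpace ℝ G]
    {p : ℝ} (hp : 1 < p) (I : Finset ι) (b : ι → ℝ) (B : ι → G) (hb : ∀ i, 0 ≤ b i)
    (hw : ∑ i ∈ I, b i ^ p ≤ 1) :
    ‖∑ i ∈ I, (p * b i ^ (p - 1)) • B i‖ ^ p ≤ p ^ p * ∑ i ∈ I, ‖B i‖ ^ p := by
  have hp0 : 0 < p := by linarith
  have hpq : (p / (p - 1)).HolderConjugate p := (Real.HolderConjugate.conjExponent hp).symm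
  have h1 : ‖∑ i ∈ I, (p * b i ^ (p - 1)) • B i‖ ≤ p * ∑ i ∈ I, b i ^ (p - 1) * ‖B i‖ := by
    refine (norm_sum_le _ _).trans_eq ?_
    rw [Finset.mul_sum]
    refine Finset.sum_congr rfl fun i _ => ?_
    rw [norm_smul, Real.norm_of_nonneg (by have := hb i; positivity), mul_assoc]
  have h2 : ∑ i ∈ I, b i ^ (p - 1) * ‖B i‖ ≤ (∑ i ∈ I, ‖B i‖ ^ p) ^ (1 / p) := by
    refine (Real.inner_le_Lp_mul_Lq_of_nonneg I hpq (fun i _ => Real.rpow_nonneg (hb i) _)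
      (fun i _ => norm_nonneg _)).trans ?_
    refine mul_le_of_le_one_left (by positivity) (Real.rpow_le_one
      (Finset.sum_nonneg fun i _ => by have := hb i; positivity) (le_of_eq_of_le ?_ hw)
      (by have : 0 < p - 1 := by linarith
          positivity))
    refine Finset.sum_congr rfl fun i _ => ?_
    rw [← Real.rpow_mul (hb i)]
    have : p - 1 ≠ 0 := by linarith
    field_simp
  have h0 : 0 ≤ ∑ i ∈ I, ‖B i‖ ^ p := Finset.sum_nonneg fun i _ => by positivity
  calc _ ≤ (p * (∑ i ∈ I, ‖B i‖ ^ p) ^ (1 / p)) ^ p := by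
        gcongr
        exact h1.trans (by gcongr)
    _ = _ := by
        rw [Real.mul_rpow hp0.le (by positivity), ← Real.rpow_mul h0, one_div,
          inv_mul_cancel₀ hp0.ne', Real.rpow_one]

/-- A compact set of codimension larger than `p` has vanishing `p`-capacity. -/
theorem exists_cutoff {S : Set V} (hS : IsCompact S) (hne : S.Nonempty) {p : ℝ} (hp : 2 ≤ p)
    (hpS : p < codimension S) {ε δ : ℝ} (hε : 0 < ε) (hδ : 0 < δ) :
    ∃ χ : V → ℝ, ContDiff ℝ 2 χ ∧ (∀ x, 0 ≤ χ x) ∧ (∀ x, χ x ≤ 1) ∧ (∀ᶠ x in 𝓝ˢ S, χ x = 0) ∧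
      (∀ x, δ ≤ Metric.infDist x S → χ x = 1) ∧
      ∫⁻ x, ENNReal.ofReal (‖fderiv ℝ χ x‖ ^ p) ≤ ENNReal.ofReal ε := by
  have hp0 : 0 < p := by linarith
  have hp1 : 1 < p := by linarith
  have hfin : dimH S ≠ ∞ := by
    -- The codimension is defined through `toReal`, so finiteness of `dimH S` is needed to recover a
    -- bound on `dimH S` itself.
    refine ne_top_of_le_ne_top (b := (n : ℝ≥0∞)) (by simp) ((dimH_mono (subset_univ S)).trans ?_)
    rw [Real.dimH_univ_eq_finrank V, finrank_euclideanSpace_fin]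
  have hd : (dimH S).toReal < n - p := by unfold codimension at hpS; linarith
  have hd0 : 0 < n - p := ENNReal.toReal_nonneg.trans_lt hd
  have hH : μH[(n - p : ℝ)] S = 0 := by
    have := hausdorffMeasure_of_dimH_lt (s := S) (d := Real.toNNReal (n - p))
      ((ENNReal.lt_ofReal_iff_toReal_lt hfin).2 hd)
    rwa [Real.coe_toNNReal _ hd0.le] at this
  obtain ⟨L, hL, hbump⟩ := exists_bump_family (n := n) hp0
  obtain ⟨M, hM, hstep⟩ := exists_smooth_step
  obtain ⟨θ, hθ, hθ0, hθ1, hθz, hθo, hθ', hθM, hθ'z, hθ'o⟩ := hstep (1 / 4) (1 / 2) (by norm_num)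
  set A : ℝ := (M / (1 / 2)) ^ p * p ^ p with hA
  have hA0 : 0 < A := by positivity
  obtain ⟨I, c, r, hcS, hr, hcov, hsum⟩ := exists_finite_ball_cover hS hne hd0 hH
    (ε := ε / (A * L)) (δ := δ / 2) (by positivity) (by positivity)
  choose b hb hb0 hb1 hbz hbint using fun i => hbump (c i) (r i) (hr i).1
  -- A smooth substitute for the maximum of the bumps: `w ≥ 1` on every ball of the covering, and `p
  -- ≥ 2` keeps it `C²`. The cutoff is `1 - θ(w)`.
  set w : V → ℝ := fun x => ∑ i ∈ I, b i x ^ p with hw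
  have hwc : ContDiff ℝ 2 w := ContDiff.sum fun i _ =>
    (hb i).rpow_const_of_le (by exact_mod_cast hp)
  have hw0 : ∀ x, 0 ≤ w x := fun x => Finset.sum_nonneg fun i _ => Real.rpow_nonneg (hb0 i x) _
  have hwd : ∀ x, fderiv ℝ w x = ∑ i ∈ I, (p * b i x ^ (p - 1)) • fderiv ℝ (b i) x := by
    intro x
    have h1 : HasFDerivAt w _ x := HasFDerivAt.fun_sum fun i _ =>
      ((hb i).differentiable (by norm_num) x).hasFDerivAt.rpow_const (Or.inr hp1.le)
    exact h1.fderiv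
  have hpt : ∀ x, ‖fderiv ℝ (fun x => 1 - θ (w x)) x‖ ^ p ≤
      A * ∑ i ∈ I, ‖fderiv ℝ (b i) x‖ ^ p := by
    intro x
    have h1 : HasFDerivAt (fun x => θ (w x)) _ x :=
      ((hθ.differentiable (by norm_num)) _).hasDerivAt.comp_hasFDerivAt x
        (hwc.differentiable (by norm_num) x).hasFDerivAt
    rw [fderiv_const_sub, norm_neg, h1.fderiv, norm_smul, Real.norm_of_nonneg (hθ' _)]
    -- Since `θ'` vanishes for `w ≥ 3/4`, the Hölder bound is needed only where `w ≤ 1`.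
    rcases le_or_gt (1 / 4 + 1 / 2) (w x) with h | h
    · rw [hθ'o _ h, zero_mul, Real.zero_rpow hp0.ne']
      positivity
    · rw [Real.mul_rpow (hθ' _) (norm_nonneg _), hwd, hA, mul_assoc]
      have := norm_sum_rpow_smul_le hp1 I (fun i => b i x) (fun i => fderiv ℝ (b i) x)
        (fun i => hb0 i x) (by change w x ≤ 1; linarith)
      exact mul_le_mul (Real.rpow_le_rpow (hθ' _) (hθM _) hp0.le) this (by positivity)
        (by positivity)
  refine ⟨fun x => 1 - θ (w x), contDiff_const.sub (hθ.comp hwc), fun x => sub_nonneg.2 (hθ1 _),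
    fun x => by linarith [hθ0 (w x)], ?_, fun x hx => ?_, ?_⟩
  · have ho : IsOpen (⋃ i ∈ I, Metric.ball (c i) (r i)) :=
      isOpen_biUnion fun i _ => Metric.isOpen_ball
    filter_upwards [ho.mem_nhdsSet.2 hcov] with x hx
    obtain ⟨i, hi, hxi⟩ := mem_iUnion₂.1 hx
    have h1 : b i x ^ p ≤ w x := Finset.single_le_sum (f := fun i => b i x ^ p)
      (fun j _ => Real.rpow_nonneg (hb0 j x) _) hi
    rw [hb1 i x hxi, Real.one_rpow] at h1
    rw [hθo _ (by linarith), sub_self]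
  · have h1 : w x = 0 := Finset.sum_eq_zero fun i _ => by
      have h2 : Metric.infDist x S ≤ dist x (c i) := Metric.infDist_le_dist_of_mem (hcS i)
      rw [hbz i x (by linarith [(hr i).2]), Real.zero_rpow hp0.ne']
    simp only [h1, hθz 0 (by norm_num), sub_zero]
  · calc ∫⁻ x, ENNReal.ofReal (‖fderiv ℝ (fun x => 1 - θ (w x)) x‖ ^ p)
        ≤ ∫⁻ x, ENNReal.ofReal A * ∑ i ∈ I, ENNReal.ofReal (‖fderiv ℝ (b i) x‖ ^ p) :=
          lintegral_mono fun x => by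
            rw [← ENNReal.ofReal_sum_of_nonneg fun i _ => by positivity,
              ← ENNReal.ofReal_mul hA0.le]
            exact ENNReal.ofReal_le_ofReal (hpt x)
      _ = ENNReal.ofReal A * ∑ i ∈ I, ∫⁻ x, ENNReal.ofReal (‖fderiv ℝ (b i) x‖ ^ p) := by
          rw [lintegral_const_mul' _ _ ENNReal.ofReal_ne_top, lintegral_finsetSum]
          intro i _
          have := (hb i).continuous_fderiv (by norm_num)
          exact (ENNReal.continuous_ofReal.comp
            (this.norm.rpow_const fun _ => Or.inr hp0.le)).measurable
      _ ≤ ENNReal.ofReal A * ∑ i ∈ I, ENNReal.ofReal (L * r i ^ (n - p)) := by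
          gcongr with i
          exact hbint i
      _ = ENNReal.ofReal (A * (L * ∑ i ∈ I, r i ^ (n - p))) := by
          rw [← ENNReal.ofReal_sum_of_nonneg fun i _ => by have := (hr i).1; positivity,
            ← ENNReal.ofReal_mul hA0.le, ← Finset.mul_sum]
      _ ≤ ENNReal.ofReal ε := by
          refine ENNReal.ofReal_le_ofReal ?_
          rw [← mul_assoc, ← le_div_iff₀' (by positivity)]
          exact hsum

end Capacity

/-! ### De Giorgi iteration. -/

section Iteration

open scoped Topology ENNReal NNReal

variable {α : Type*} [MeasurableSpace α] {μ : Measure α}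

/-- Reverse Hölder inequalities between level sets give boundedness (De Giorgi iteration). -/
theorem ae_bounded_of_level_set_estimate {Q f : α → ℝ} (hQ : AEMeasurable Q μ) (hQ0 : ∀ x, 0 ≤ Q x)
    (hfm : AEMeasurable f μ) {N q s C K₀ : ℝ} (hN : 2 < N) (hq : 0 < q) (hs : N / 2 < s)
    (hK₀ : 1 ≤ K₀) (hC : 0 < C)
    (hf : ∫⁻ x, ENNReal.ofReal (f x) ^ s ∂μ ≠ ∞)
    (hint : ∫⁻ x, ENNReal.ofReal (Q x ^ ((q + 1) / 2)) ^ (2 * N / (N - 2)) ∂μ ≠ ∞)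
    (H : ∀ t τ : ℝ, K₀ ≤ t → 0 < τ → τ ≤ t →
      (∫⁻ x, {x | t + 2 * τ ≤ Q x}.indicator
        (fun x => ENNReal.ofReal (Q x ^ ((q + 1) / 2)) ^ (2 * N / (N - 2))) x ∂μ) ^ ((N - 2) / N) ≤
      ENNReal.ofReal (C * (t / τ) ^ 3) * ∫⁻ x, {x | t < Q x}.indicator
        (fun x => ENNReal.ofReal (Q x ^ (q + 1) * f x)) x ∂μ) :
    ∃ K : ℝ, ∀ᵐ x ∂μ, Q x ≤ K := by
  have hN2 : 0 < N - 2 := by linarith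
  have hN0 : 0 < N := by linarith
  have hs1 : 1 < s := by linarith
  have hs0 : 0 < s := by linarith
  have hs1' : 0 < s - 1 := by linarith
  set G : α → ℝ≥0∞ := fun x => ENNReal.ofReal (Q x ^ ((q + 1) / 2)) ^ (2 * N / (N - 2)) with hG
  have hGm : AEMeasurable G μ := ((hQ.pow_const _).ennreal_ofReal).pow_const _
  have hset : ∀ t : ℝ, NullMeasurableSet {x | t ≤ Q x} μ := fun t =>
    nullMeasurableSet_le aemeasurable_const hQ
  set Z : ℝ → ℝ≥0∞ := fun t => ∫⁻ x, {x | t ≤ Q x}.indicator G x ∂μ with hZ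
  have hZmono : ∀ a b, a ≤ b → Z b ≤ Z a := fun a b hab =>
    lintegral_mono fun x => indicator_le_indicator_of_subset (fun y hy => le_trans hab hy)
      (fun _ => bot_le) x
  have hZfin : ∀ t, Z t ≠ ∞ := fun t =>
    ne_top_of_le_ne_top hint (lintegral_mono fun x => indicator_le_self _ _ _)
  -- Hölder contributes the power `1 - 1/s` and undoing the Sobolev power contributes `N/(N-2)`; the
  -- product exceeds `1` exactly because `s > N/2`.
  set θ : ℝ := (1 - 1 / s) * (N / (N - 2)) with hθ
  have hθ1 : 1 < θ := by
    rw [hθ, ← sub_pos, show (1 - 1 / s) * (N / (N - 2)) - 1 = (2 * s - N) / (s * (N - 2)) by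
      field_simp; ring]
    have : 0 < 2 * s - N := by linarith
    positivity
  -- Hölder's inequality for the right-hand side
  set Φ : ℝ≥0∞ := (∫⁻ x, ENNReal.ofReal (f x) ^ s ∂μ) ^ (1 / s) with hΦ
  have hΦfin : Φ ≠ ∞ := ENNReal.rpow_ne_top_of_nonneg (by positivity) hf
  have holder : ∀ t : ℝ, 1 ≤ t → ∫⁻ x, {x | t < Q x}.indicator
      (fun x => ENNReal.ofReal (Q x ^ (q + 1) * f x)) x ∂μ ≤ Φ * Z t ^ (1 - 1 / s) := by
    intro t ht
    have hconj : s.HolderConjugate (s / (s - 1)) := Real.HolderConjugate.conjExponent hs1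
    calc _ ≤ ∫⁻ x, ENNReal.ofReal (f x) *
          {x | t ≤ Q x}.indicator (fun x => ENNReal.ofReal (Q x ^ (q + 1))) x ∂μ := by
          refine lintegral_mono fun x => ?_
          by_cases hx : t < Q x
          · rw [indicator_of_mem (show x ∈ {x | t < Q x} from hx),
              indicator_of_mem (show x ∈ {x | t ≤ Q x} from hx.le),
              ENNReal.ofReal_mul (Real.rpow_nonneg (hQ0 x) _), mul_comm]
          · rw [indicator_of_notMem (show x ∉ {x | t < Q x} from hx)]
            exact bot_le
      _ ≤ Φ * (∫⁻ x, ({x | t ≤ Q x}.indicator (fun x => ENNReal.ofReal (Q x ^ (q + 1))) x) ^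
            (s / (s - 1)) ∂μ) ^ (1 / (s / (s - 1))) :=
          ENNReal.lintegral_mul_le_Lp_mul_Lq μ hconj hfm.ennreal_ofReal
            ((hQ.pow_const _).ennreal_ofReal.indicator₀ (hset t))
      _ ≤ Φ * Z t ^ (1 / (s / (s - 1))) := by
          refine mul_le_mul' le_rfl (ENNReal.rpow_le_rpow (lintegral_mono fun x => ?_)
            (by positivity))
          by_cases hx : x ∈ {x | t ≤ Q x}
          · rw [indicator_of_mem hx, indicator_of_mem hx]
            have hx1 : 1 ≤ Q x := ht.trans hx
            have hx0 : 0 ≤ Q x := hQ0 x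
            simp only [hG]
            rw [ENNReal.ofReal_rpow_of_nonneg (by positivity) (by positivity),
              ENNReal.ofReal_rpow_of_nonneg (by positivity) (by positivity),
              ← Real.rpow_mul hx0, ← Real.rpow_mul hx0]
            -- On the level set `Q ≥ 1`, so the exponent may be raised from `(q+1)s/(s-1)` to
            -- `(q+1)N/(N-2)`.
            refine ENNReal.ofReal_le_ofReal (Real.rpow_le_rpow_of_exponent_le hx1 ?_)
            rw [show (q + 1) / 2 * (2 * N / (N - 2)) = (q + 1) * (N / (N - 2)) by ring]
            gcongr ?_ * ?_
            rw [div_le_div_iff₀ hs1' hN2]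
            linarith
          · rw [indicator_of_notMem hx, indicator_of_notMem hx,
              ENNReal.zero_rpow_of_pos (by positivity)]
      _ = _ := by
          congr 2
          field_simp
  -- the recursive inequality
  set D : ℝ := C * 512 * Φ.toReal + 1 with hD
  have hD0 : 0 < D := by positivity
  have hrec : ∀ K : ℝ, K₀ ≤ K → ∀ j : ℕ,
      (Z (K * (2 - (1 / 2) ^ (j + 1)))).toReal ≤ D ^ (N / (N - 2)) * ((8 : ℝ) ^ (N / (N - 2))) ^ j *
        (Z (K * (2 - (1 / 2) ^ j))).toReal ^ θ := by
    intro K hK j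
    have hK1 : 1 ≤ K := hK₀.trans hK
    have hj0 : (0 : ℝ) < (1 / 2) ^ j := by positivity
    have hj1 : ((1 : ℝ) / 2) ^ j ≤ 1 := pow_le_one₀ (by norm_num) (by norm_num)
    set t : ℝ := K * (2 - (1 / 2) ^ j) with ht
    -- Chosen so that `t + 2τ` is the next level. Then `t/τ ≤ 8 · 2^j`, whose cube gives the
    -- constant `512` and the ratio `8` of the recursion.
    set τ : ℝ := K * (1 / 2) ^ j / 4 with hτ
    have hτ0 : 0 < τ := by positivity
    have htK : K ≤ t := by rw [ht]; nlinarith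
    have hτt : τ ≤ t := by rw [hτ]; nlinarith
    have hstep : K * (2 - (1 / 2) ^ (j + 1)) = t + 2 * τ := by rw [ht, hτ, pow_succ]; ring
    have hlam : t / τ ≤ 8 * 2 ^ j := by
      rw [div_le_iff₀ hτ0, hτ]
      have : (2 : ℝ) ^ j * (1 / 2) ^ j = 1 := by rw [← mul_pow]; norm_num
      have e : 8 * 2 ^ j * (K * (1 / 2) ^ j / 4) = 2 * K * ((2 : ℝ) ^ j * (1 / 2) ^ j) := by ring
      rw [e, this, ht]
      nlinarith
    have h1 : Z (t + 2 * τ) ^ ((N - 2) / N) ≤ ENNReal.ofReal (D * 8 ^ j) * Z t ^ (1 - 1 / s) := by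
      refine (H t τ (hK.trans htK) hτ0 hτt).trans ?_
      calc _ ≤ ENNReal.ofReal (C * (8 * 2 ^ j) ^ 3) * (Φ * Z t ^ (1 - 1 / s)) := by
            have h0 : 0 ≤ t / τ := div_nonneg (by linarith) hτ0.le
            have := holder t (hK1.trans htK)
            gcongr
        _ = ENNReal.ofReal (C * (8 * 2 ^ j) ^ 3 * Φ.toReal) * Z t ^ (1 - 1 / s) := by
            rw [ENNReal.ofReal_mul (p := C * (8 * 2 ^ j) ^ 3) (by positivity), ENNReal.ofReal_toReal hΦfin, mul_assoc]
        _ ≤ _ := by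
            refine mul_le_mul' (ENNReal.ofReal_le_ofReal ?_) le_rfl
            have e8 : ((2 : ℝ) ^ j) ^ 3 = 8 ^ j := by
              rw [← pow_mul, mul_comm, pow_mul]; norm_num
            have h8 : (0 : ℝ) < 8 ^ j := by positivity
            calc C * (8 * 2 ^ j) ^ 3 * Φ.toReal = C * 512 * Φ.toReal * 8 ^ j := by
                  rw [mul_pow, e8]; ring
              _ ≤ D * 8 ^ j := by
                  gcongr
                  rw [hD]; linarith
    rw [hstep]
    set a := (Z (t + 2 * τ)).toReal with ha
    set b := (Z t).toReal with hb
    have ha0 : 0 ≤ a := ENNReal.toReal_nonneg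
    have hb0 : 0 ≤ b := ENNReal.toReal_nonneg
    have hss : 0 ≤ 1 - 1 / s := by
      rw [sub_nonneg, div_le_one hs0]; exact hs1.le
    rw [← ENNReal.ofReal_toReal (hZfin (t + 2 * τ)), ← ENNReal.ofReal_toReal (hZfin t), ← ha, ← hb,
      ENNReal.ofReal_rpow_of_nonneg ha0 (by positivity), ENNReal.ofReal_rpow_of_nonneg hb0 hss,
      ← ENNReal.ofReal_mul (by positivity), ENNReal.ofReal_le_ofReal_iff (by positivity)] at h1
    have h2 := Real.rpow_le_rpow (by positivity) h1 (by positivity : 0 ≤ N / (N - 2))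
    rw [← Real.rpow_mul ha0, show (N - 2) / N * (N / (N - 2)) = 1 by field_simp, Real.rpow_one,
      Real.mul_rpow (by positivity) (by positivity), Real.mul_rpow hD0.le (by positivity),
      ← Real.rpow_mul hb0, ← hθ] at h2
    refine h2.trans_eq ?_
    congr 2
    rw [← Real.rpow_natCast, ← Real.rpow_natCast, ← Real.rpow_mul (by norm_num),
      ← Real.rpow_mul (by norm_num), mul_comm]
  obtain ⟨δ, hδ, hconv⟩ := exists_pos_tendsto_zero_of_le_rpow (A := D ^ (N / (N - 2)))
    (B := (8 : ℝ) ^ (N / (N - 2))) (by positivity)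
    (Real.one_lt_rpow (by norm_num) (by positivity)) hθ1
  -- a level with small tail
  have htail : Filter.Tendsto (fun m : ℕ => Z m) Filter.atTop (𝓝 0) := by
    have := tendsto_lintegral_of_dominated_convergence' (μ := μ)
      (F := fun (m : ℕ) x => {x | (m : ℝ) ≤ Q x}.indicator G x) (f := fun _ => 0) G
      (fun m => hGm.indicator₀ (hset m))
      (fun m => Filter.Eventually.of_forall fun x => indicator_le_self _ _ _) hint
      (Filter.Eventually.of_forall fun x => by
        obtain ⟨m₀, hm₀⟩ := exists_nat_gt (Q x)
        refine tendsto_const_nhds.congr' ?_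
        filter_upwards [Filter.eventually_ge_atTop m₀] with m hm
        rw [indicator_of_notMem]
        simp only [mem_ofPred_eq, not_le]
        exact hm₀.trans_le (by exact_mod_cast hm))
    simpa using this
  -- Smallness comes from the height of the first level, not from the size of the domain; the levels
  -- then increase from `m` to `2m`.
  obtain ⟨m, hm1, hm2⟩ := ((htail.eventually_lt_const (show (0 : ℝ≥0∞) < ENNReal.ofReal δ by
    simpa using hδ)).and (Filter.eventually_ge_atTop ⌈K₀⌉₊)).exists
  have hmK : K₀ ≤ m := (Nat.le_ceil K₀).trans (by exact_mod_cast hm2)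
  have hlim := hconv (fun j => (Z (m * (2 - (1 / 2) ^ j))).toReal) (fun j => ENNReal.toReal_nonneg)
    (by
      simp only [pow_zero]
      norm_num
      exact ENNReal.toReal_le_of_le_ofReal hδ.le hm1.le) (hrec m hmK)
  have hle : ∀ j : ℕ, (Z (2 * m)).toReal ≤ (Z (m * (2 - (1 / 2) ^ j))).toReal := fun j =>
    ENNReal.toReal_mono (hZfin _) (hZmono _ _ (by
      have : (0 : ℝ) < (1 / 2) ^ j := by positivity
      nlinarith [hK₀.trans hmK]))
  have hz0 : (Z (2 * m)).toReal = 0 :=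
    le_antisymm (ge_of_tendsto' hlim hle) ENNReal.toReal_nonneg
  have hz1 : Z (2 * m) = 0 := by
    rcases (ENNReal.toReal_eq_zero_iff _).1 hz0 with h | h
    · exact h
    · exact absurd h (hZfin _)
  rw [hZ, lintegral_eq_zero_iff' (hGm.indicator₀ (hset _))] at hz1
  refine ⟨2 * m, ?_⟩
  filter_upwards [hz1] with x hx
  by_contra hcon
  have hlt : 2 * (m : ℝ) < Q x := not_le.1 hcon
  have hpos : 0 < Q x := by linarith [hK₀.trans hmK]
  rw [indicator_of_mem (show x ∈ {x | 2 * (m : ℝ) ≤ Q x} from hlt.le)] at hx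
  simp only [hG, Pi.zero_apply] at hx
  have h1 : (0 : ℝ≥0∞) < ENNReal.ofReal (Q x ^ ((q + 1) / 2)) := by
    rw [ENNReal.ofReal_pos]; positivity
  exact (ENNReal.rpow_pos h1 ENNReal.ofReal_ne_top).ne' hx

end Iteration

/-! ### Passing across the singular set. -/

section Removability

open scoped Topology ENNReal NNReal

variable {n : ℕ} {E : Type*} [NormedAddCommGroup E] [InnerProductSpace ℝ E]

local notation "V" => EuclideanSpace ℝ (Fin n)

theorem continuousOn_Qsq_comp {ω : V → V →L[ℝ] E} {U : Set V} (hω : ContinuousOn ω U) :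
    ContinuousOn (fun x => Qsq (ω x)) U :=
  (contDiff_Qsq (m := 0)).continuous.comp_continuousOn hω

/-- Comparison of the right-hand side for the cutoff `ψ χ` with integrals over `O \ S`. -/
theorem source_le_indicator {S O : Set V} {ψ χ : V → ℝ}
    (hχ0 : ∀ x, 0 ≤ χ x) (hχ1 : ∀ x, χ x ≤ 1) (hχS : ∀ᶠ x in 𝓝ˢ S, χ x = 0) (hO : IsOpen O)
    (hψO : ∀ x ∈ O, ψ x = 1) {Q N : V → ℝ} {q t : ℝ} (hQ0 : ∀ x, 0 ≤ Q x) (hN : ∀ x, 0 ≤ N x)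
    (hQt : ∀ x ∈ tsupport ψ \ O, Q x ≤ t) (x : V) :
    {x | t < Q x}.indicator (fun x => ENNReal.ofReal (Q x ^ (q + 1) *
      ((ψ x * χ x) ^ 2 * N x + ‖fderiv ℝ (fun x => ψ x * χ x) x‖ ^ 2))) x ≤
    (O \ S).indicator (fun x => {x | t < Q x}.indicator
      (fun x => ENNReal.ofReal (Q x ^ (q + 1) * N x)) x +
        ENNReal.ofReal (‖fderiv ℝ χ x‖ ^ 2) * ENNReal.ofReal (Q x ^ (q + 1))) x := by
  have hQp : 0 ≤ Q x ^ (q + 1) := Real.rpow_nonneg (hQ0 x) _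
  by_cases ht : t < Q x
  swap
  · rw [indicator_of_notMem (show x ∉ {x | t < Q x} from ht)]
    exact bot_le
  rw [indicator_of_mem (show x ∈ {x | t < Q x} from ht)]
  have hzero : (fun x => ψ x * χ x) =ᶠ[𝓝 x] (fun _ => 0) →
      ENNReal.ofReal (Q x ^ (q + 1) * ((ψ x * χ x) ^ 2 * N x +
        ‖fderiv ℝ (fun x => ψ x * χ x) x‖ ^ 2)) = 0 := fun h => by
    rw [h.fderiv_eq, h.eq_of_nhds]
    simp
  by_cases hxO : x ∈ O
  · by_cases hxS : x ∈ S
    · rw [hzero ((eventually_nhdsSet_iff_forall.1 hχS x hxS).mono fun y hy => by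
        simp only [hy, mul_zero])]
      exact bot_le
    · have hev : (fun x => ψ x * χ x) =ᶠ[𝓝 x] χ := by
        filter_upwards [hO.mem_nhds hxO] with y hy
        rw [hψO y hy, one_mul]
      rw [indicator_of_mem (show x ∈ O \ S from ⟨hxO, hxS⟩),
        indicator_of_mem (show x ∈ {x | t < Q x} from ht), hev.fderiv_eq,
        ← ENNReal.ofReal_mul (by positivity), ← ENNReal.ofReal_add
          (mul_nonneg hQp (hN x)) (by positivity), hψO x hxO, one_mul]
      refine ENNReal.ofReal_le_ofReal ?_
      have h1 : χ x ^ 2 * N x ≤ N x :=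
        mul_le_of_le_one_left (hN x) (pow_le_one₀ (hχ0 x) (hχ1 x))
      rw [mul_add, mul_comm (‖fderiv ℝ χ x‖ ^ 2)]
      gcongr
  -- Outside `O` the gradient of `ψ` may be nonzero, but `Q ≤ t` there, so such points are not in
  -- the level set.
  · by_cases hxψ : x ∈ tsupport ψ
    · exact absurd (hQt x ⟨hxψ, hxO⟩) (not_le.2 ht)
    · rw [hzero ((notMem_tsupport_iff_eventuallyEq.1 hxψ).mono fun y hy => by
        simp only [hy, Pi.zero_apply, zero_mul])]
      exact bot_le

/-- The level set estimate holds across a compact set of zero `p`-capacity. -/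
theorem level_set_estimate_across (hn : 2 < n) {Ω S O : Set V} (hS : IsCompact S)
    (hne : S.Nonempty) {p : ℝ} (hp : 2 < p) (hpS : p < codimension S)
    {ω : V → V →L[ℝ] E} {ν : V → V →L[ℝ] E →L[ℝ] E} (hω : ContinuousOn ω (Ω \ S))
    {q C K₀ : ℝ}
    (HE : ∀ (ζ : V → ℝ) (t τ : ℝ), ContDiff ℝ 2 ζ → HasCompactSupport ζ →
      tsupport ζ ⊆ Ω \ S → 1 ≤ t → 0 < τ → τ ≤ t →
      (∫⁻ x, {x | t + 2 * τ ≤ Qsq (ω x)}.indicator (fun x => ENNReal.ofReal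
        (|ζ x| * Qsq (ω x) ^ ((q + 1) / 2)) ^ (2 * n / (n - 2) : ℝ)) x) ^ ((n - 2) / n : ℝ) ≤
      ENNReal.ofReal (C * (t / τ) ^ 3) * ∫⁻ x, {x | t < Qsq (ω x)}.indicator (fun x =>
        ENNReal.ofReal (Qsq (ω x) ^ (q + 1) *
          (ζ x ^ 2 * (1 + ‖ν x‖ ^ 2) + ‖fderiv ℝ ζ x‖ ^ 2))) x)
    {ψ : V → ℝ} (hψ : ContDiff ℝ 2 ψ) (hψc : HasCompactSupport ψ) (hψΩ : tsupport ψ ⊆ Ω)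
    (hO : IsOpen O) (hOΩ : O ⊆ Ω) (hψO : ∀ x ∈ O, ψ x = 1) (hK₀ : 1 ≤ K₀)
    (hQK : ∀ x ∈ tsupport ψ \ O, Qsq (ω x) ≤ K₀)
    (hint : ∫⁻ x in O \ S, ENNReal.ofReal (Qsq (ω x) ^ (q + 1)) ^ (p / (p - 2)) ≠ ∞)
    (t τ : ℝ) (ht : K₀ ≤ t) (hτ : 0 < τ) (hτt : τ ≤ t) :
    (∫⁻ x in O \ S, {x | t + 2 * τ ≤ Qsq (ω x)}.indicator (fun x => ENNReal.ofReal
        (Qsq (ω x) ^ ((q + 1) / 2)) ^ (2 * n / (n - 2) : ℝ)) x) ^ ((n - 2) / n : ℝ) ≤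
      ENNReal.ofReal (C * (t / τ) ^ 3) * ∫⁻ x in O \ S, {x | t < Qsq (ω x)}.indicator (fun x =>
        ENNReal.ofReal (Qsq (ω x) ^ (q + 1) * (1 + ‖ν x‖ ^ 2))) x := by
  have hn2 : (0 : ℝ) < n - 2 := by
    have : (2 : ℝ) < n := by exact_mod_cast hn
    linarith
  have hn0 : (0 : ℝ) < n := by linarith
  have hp2 : 0 < p - 2 := by linarith
  have hp0 : 0 < p := by linarith
  have hT : MeasurableSet (O \ S) := hO.measurableSet.diff hS.measurableSet
  have hQc : ContinuousOn (fun x => Qsq (ω x)) (O \ S) :=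
    continuousOn_Qsq_comp (hω.mono (sdiff_subset_sdiff_left hOΩ))
  have hQm : AEMeasurable (fun x => Qsq (ω x)) (volume.restrict (O \ S)) := hQc.aemeasurable hT
  have hex : ∀ m : ℕ, ∃ χ : V → ℝ, ContDiff ℝ 2 χ ∧ (∀ x, 0 ≤ χ x) ∧ (∀ x, χ x ≤ 1) ∧
      (∀ᶠ x in 𝓝ˢ S, χ x = 0) ∧ (∀ x, 1 / ((m : ℝ) + 1) ≤ Metric.infDist x S → χ x = 1) ∧
      ∫⁻ x, ENNReal.ofReal (‖fderiv ℝ χ x‖ ^ p) ≤ ENNReal.ofReal (1 / ((m : ℝ) + 1)) := fun m =>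
    exists_cutoff hS hne hp.le hpS (by positivity) (by positivity)
  choose χ hχ hχ0 hχ1 hχS hχδ hχp using hex
  set Φ : ℝ≥0∞ := (∫⁻ x in O \ S, ENNReal.ofReal (Qsq (ω x) ^ (q + 1)) ^ (p / (p - 2))) ^
    (1 / (p / (p - 2))) with hΦ
  have hΦfin : Φ ≠ ∞ := ENNReal.rpow_ne_top_of_nonneg (by positivity) hint
  set a : ℝ≥0∞ := ∫⁻ x in O \ S, {x | t < Qsq (ω x)}.indicator (fun x =>
        ENNReal.ofReal (Qsq (ω x) ^ (q + 1) * (1 + ‖ν x‖ ^ 2))) x with ha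
  set F : ℕ → V → ℝ≥0∞ := fun m x => {x | t + 2 * τ ≤ Qsq (ω x)}.indicator (fun x =>
    ENNReal.ofReal (|ψ x * χ m x| * Qsq (ω x) ^ ((q + 1) / 2)) ^ (2 * n / (n - 2) : ℝ)) x with hF
  -- the error made by the cutoff near `S`
  have herr : ∀ m : ℕ, ∫⁻ x in O \ S, ENNReal.ofReal (‖fderiv ℝ (χ m) x‖ ^ 2) *
      ENNReal.ofReal (Qsq (ω x) ^ (q + 1)) ≤ ENNReal.ofReal (1 / ((m : ℝ) + 1)) ^ (2 / p) * Φ := by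
    intro m
    have hconj : (p / 2).HolderConjugate (p / (p - 2)) := by
      rw [Real.holderConjugate_iff]
      refine ⟨by linarith, ?_⟩
      field_simp
      ring
    have hgc : Continuous (fderiv ℝ (χ m)) := (hχ m).continuous_fderiv (by norm_num)
    refine (ENNReal.lintegral_mul_le_Lp_mul_Lq _ hconj
      (by fun_prop) ((hQm.pow_const _).ennreal_ofReal)).trans ?_
    refine mul_le_mul' ?_ le_rfl
    rw [show 1 / (p / 2) = 2 / p by field_simp]
    refine ENNReal.rpow_le_rpow ?_ (by positivity)
    refine (setLIntegral_le_lintegral _ _).trans (le_trans (lintegral_mono fun x => ?_) (hχp m))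
    rw [ENNReal.ofReal_rpow_of_nonneg (by positivity) (by positivity), ← Real.rpow_natCast,
      ← Real.rpow_mul (norm_nonneg _)]
    refine ENNReal.ofReal_le_ofReal (le_of_eq ?_)
    congr 1
    push_cast
    ring
  -- The outer power is moved to the right-hand side so that Fatou's lemma applies to the bare
  -- integral.
  have hm : ∀ m, ∫⁻ x in O \ S, F m x ≤ (ENNReal.ofReal (C * (t / τ) ^ 3) *
      (a + ENNReal.ofReal (1 / ((m : ℝ) + 1)) ^ (2 / p) * Φ)) ^ (n / (n - 2) : ℝ) := by
    intro m
    have hts : tsupport (fun x => ψ x * χ m x) ⊆ tsupport ψ :=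
      closure_mono fun x hx h => hx (by simp [h])
    have hsub : tsupport (fun x => ψ x * χ m x) ⊆ Ω \ S := by
      intro x hx
      refine ⟨hψΩ (hts hx), fun hxS => ?_⟩
      refine notMem_tsupport_iff_eventuallyEq.2 ?_ hx
      filter_upwards [eventually_nhdsSet_iff_forall.1 (hχS m) x hxS] with y hy
      simp [hy]
    have h1 := HE (fun x => ψ x * χ m x) t τ (hψ.mul (hχ m))
      (hψc.of_isClosed_subset (isClosed_tsupport _) hts) hsub (hK₀.trans ht) hτ hτt
    have h2 : ∫⁻ x, {x | t < Qsq (ω x)}.indicator (fun x => ENNReal.ofReal (Qsq (ω x) ^ (q + 1) *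
          ((ψ x * χ m x) ^ 2 * (1 + ‖ν x‖ ^ 2) + ‖fderiv ℝ (fun x => ψ x * χ m x) x‖ ^ 2))) x ≤
        a + ENNReal.ofReal (1 / ((m : ℝ) + 1)) ^ (2 / p) * Φ := by
      refine (lintegral_mono fun x => source_le_indicator (S := S) (q := q) (hχ0 m) (hχ1 m)
        (hχS m) hO hψO (fun x => Qsq_nonneg (ω x)) (fun x => by positivity)
        (fun x hx => (hQK x hx).trans ht) x).trans ?_
      rw [lintegral_indicator hT, lintegral_add_right']
      · exact add_le_add le_rfl (herr m)
      · have hgc : Continuous (fderiv ℝ (χ m)) := (hχ m).continuous_fderiv (by norm_num)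
        exact AEMeasurable.mul (by fun_prop) ((hQm.pow_const _).ennreal_ofReal)
    have h3 : (∫⁻ x in O \ S, F m x) ^ ((n - 2) / n : ℝ) ≤ ENNReal.ofReal (C * (t / τ) ^ 3) *
        (a + ENNReal.ofReal (1 / ((m : ℝ) + 1)) ^ (2 / p) * Φ) :=
      (ENNReal.rpow_le_rpow (setLIntegral_le_lintegral _ _) (by positivity)).trans
        (h1.trans (mul_le_mul' le_rfl h2))
    have h4 := ENNReal.rpow_le_rpow h3 (by positivity : (0 : ℝ) ≤ n / (n - 2))
    rwa [← ENNReal.rpow_mul, show ((n - 2) / n * (n / (n - 2)) : ℝ) = 1 by field_simp,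
      ENNReal.rpow_one] at h4
  -- passage to the limit
  have hlim : Filter.Tendsto (fun m : ℕ => (ENNReal.ofReal (C * (t / τ) ^ 3) *
      (a + ENNReal.ofReal (1 / ((m : ℝ) + 1)) ^ (2 / p) * Φ)) ^ (n / (n - 2) : ℝ)) Filter.atTop
      (𝓝 ((ENNReal.ofReal (C * (t / τ) ^ 3) * a) ^ (n / (n - 2) : ℝ))) := by
    have e1 : Filter.Tendsto (fun m : ℕ => ENNReal.ofReal (1 / ((m : ℝ) + 1))) Filter.atTop
        (𝓝 0) := by
      simpa using ENNReal.tendsto_ofReal tendsto_one_div_add_atTop_nhds_zero_nat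
    have e2 : Filter.Tendsto (fun m : ℕ => ENNReal.ofReal (1 / ((m : ℝ) + 1)) ^ (2 / p))
        Filter.atTop (𝓝 0) := by
      have := (ENNReal.continuous_rpow_const (y := 2 / p)).tendsto 0 |>.comp e1
      rwa [ENNReal.zero_rpow_of_pos (by positivity)] at this
    have e3 := ENNReal.Tendsto.mul_const (b := Φ) e2 (Or.inr hΦfin)
    rw [zero_mul] at e3
    have e4 := ENNReal.Tendsto.const_mul (a := ENNReal.ofReal (C * (t / τ) ^ 3))
      (e3.const_add a) (Or.inr ENNReal.ofReal_ne_top)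
    rw [add_zero] at e4
    exact (ENNReal.continuous_rpow_const.tendsto _).comp e4
  have hFm : ∀ m, AEMeasurable (F m) (volume.restrict (O \ S)) := fun m =>
    AEMeasurable.indicator₀ ((((hψ.continuous.mul (hχ m).continuous).abs.aemeasurable.mul
      (hQm.pow_const _)).ennreal_ofReal).pow_const _) (nullMeasurableSet_le aemeasurable_const hQm)
  have hfatou : ∫⁻ x in O \ S, {x | t + 2 * τ ≤ Qsq (ω x)}.indicator (fun x => ENNReal.ofReal
        (Qsq (ω x) ^ ((q + 1) / 2)) ^ (2 * n / (n - 2) : ℝ)) x ≤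
      (ENNReal.ofReal (C * (t / τ) ^ 3) * a) ^ (n / (n - 2) : ℝ) := by
    calc _ ≤ ∫⁻ x in O \ S, Filter.liminf (fun m => F m x) Filter.atTop := by
          refine setLIntegral_mono' hT fun x hx => ?_
          refine le_of_eq (Filter.Tendsto.liminf_eq ?_).symm
          refine tendsto_const_nhds.congr' ?_
          -- At a fixed point off `S` the cutoffs are eventually equal to `1`, so the integrands are
          -- eventually constant.
          have hpos : 0 < Metric.infDist x S :=
            (hS.isClosed.notMem_iff_infDist_pos hne).1 hx.2
          filter_upwards [tendsto_one_div_add_atTop_nhds_zero_nat.eventually_lt_const hpos] with m hm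
          have h1 : χ m x = 1 := hχδ m x hm.le
          by_cases hxt : x ∈ {x | t + 2 * τ ≤ Qsq (ω x)}
          · simp only [hF]
            rw [indicator_of_mem hxt, indicator_of_mem hxt, h1, hψO x hx.1]
            simp
          · simp only [hF]
            rw [indicator_of_notMem hxt, indicator_of_notMem hxt]
      _ ≤ Filter.liminf (fun m => ∫⁻ x in O \ S, F m x) Filter.atTop := lintegral_liminf_le' hFm
      _ ≤ Filter.liminf (fun m : ℕ => (ENNReal.ofReal (C * (t / τ) ^ 3) *
            (a + ENNReal.ofReal (1 / ((m : ℝ) + 1)) ^ (2 / p) * Φ)) ^ (n / (n - 2) : ℝ))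
            Filter.atTop := Filter.liminf_le_liminf (Filter.Eventually.of_forall hm)
      _ = _ := hlim.liminf_eq
  have h4 := ENNReal.rpow_le_rpow hfatou (by positivity : (0 : ℝ) ≤ (n - 2) / n)
  rwa [← ENNReal.rpow_mul, show (n / (n - 2) * ((n - 2) / n) : ℝ) = 1 by field_simp,
    ENNReal.rpow_one] at h4

/-- From `Q ≤ n‖ω‖²`, together with the inclusion of Lebesgue spaces on a set of finite measure. -/
theorem lintegral_Qsq_rpow_ne_top {A : Set V} (hA : volume A ≠ ∞) {ω : V → V →L[ℝ] E} {a b : ℝ}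
    (hb : 0 < b) (hba : b ≤ a) (h : MemLp ω (ENNReal.ofReal (2 * a)) (volume.restrict A)) :
    ∫⁻ x in A, ENNReal.ofReal (Qsq (ω x) ^ b) ≠ ∞ := by
  have : IsFiniteMeasure (volume.restrict A) := isFiniteMeasure_restrict.2 hA
  have h1 : MemLp ω (ENNReal.ofReal (2 * b)) (volume.restrict A) :=
    h.mono_exponent (ENNReal.ofReal_le_ofReal (by linarith))
  have h2 := lintegral_rpow_enorm_lt_top_of_eLpNorm_lt_top
    (by simpa using hb) ENNReal.ofReal_ne_top h1.2
  rw [ENNReal.toReal_ofReal (by positivity)] at h2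
  refine ne_top_of_le_ne_top (b := ENNReal.ofReal ((n : ℝ) ^ b) * ∫⁻ x in A, ‖ω x‖ₑ ^ (2 * b))
    (ENNReal.mul_ne_top ENNReal.ofReal_ne_top h2.ne) ?_
  rw [← lintegral_const_mul' _ _ ENNReal.ofReal_ne_top]
  refine lintegral_mono fun x => ?_
  rw [← ofReal_norm, ENNReal.ofReal_rpow_of_nonneg (norm_nonneg _) (by positivity),
    ← ENNReal.ofReal_mul (by positivity)]
  refine ENNReal.ofReal_le_ofReal ?_
  rw [Real.rpow_mul (norm_nonneg _), Real.rpow_two, ← Real.mul_rpow (by positivity) (by positivity)]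
  exact Real.rpow_le_rpow (Qsq_nonneg _) (Qsq_le_norm_sq _) hb.le

end Removability

/-! ### Exponents and conclusion. -/

section Main

open scoped Topology ENNReal NNReal

variable {n : ℕ} {E : Type*} [NormedAddCommGroup E] [InnerProductSpace ℝ E]

local notation "V" => EuclideanSpace ℝ (Fin n)

theorem codimension_le (S : Set V) : codimension S ≤ n := by
  unfold codimension
  linarith [ENNReal.toReal_nonneg (a := dimH S)]

/-- The integrability hypotheses in all dimensions provide an exponent `p` below the codimension
for which `|ω| ^ (q + 1)` lies in `L ^ (2 p / (p - 2))`. -/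
theorem exists_removability_exponent {A S : Set V} (hA : volume A ≠ ∞) {ω : V → V →L[ℝ] E} {q : ℝ}
    (hq : 0 < q)
    (hlarge : 4 < n →
      2 * (n : ℝ) / ((n : ℝ) - 2) < codimension S ∧
      MemLp ω (ENNReal.ofReal (n * (q + 1))) (volume.restrict A))
    (hsmall : n ≤ 4 →
      2 < codimension S ∧
      ∃ ε γ₁ γ₂ β : ℝ, 0 < ε ∧ ε < codimension S - 2 ∧
        β = (codimension S - ε) / (codimension S - 2 - ε) ∧
        1 / 2 < γ₁ ∧ γ₁ < γ₂ ∧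
        MemLp ω (ENNReal.ofReal (4 * (q + 1) * β * γ₁)) (volume.restrict A) ∧
        MemLp ω (ENNReal.ofReal (4 * (q + 1) * γ₂)) (volume.restrict A)) :
    ∃ p : ℝ, 2 < p ∧ p < codimension S ∧
      MemLp ω (ENNReal.ofReal (2 * ((q + 1) * (p / (p - 2))))) (volume.restrict A) := by
  have : IsFiniteMeasure (volume.restrict A) := isFiniteMeasure_restrict.2 hA
  rcases lt_or_ge 4 n with h | h
  · obtain ⟨h1, h2⟩ := hlarge h
    have hn : (4 : ℝ) < n := by exact_mod_cast h
    have hn2 : (0 : ℝ) < n - 2 := by linarith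
    -- With this `p` one has `p/(p-2) = n/2`, and the required exponent is exactly `n(q+1)`.
    refine ⟨2 * n / (n - 2), ?_, h1, ?_⟩
    · rw [lt_div_iff₀ hn2]; linarith
    · convert h2 using 2
      rw [show 2 * (n : ℝ) / (n - 2) - 2 = 4 / (n - 2) by field_simp; ring]
      field_simp
      ring
  · obtain ⟨h1, ε, γ₁, γ₂, β, hε, hε2, hβ, hγ₁, hγ, h2, h3⟩ := hsmall h
    -- With this `p` one has `p/(p-2) = β`, and `2(q+1)β ≤ 4(q+1)βγ₁` because `γ₁ > 1/2`.
    refine ⟨codimension S - ε, by linarith, by linarith, h2.mono_exponent ?_⟩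
    rw [show codimension S - ε - 2 = codimension S - 2 - ε by ring, ← hβ]
    refine ENNReal.ofReal_le_ofReal ?_
    have hβ0 : 0 < β := by
      rw [hβ]
      exact div_pos (by linarith) (by linarith)
    have h4 : 0 < (q + 1) * β := by positivity
    nlinarith

theorem lintegral_one_add_norm_sq_rpow_ne_top {A T : Set V} (hA : volume A ≠ ∞) (hTA : T ⊆ A)
    (hT : MeasurableSet T) {ν : V → V →L[ℝ] E →L[ℝ] E} (hν : ContinuousOn (fun x => ‖ν x‖) T)
    {s : ℝ} (hs : 0 < s)
    (h : MemLp (fun x => gradNorm ν x + ‖ν x‖ ^ 2) (ENNReal.ofReal s) (volume.restrict A)) :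
    ∫⁻ x in T, ENNReal.ofReal (1 + ‖ν x‖ ^ 2) ^ s ≠ ∞ := by
  have : IsFiniteMeasure (volume.restrict T) :=
    isFiniteMeasure_restrict.2 (ne_top_of_le_ne_top hA (measure_mono hTA))
  have h1 : MemLp (fun x => ‖ν x‖ ^ 2) (ENNReal.ofReal s) (volume.restrict T) :=
    (h.mono_measure (Measure.restrict_mono_set _ hTA)).mono
      ((hν.pow 2).aestronglyMeasurable hT) (Filter.Eventually.of_forall fun x => by
        have hg : 0 ≤ gradNorm ν x := Real.sqrt_nonneg _
        have hN : 0 ≤ ‖ν x‖ ^ 2 := by positivity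
        rw [Real.norm_of_nonneg hN, Real.norm_of_nonneg (by positivity)]
        linarith)
  have h2 : MemLp (fun x => 1 + ‖ν x‖ ^ 2) (ENNReal.ofReal s) (volume.restrict T) :=
    (memLp_const (1 : ℝ)).add h1
  have h3 := lintegral_rpow_enorm_lt_top_of_eLpNorm_lt_top
    (by simpa using hs) ENNReal.ofReal_ne_top h2.2
  rw [ENNReal.toReal_ofReal hs.le] at h3
  refine ne_top_of_le_ne_top h3.ne (lintegral_mono fun x => ?_)
  rw [Real.enorm_of_nonneg (by positivity)]

/-- The set where the bound fails is open in `V` and null, hence empty. -/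
theorem le_of_ae_le_of_continuousOn {T : Set V} (hT : IsOpen T) {Q : V → ℝ} (hQ : ContinuousOn Q T)
    {K : ℝ} (h : ∀ᵐ x ∂volume.restrict T, Q x ≤ K) : ∀ x ∈ T, Q x ≤ K := by
  intro x hx
  by_contra hcon
  have ho : IsOpen (T ∩ Q ⁻¹' Ioi K) := hQ.isOpen_inter_preimage hT isOpen_Ioi
  have h0 : volume (T ∩ Q ⁻¹' Ioi K) = 0 := by
    rw [ae_restrict_iff' hT.measurableSet] at h
    refine measure_mono_null (fun y hy => ?_) h
    intro h'
    exact not_le.2 hy.2 (h' hy.1)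
  have : x ∈ T ∩ Q ⁻¹' Ioi K := ⟨hx, not_le.1 hcon⟩
  rw [(ho.measure_eq_zero_iff volume).1 h0] at this
  exact this

end Main

theorem corollary7 (n : ℕ) (hn : 2 < n)
    {E : Type*} [NormedAddCommGroup E] [InnerProductSpace ℝ E] [FiniteDimensional ℝ E]
    -- the domain, the disc and the singular set
    (Ω S : Set (EuclideanSpace ℝ (Fin n))) (c : EuclideanSpace ℝ (Fin n)) (R : ℝ)
    (hΩo : IsOpen Ω) (hΩc : IsConnected Ω) (hΩb : Bornology.IsBounded Ω) (hΩA : IsTypeA Ω)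
    (hBΩ : Metric.ball c R ⊆ Ω) (hS : IsCompact S) (hSB : S ⊆ Metric.ball c R)
    -- the density
    (ρ : ℝ → ℝ) (κ q k : ℝ) (hκ : 0 < κ) (hq : 0 < q) (hk : 0 ≤ k)
    (hρc : ContinuousOn ρ (Ici 0)) (hρd : ContDiffOn ℝ 1 ρ (Ioi 0))
    (hρ : ∀ Q : ℝ, 0 < Q →
      κ⁻¹ * (Q + k) ^ q ≤ ρ Q + 2 * Q * deriv ρ Q ∧
      ρ Q + 2 * Q * deriv ρ Q ≤ κ * (Q + k) ^ q)
    -- the right-hand side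
    (ξ : (EuclideanSpace ℝ (Fin n) →L[ℝ] E) → E) (hξd : Differentiable ℝ ξ)
    (hξ : ∀ w, ‖fderiv ℝ ξ w‖ ≤ κ * (Qsq w + k) ^ q)
    -- the smooth solution away from the singular set
    (ω : EuclideanSpace ℝ (Fin n) → EuclideanSpace ℝ (Fin n) →L[ℝ] E)
    (ν : EuclideanSpace ℝ (Fin n) → EuclideanSpace ℝ (Fin n) →L[ℝ] E →L[ℝ] E)
    (hω : ContDiffOn ℝ (⊤ : ℕ∞) ω (Ω \ S)) (hν : ContDiffOn ℝ (⊤ : ℕ∞) ν (Ω \ S))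
    (hδ : ∀ x ∈ Ω \ S, codiff (fun y => ρ (Qsq (ω y)) • ω y) x = ξ (ω x))
    (hd : ∀ x ∈ Ω \ S, ∀ u v : EuclideanSpace ℝ (Fin n),
      dOne ω x ![u, v] = wedgeOne (ν x) (ω x) u v)
    -- codimension and integrability
    (hlarge : 4 < n →
      2 * (n : ℝ) / ((n : ℝ) - 2) < codimension S ∧
      MemLp ω (ENNReal.ofReal (n * (q + 1))) (volume.restrict (Metric.ball c R \ S)))
    (hsmall : n ≤ 4 →
      2 < codimension S ∧
      ∃ ε γ₁ γ₂ β : ℝ, 0 < ε ∧ ε < codimension S - 2 ∧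
        β = (codimension S - ε) / (codimension S - 2 - ε) ∧
        1 / 2 < γ₁ ∧ γ₁ < γ₂ ∧
        MemLp ω (ENNReal.ofReal (4 * (q + 1) * β * γ₁))
          (volume.restrict (Metric.ball c R \ S)) ∧
        MemLp ω (ENNReal.ofReal (4 * (q + 1) * γ₂))
          (volume.restrict (Metric.ball c R \ S)))
    (hνs : ∃ s : ℝ, (n : ℝ) / 2 < s ∧
      MemLp (fun x => gradNorm ν x + ‖ν x‖ ^ 2) (ENNReal.ofReal s)
        (volume.restrict (Metric.ball c R \ S))) :
    ∀ K : Set (EuclideanSpace ℝ (Fin n)), IsCompact K → K ⊆ Ω →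
      ∃ C : ℝ, ∀ x ∈ K \ S, ‖ω x‖ ≤ C := by
  have hωc : ContinuousOn ω (Ω \ S) := hω.continuousOn
  have hQc : ContinuousOn (fun x => Qsq (ω x)) (Ω \ S) := continuousOn_Qsq_comp hωc
  -- For a compact `K`, the set `K \ O` is compact and avoids `S`, so continuity bounds `ω` there.
  suffices hnear : ∃ O : Set (EuclideanSpace ℝ (Fin n)), IsOpen O ∧ S ⊆ O ∧
      ∃ C : ℝ, ∀ x ∈ O \ S, Qsq (ω x) ≤ C by
    obtain ⟨O, hO, hSO, C, hC⟩ := hnear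
    intro K hK hKΩ
    obtain ⟨C', hC'⟩ := (hK.diff hO).exists_bound_of_continuousOn
      (hωc.mono fun x hx => ⟨hKΩ hx.1, fun h => hx.2 (hSO h)⟩)
    refine ⟨max √C C', fun x hx => ?_⟩
    by_cases hxO : x ∈ O
    · exact (norm_le_sqrt_Qsq _).trans
        ((Real.sqrt_le_sqrt (hC x ⟨hxO, hx.2⟩)).trans (le_max_left _ _))
    · exact (hC' x ⟨hx.1, hxO⟩).trans (le_max_right _ _)
  rcases S.eq_empty_or_nonempty with rfl | hne
  · exact ⟨∅, isOpen_empty, subset_rfl, 0, by simp⟩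
  have hn' : (2 : ℝ) < n := by exact_mod_cast hn
  have hn2 : (0 : ℝ) < n - 2 := by linarith
  have hBfin : volume (Metric.ball c R \ S) ≠ ⊤ :=
    ne_top_of_le_ne_top measure_ball_lt_top.ne (measure_mono sdiff_subset)
  -- the balls around the singular set
  obtain ⟨R₁, hR₁R, hSR₁⟩ := exists_lt_subset_ball hS.isClosed hSB
  have hR₁ : 0 < R₁ := by
    obtain ⟨x, hx⟩ := hne
    exact Metric.pos_of_mem_ball (hSR₁ hx)
  obtain ⟨R₂, hR₁₂, hR₂R⟩ := exists_between hR₁R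
  let ψ : ContDiffBump c := ⟨R₁, R₂, hR₁, hR₁₂⟩
  have hψt : tsupport ψ = Metric.closedBall c R₂ := ψ.tsupport_eq
  set O := Metric.ball c R₁ with hO
  have hOB : O ⊆ Metric.ball c R := Metric.ball_subset_ball hR₁R.le
  have hOΩ : O ⊆ Ω := hOB.trans hBΩ
  have hOS : O \ S ⊆ Ω \ S := sdiff_subset_sdiff_left hOΩ
  have hOSo : IsOpen (O \ S) := Metric.isOpen_ball.sdiff hS.isClosed
  have hψΩ : tsupport ψ ⊆ Ω := by
    rw [hψt]
    exact (Metric.closedBall_subset_ball hR₂R).trans hBΩ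
  -- The gradient of `ψ` is confined to this compact annulus, which misses `S`; `Q` is bounded on it
  -- by continuity.
  obtain ⟨K₀, hK₀⟩ := ((isCompact_closedBall c R₂).diff
    (Metric.isOpen_ball (x := c) (ε := R₁))).exists_bound_of_continuousOn
    (hQc.mono fun x hx => ⟨hψΩ (hψt ▸ hx.1), fun h => hx.2 (hSR₁ h)⟩)
  -- the analytic estimates
  obtain ⟨l, u, hl, hu, hρ'⟩ := density_bounds hκ hq hk hρc hρd hρ
  obtain ⟨X, hX, hξ'⟩ := norm_le_of_fderiv_le hκ hq hk hξd hξ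
  obtain ⟨C, hC, HE⟩ := level_set_estimate (ν := ν) hn hq hl hu hX hρd hρ' hξ'
    (hΩo.sdiff hS.isClosed) (hω.of_le (WithTop.coe_le_coe.2 (le_top : (2 : ℕ∞) ≤ ⊤))) hδ hd
  obtain ⟨p, hp, hpS, hωp⟩ := exists_removability_exponent hBfin hq hlarge hsmall
  have hpn : p ≤ n := hpS.le.trans (codimension_le S)
  have hp2 : 0 < p - 2 := by linarith
  have hp0 : 0 < p := by linarith
  have hωO : MemLp ω (ENNReal.ofReal (2 * ((q + 1) * (p / (p - 2))))) (volume.restrict (O \ S)) :=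
    hωp.mono_measure (Measure.restrict_mono_set _ (sdiff_subset_sdiff_left hOB))
  have hOfin : volume (O \ S) ≠ ⊤ :=
    ne_top_of_le_ne_top hBfin (measure_mono (sdiff_subset_sdiff_left hOB))
  have hint₁ := lintegral_Qsq_rpow_ne_top (b := (q + 1) * (p / (p - 2))) hOfin (by positivity)
    le_rfl hωO
  -- The iteration needs the exponent `n/(n-2)`, which is at most `p/(p-2)` because `p ≤ codimension
  -- S ≤ n`.
  have hint₂ := lintegral_Qsq_rpow_ne_top (b := (q + 1) * (n / (n - 2))) hOfin (by positivity)
    (by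
      gcongr ?_ * ?_
      rw [div_le_div_iff₀ hn2 hp2]
      linarith) hωO
  obtain ⟨s, hs, hνs⟩ := hνs
  have hνc : ContinuousOn (fun x => ‖ν x‖) (O \ S) :=
    ContinuousOn.norm (E := EuclideanSpace ℝ (Fin n) →L[ℝ] E →L[ℝ] E) (hν.continuousOn.mono hOS)
  have H := level_set_estimate_across (ν := ν) hn (O := O) (K₀ := max K₀ 1) hS hne hp hpS hωc HE
    ψ.contDiff ψ.hasCompactSupport hψΩ Metric.isOpen_ball hOΩ
    (fun x hx => ψ.one_of_mem_closedBall (Metric.ball_subset_closedBall hx)) (le_max_right _ _)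
    (fun x hx => (le_trans (Real.le_norm_self _) (hK₀ x (hψt ▸ hx))).trans (le_max_left _ _))
    (by
      convert hint₁ using 4 with x
      rw [ENNReal.ofReal_rpow_of_nonneg (Real.rpow_nonneg (Qsq_nonneg _) _) (by positivity),
        ← Real.rpow_mul (Qsq_nonneg _)])
  obtain ⟨M, hM⟩ := ae_bounded_of_level_set_estimate (f := fun x => 1 + ‖ν x‖ ^ 2)
    ((hQc.mono hOS).aemeasurable hOSo.measurableSet) (fun x => Qsq_nonneg (ω x))
    ((continuousOn_const.add (hνc.pow 2)).aemeasurable hOSo.measurableSet) hn' hq hs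
    (le_max_right _ _) hC
    (lintegral_one_add_norm_sq_rpow_ne_top hBfin (sdiff_subset_sdiff_left hOB) hOSo.measurableSet
      hνc (by linarith) hνs)
    (by
      refine ne_of_eq_of_ne (lintegral_congr fun x => ?_) hint₂
      rw [ENNReal.ofReal_rpow_of_nonneg (Real.rpow_nonneg (Qsq_nonneg _) _) (by positivity),
        ← Real.rpow_mul (Qsq_nonneg _)]
      congr 2
      ring) H
  exact ⟨O, Metric.isOpen_ball, hSR₁, M, le_of_ae_le_of_continuousOn hOSo (hQc.mono hOS) hM⟩
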